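/- **Conventions.** A partition is a non-increasing sequence $\lambda=(\lambda_1,\lambda_2,\dots)$ of non-negative integers with finitely many non-zero terms (its parts); it is strict if its parts are pairwise distinct. A partition is identified with its Young diagram, and $|\lambda|$ is its number of nodes. A node in column $j\ge 1$ has color $0$ if $j\equiv 0,1 \pmod 4$ and color $1$ if $j\equiv 2,3\pmod 4$. For a partition $\lambda$, let $I_i^{\ell}(\lambda)$ be the set of strict partitions $\mu\supset\lambda$ with $|\mu|=|\lambda|+\ell$ such that all nodes of $\mu\setminus\lambda$ have color $i$. Put $c_m=(4m-3,\dots,5,1)$ for $m>0$, $c_0=\emptyset$, and $c_m=(-4m-1,\dots,7,3)$ for $m<0$. Let $\square(a,b)$ be the rectangular partition $(b^a)$ with $a$ rows of length $b$. *4-bar quotient.* For a strict partition $\mu$, let $\mu[0]$ be the strict partition whose parts are the numbers $k\geq 1$ such that $2k$ is a part of $\mu$. Let $$\mathcal M(\mu)=\{k\ge 0: 4k+1 \text{ is a part of }\mu\}\ \cup\ \bigl(\mathbb Z_{<0}\setminus\{-k-1: k\ge 0,\ 4k+3\text{ is a part of }\mu\}\bigr),$$ with elements $i_1>i_2>i_3>\cdots$,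 and let $e$ be the number of parts of $\mu$ congruent to $1$ modulo $4$ minus the number of parts congruent to $3$ modulo $4$. Then $\mu[1]$ is the partition $(i_1+1-e,\,i_2+2-e,\,i_3+3-e,\dots)$. *Sign.* For $\mu\in I_i^{\ell}(c_m)$, let $E$ be the set of even parts of $\mu$, together with $0$ if and only if $m<0$ and $\mu_{-m+1}=0$. Let $g(\mu)$ be the number of pairs $(a,b)$ with $a\in E$, $b$ a part of $\mu$, $b\equiv 1\pmod 4$ and $b>a$. Put $\delta(\mu)=(-1)^{g(\mu)}$. *Schur functions.* In $\mathbb C[t_1,t_2,t_3,\dots]$ define $h_n(t)$ and $q_n(t)$ by $\exp\bigl(\sum_{n\ge1}t_nz^n\bigr)=\sum_{n\ge0}h_n(t)z^n$ and $\exp\bigl(\sum_{n\ge1}t_{2n-1}z^{2n-1}\bigr)=\sum_{n\ge0}q_n(t)z^n$, with $h_n=0$ for $n<0$. For a partition $\lambda$ of length $r$ put $S_\lambda(t)=\det\bigl(h_{\lambda_i+j-i}(t)\bigr)_{1\le i,j\le r}$, and let $S_\lambda(t^{(2)})$ be obtained from $S_\lambda(t)$ by substituting $t_j\mapsto t_{2j}$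 for all $j$. For $a>b\ge0$ put $Q_{a,b}(t)=q_a(t)q_b(t)+2\sum_{i=1}^{b}(-1)^iq_{a+i}(t)q_{b-i}(t)$, $Q_{b,a}=-Q_{a,b}$ and $Q_{a,a}=0$. For a strict partition written with an even number of entries $\lambda=(\lambda_1>\cdots>\lambda_{2k}\ge0)$ (appending one $0$ if its length is odd), put $Q_\lambda(t)=\mathrm{Pf}\bigl(Q_{\lambda_i,\lambda_j}(t)\bigr)_{1\le i,j\le 2k}$. **Theorem (mixed expansion formulas).** For all non-negative integers $m$ and $n$, the following identities hold in $\mathbb C[t_1,t_2,t_3,\dots]$: $$\sum_{\mu\in I_1^n(c_m)}\delta(\mu)\,Q_{\mu[0]}(t)\,S_{\mu[1]}(t^{(2)})=S_{\square(2m-n,\,n)}(t),$$ $$\sum_{\mu\in I_0^n(c_{-m})}\delta(\mu)\,Q_{\mu[0]}(t)\,S_{\mu[1]}(t^{(2)})=S_{\square(n,\,2m+1-n)}(t),$$ where the right-hand side of the first identity is read as $0$ if $n>2m$, and that of the second as $0$ if $n>2m+1$. -/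

import Mathlib

/-!
Partitions are Mathlib's Young diagrams (English convention). All indices are shifted to start
at `0`: the part `λ_{i+1}` of a partition `λ` is `λ.rowLen i` (which is `0` beyond the last part),
the length of `λ` is `λ.colLen 0`, its weight is `λ.card`, and a node in row `i+1` and
column `j+1` is the pair `(i, j)`.
-/

namespace MixedExpansion

noncomputable section

/-! ### Partitions -/

/-- The partition `(f 0, f 1, f 2, …)` given by a non-increasing sequence that vanishes from
some index `N` on. -/
def ofSeq (f : ℕ → ℕ) (hf : Antitone f) (hN : ∃ N, ∀ k, N ≤ k → f k = 0) : YoungDiagram where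
  cells := (Finset.range hN.choose ×ˢ Finset.range (f 0)).filter fun x => x.2 < f x.1
  isLowerSet := by
    rintro ⟨i, j⟩ ⟨i', j'⟩ ⟨hi, hj⟩ h
    simp only [Finset.coe_filter, Finset.mem_product, Finset.mem_range, Set.mem_ofPred_eq]
      at h hi hj ⊢
    have := hf hi
    exact ⟨⟨by omega, by omega⟩, by omega⟩

theorem rowLen_ofSeq (f : ℕ → ℕ) (hf : Antitone f) (hN : ∃ N, ∀ k, N ≤ k → f k = 0) (i : ℕ) :
    (ofSeq f hf hN).rowLen i = f i := by
  have key : ∀ j, (i, j) ∈ ofSeq f hf hN ↔ j < f i := by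
    intro j
    rw [← YoungDiagram.mem_cells]
    simp only [ofSeq, Finset.mem_filter, Finset.mem_product, Finset.mem_range]
    refine ⟨fun h => h.2, fun h => ⟨⟨?_, h.trans_le (hf (Nat.zero_le i))⟩, h⟩⟩
    by_contra hc
    have := hN.choose_spec i (not_lt.mp hc)
    omega
  have h1 := key (f i)
  have h2 := key ((ofSeq f hf hN).rowLen i)
  rw [YoungDiagram.mem_iff_lt_rowLen] at h1 h2
  omega

/-- A partition is strict if all its parts are distinct. -/
def IsStrict (μ : YoungDiagram) : Prop := μ.rowLens.Nodup

/-- The set of parts of a partition. -/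
def parts (μ : YoungDiagram) : Finset ℕ := μ.rowLens.toFinset

theorem rect_antitone (a b : ℕ) : Antitone fun i => if i < a then b else 0 := by
  intro i j h
  dsimp only
  split_ifs <;> omega

/-- The rectangle with `a` rows of length `b`. -/
def rect (a b : ℕ) : YoungDiagram :=
  ofSeq (fun i => if i < a then b else 0) (rect_antitone a b)
    ⟨a, fun k hk => by simp [not_lt.mpr hk]⟩

/-- The color of a node: `0` if its column number is `0` or `1` modulo `4`, and `1` otherwise. -/
def color (x : ℕ × ℕ) : ℕ := if (x.2 + 1) % 4 = 0 ∨ (x.2 + 1) % 4 = 1 then 0 else 1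

/-- The strict partitions obtained from `lam` by adding `l` nodes, all of color `i`. -/
def addSet (i l : ℕ) (lam : YoungDiagram) : Set YoungDiagram :=
  {μ | IsStrict μ ∧ lam ≤ μ ∧ μ.card = lam.card + l ∧ ∀ x ∈ μ.cells \ lam.cells, color x = i}

theorem addSet_finite (i l : ℕ) (lam : YoungDiagram) : (addSet i l lam).Finite := by
  set N := lam.card + l with hN
  have inj : Function.Injective YoungDiagram.cells := fun a b h => YoungDiagram.ext h
  refine Set.Finite.of_finite_image (f := YoungDiagram.cells) ?_ inj.injOn
  refine (Finset.finite_toSet (Finset.range N ×ˢ Finset.range N).powerset).subset ?_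
  rintro _ ⟨μ, ⟨-, -, hc, -⟩, rfl⟩
  simp only [Finset.coe_powerset, Set.mem_preimage, Set.mem_powerset_iff, Finset.coe_subset]
  rintro ⟨a, b⟩ hab
  have hab' : (a, b) ∈ μ := (YoungDiagram.mem_cells _).1 hab
  have h1 : μ.rowLen a ≤ N := by
    rw [YoungDiagram.rowLen_eq_card, hN, ← hc]
    exact Finset.card_le_card (Finset.filter_subset _ _)
  have h2 : μ.colLen b ≤ N := by
    rw [YoungDiagram.colLen_eq_card, hN, ← hc]
    exact Finset.card_le_card (Finset.filter_subset _ _)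
  have h3 := YoungDiagram.mem_iff_lt_rowLen.1 hab'
  have h4 := YoungDiagram.mem_iff_lt_colLen.1 hab'
  simp only [Finset.mem_product, Finset.mem_range]
  omega

/-- `I_i^l(lam)` as a finite set. -/
def addFinset (i l : ℕ) (lam : YoungDiagram) : Finset YoungDiagram := (addSet_finite i l lam).toFinset

theorem core_antitone (m : ℤ) : Antitone fun i : ℕ =>
    if i < m.natAbs then 4 * (m.natAbs - i) - (if 0 < m then 3 else 1) else 0 := by
  intro i j h
  dsimp only
  split_ifs <;> omega

/-- The 4-bar cores `c_m`: `(4m-3, …, 5, 1)` for `m > 0`, empty for `m = 0`, and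
`(-4m-1, …, 7, 3)` for `m < 0`. -/
def core (m : ℤ) : YoungDiagram :=
  ofSeq (fun i => if i < m.natAbs then 4 * (m.natAbs - i) - (if 0 < m then 3 else 1) else 0)
    (core_antitone m)
    ⟨m.natAbs, fun k hk => by simp [not_lt.mpr hk]⟩

/-! ### The 4-bar quotient -/

/-- `μ[0]`: the partition whose parts are the halves of the even parts of `μ`. -/
def quot0 (μ : YoungDiagram) : YoungDiagram :=
  YoungDiagram.ofRowLens ((((parts μ).filter fun a => a % 2 = 0).image fun a => a / 2).sort (· ≥ ·))
    (Finset.pairwise_sort _ _).sortedGE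

/-- The Maya diagram of `μ`. -/
def maya (μ : YoungDiagram) : Set ℤ :=
  {x | ∃ k : ℕ, 4 * k + 1 ∈ parts μ ∧ x = k} ∪
    ({x | x < 0} \ {x | ∃ k : ℕ, 4 * k + 3 ∈ parts μ ∧ x = -k - 1})

/-- The charge of the Maya diagram. -/
def charge (μ : YoungDiagram) : ℤ :=
  (((parts μ).filter fun a => a % 4 = 1).card : ℤ) - ((parts μ).filter fun a => a % 4 = 3).card

/-- `B - n` is a member of the Maya diagram, where `B`, the largest part of `μ`, is an upper bound
of the Maya diagram. -/
def mayaPred (μ : YoungDiagram) (n : ℕ) : Prop := (μ.rowLen 0 : ℤ) - n ∈ maya μ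

/-- The elements of the Maya diagram in descending order. -/
def mayaSeq (μ : YoungDiagram) (k : ℕ) : ℤ := (μ.rowLen 0 : ℤ) - Nat.nth (mayaPred μ) k

theorem le_of_mem_parts {μ : YoungDiagram} {a : ℕ} (h : a ∈ parts μ) : a ≤ μ.rowLen 0 := by
  simp only [parts, YoungDiagram.rowLens, List.mem_toFinset, List.mem_map] at h
  obtain ⟨i, -, rfl⟩ := h
  exact μ.rowLen_anti 0 i (Nat.zero_le i)

theorem mayaPred_of_lt (μ : YoungDiagram) {n : ℕ} (h : 2 * μ.rowLen 0 < n) : mayaPred μ n := by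
  right
  refine ⟨by simp only [Set.mem_ofPred_eq]; omega, ?_⟩
  rintro ⟨k, hk, hx⟩
  have := le_of_mem_parts hk
  omega

theorem mayaPred_infinite (μ : YoungDiagram) : (Set.ofPred (mayaPred μ)).Infinite :=
  Set.infinite_of_not_bddAbove fun ⟨b, hb⟩ => by
    have := hb (show mayaPred μ (2 * μ.rowLen 0 + b + 1) from mayaPred_of_lt μ (by omega))
    omega

theorem mayaSeq_strictAnti (μ : YoungDiagram) : StrictAnti (mayaSeq μ) := fun a b h => by
  have := Nat.nth_strictMono (mayaPred_infinite μ) h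
  simp only [mayaSeq]
  omega

theorem range_mayaSeq (μ : YoungDiagram) : Set.range (mayaSeq μ) = maya μ := by
  ext x
  constructor
  · rintro ⟨k, rfl⟩
    exact Nat.nth_mem_of_infinite (mayaPred_infinite μ) k
  · intro hx
    have hle : x ≤ μ.rowLen 0 := by
      rcases hx with ⟨k, hk, rfl⟩ | ⟨hx, -⟩
      · have := le_of_mem_parts hk
        omega
      · simp only [Set.mem_ofPred_eq] at hx
        omega
    have hp : mayaPred μ (μ.rowLen 0 - x).toNat := by
      have h : (μ.rowLen 0 : ℤ) - ((μ.rowLen 0 - x).toNat : ℕ) = x := by omega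
      rw [mayaPred, h]
      exact hx
    have hr : (μ.rowLen 0 - x).toNat ∈ Set.range (Nat.nth (mayaPred μ)) := by
      rw [Nat.range_nth_of_infinite (mayaPred_infinite μ)]
      exact hp
    obtain ⟨k, hk⟩ := hr
    refine ⟨k, ?_⟩
    simp only [mayaSeq, hk]
    omega

open Classical in
theorem count_mayaPred (μ : YoungDiagram) (j : ℕ) :
    (Nat.count (mayaPred μ) (2 * μ.rowLen 0 + 1 + j) : ℤ) = μ.rowLen 0 + charge μ + j := by
  induction j with
  | succ j ih =>
    rw [← Nat.add_assoc, Nat.count_succ, if_pos (mayaPred_of_lt μ (by omega))]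
    push_cast
    omega
  | zero =>
    set B := μ.rowLen 0 with hB
    rw [Nat.count_eq_card_filter_range]
    have e1 : ((Finset.range (B + 1)).filter (mayaPred μ)).card
        = ((parts μ).filter fun a => a % 4 = 1).card := by
      refine Finset.card_bij' (fun n _ => 4 * (B - n) + 1) (fun a _ => B - a / 4) ?_ ?_ ?_ ?_
      · intro n hn
        simp only [Finset.mem_filter, Finset.mem_range] at hn ⊢
        obtain ⟨h1, ⟨k, hk, hx⟩ | ⟨hx, -⟩⟩ := hn
        · have : k = B - n := by omega
          subst this
          exact ⟨hk, by omega⟩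
        · simp only [Set.mem_ofPred_eq] at hx
          omega
      · intro a ha
        simp only [Finset.mem_filter, Finset.mem_range] at ha ⊢
        have := le_of_mem_parts ha.1
        refine ⟨by omega, Or.inl ⟨a / 4, ?_, by omega⟩⟩
        rw [show 4 * (a / 4) + 1 = a by omega]
        exact ha.1
      · intro n hn
        simp only [Finset.mem_filter, Finset.mem_range] at hn
        omega
      · intro a ha
        simp only [Finset.mem_filter] at ha
        have := le_of_mem_parts ha.1
        omega
    have e2 : ((Finset.Ico (B + 1) (2 * B + 1)).filter fun n => ¬ mayaPred μ n).card
        = ((parts μ).filter fun a => a % 4 = 3).card := by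
      refine Finset.card_bij' (fun n _ => 4 * (n - B - 1) + 3) (fun a _ => B + 1 + a / 4) ?_ ?_ ?_ ?_
      · intro n hn
        simp only [Finset.mem_filter, Finset.mem_Ico] at hn ⊢
        refine ⟨?_, by omega⟩
        by_contra hc
        refine hn.2 (Or.inr ⟨by simp only [Set.mem_ofPred_eq]; omega, ?_⟩)
        rintro ⟨k, hk, hx⟩
        have : k = n - B - 1 := by omega
        subst this
        exact hc hk
      · intro a ha
        simp only [Finset.mem_filter, Finset.mem_Ico] at ha ⊢
        have := le_of_mem_parts ha.1
        refine ⟨by omega, ?_⟩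
        rintro (⟨k, hk, hx⟩ | ⟨-, hx⟩)
        · omega
        · refine hx ⟨a / 4, ?_, by omega⟩
          rw [show 4 * (a / 4) + 3 = a by omega]
          exact ha.1
      · intro n hn
        simp only [Finset.mem_filter, Finset.mem_Ico] at hn
        omega
      · intro a ha
        simp only [Finset.mem_filter] at ha
        omega
    have e3 := Finset.card_filter_add_card_filter_not (s := Finset.Ico (B + 1) (2 * B + 1))
      (mayaPred μ)
    have e4 : ((Finset.range (2 * B + 1 + 0)).filter (mayaPred μ)).card
        = ((Finset.range (B + 1)).filter (mayaPred μ)).card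
          + ((Finset.Ico (B + 1) (2 * B + 1)).filter (mayaPred μ)).card := by
      rw [← Finset.card_union_of_disjoint, ← Finset.filter_union]
      · congr 2
        ext n
        simp only [Finset.mem_range, Finset.mem_union, Finset.mem_Ico]
        omega
      · refine Finset.disjoint_filter_filter ?_
        rw [Finset.disjoint_left]
        intro n h1 h2
        simp only [Finset.mem_range, Finset.mem_Ico] at h1 h2
        omega
    rw [Nat.card_Ico] at e3
    have e5 : ((((Finset.range (2 * B + 1 + 0)).filter (mayaPred μ)).card : ℕ) : ℤ)
        = B + charge μ := by
      rw [e4, charge]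
      push_cast
      omega
    rw [Nat.cast_zero, add_zero, ← e5]
    congr!

/-- From some index on, the elements `i_1 > i_2 > …` of the Maya diagram are `i_k = -k + m`. -/
theorem mayaSeq_eventually (μ : YoungDiagram) :
    ∃ N : ℕ, ∀ k, N ≤ k → mayaSeq μ k + (k + 1) - charge μ = 0 := by
  classical
  refine ⟨(μ.rowLen 0 + charge μ).toNat, fun k hk => ?_⟩
  have h0 := count_mayaPred μ 0
  obtain ⟨j, hj⟩ : ∃ j : ℕ, (k : ℤ) = μ.rowLen 0 + charge μ + j :=
    ⟨(k - (μ.rowLen 0 + charge μ)).toNat, by omega⟩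
  have hc : Nat.count (mayaPred μ) (2 * μ.rowLen 0 + 1 + j) = k := by
    have := count_mayaPred μ j
    omega
  have hn := Nat.nth_count (p := mayaPred μ) (n := 2 * μ.rowLen 0 + 1 + j)
    (mayaPred_of_lt μ (by omega))
  rw [hc] at hn
  simp only [mayaSeq, hn]
  push_cast
  omega

theorem mayaSeq_antitone (μ : YoungDiagram) :
    Antitone fun k : ℕ => mayaSeq μ k + (k + 1) - charge μ := by
  refine antitone_nat_of_succ_le fun k => ?_
  have := mayaSeq_strictAnti μ (Nat.lt_add_one k)
  push_cast
  omega

theorem quot1_antitone (μ : YoungDiagram) :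
    Antitone fun k : ℕ => (mayaSeq μ k + (k + 1) - charge μ).toNat :=
  fun _ _ h => Int.toNat_le_toNat (mayaSeq_antitone μ h)

theorem quot1_eventually (μ : YoungDiagram) :
    ∃ N, ∀ k : ℕ, N ≤ k → (mayaSeq μ k + (k + 1) - charge μ).toNat = 0 :=
  (mayaSeq_eventually μ).imp fun _ h k hk => by rw [h k hk, Int.toNat_zero]

/-- `μ[1] = (i_1 + 1 - m, i_2 + 2 - m, …)`, where `i_1 > i_2 > …` are the elements of the Maya
diagram and `m` is the charge. -/
def quot1 (μ : YoungDiagram) : YoungDiagram :=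
  ofSeq (fun k => (mayaSeq μ k + (k + 1) - charge μ).toNat)
    (quot1_antitone μ) (quot1_eventually μ)

/-- The integers `i_k + k - m` are non-negative, so nothing is lost by `Int.toNat` above. -/
theorem rowLen_quot1 (μ : YoungDiagram) (k : ℕ) :
    ((quot1 μ).rowLen k : ℤ) = mayaSeq μ k + (k + 1) - charge μ := by
  rw [quot1, rowLen_ofSeq, Int.toNat_of_nonneg]
  obtain ⟨N, hN⟩ := mayaSeq_eventually μ
  have h1 := mayaSeq_antitone μ (le_max_left k N)
  have h2 := hN _ (le_max_right k N)
  simp only at h1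
  omega

/-! ### The sign -/

/-- The positions of the beads on the leftmost runner of the 4-bar abacus of `μ ∈ I_i^l(c_m)`: the
even parts of `μ`, and also `0` if and only if `m < 0` and `μ_{-m+1} = 0`. -/
def leftBeads (m : ℤ) (μ : YoungDiagram) : Finset ℕ :=
  ((parts μ).filter fun a => a % 2 = 0) ∪
    (if m < 0 ∧ μ.rowLen (-m).toNat = 0 then {0} else ∅)

/-- The positions of the beads on the central runner. -/
def centralBeads (μ : YoungDiagram) : Finset ℕ := (parts μ).filter fun a => a % 4 = 1

/-- The sign of `μ ∈ I_i^l(c_m)`. -/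
def sign (m : ℤ) (μ : YoungDiagram) : ℤ :=
  (-1) ^ ((leftBeads m μ ×ˢ centralBeads μ).filter fun x => x.1 < x.2).card

/-! ### Schur functions -/

section Schur

variable {A : Type*} [CommRing A] [Algebra ℚ A]

/-- `h_n(t)`, the coefficient of `z ^ n` in `exp (∑_{k ≥ 1} t_k z ^ k)`. -/
def hPoly (t : ℕ+ → A) (n : ℕ) : A :=
  PowerSeries.coeff n ((PowerSeries.exp A).subst
    (PowerSeries.mk fun k => if h : 0 < k then t (Nat.toPNat k h) else 0))

/-- The Schur function `S_lam(t) = det (h_{lam_i + j - i}(t))`, where `h_n = 0` for `n < 0`. -/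
def schurS (lam : YoungDiagram) (t : ℕ+ → A) : A :=
  Matrix.det (Matrix.of fun i j : Fin (lam.colLen 0) =>
    if (lam.rowLen i : ℤ) + j - i < 0 then 0 else hPoly t ((lam.rowLen i : ℤ) + j - i).toNat)

/-- `q_n(t)`, the coefficient of `z ^ n` in `exp (∑_{k odd} t_k z ^ k)`. -/
def qPoly (t : ℕ+ → A) (n : ℕ) : A :=
  PowerSeries.coeff n ((PowerSeries.exp A).subst
    (PowerSeries.mk fun k => if h : Odd k then t (Nat.toPNat k h.pos) else 0))

/-- `Q_{m,n}(t)` for `m > n`. -/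
def QPairAux (t : ℕ+ → A) (m n : ℕ) : A :=
  qPoly t m * qPoly t n +
    2 * ∑ i ∈ Finset.Icc 1 n, (-1) ^ i * qPoly t (m + i) * qPoly t (n - i)

/-- `Q_{m,n}(t)`, extended to all `m`, `n` by skew-symmetry. -/
def QPair (t : ℕ+ → A) (m n : ℕ) : A :=
  if n < m then QPairAux t m n else if m < n then -QPairAux t n m else 0

/-- The Pfaffian of a skew-symmetric matrix of even size, by expansion along the first row. -/
def pfaffian : (n : ℕ) → Matrix (Fin (2 * n)) (Fin (2 * n)) A → A
  | 0, _ => 1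
  | n + 1, M => ∑ j : Fin (2 * n + 1), (-1) ^ (j : ℕ) * M 0 j.succ *
      pfaffian n (M.submatrix (fun i => (j.succAbove i).succ) (fun i => (j.succAbove i).succ))

/-- The Schur `Q`-function of a strict partition `lam = (lam_1, …, lam_{2k})`, written with an even
number of entries by appending a `0` if its length is odd. -/
def schurQ (lam : YoungDiagram) (t : ℕ+ → A) : A :=
  pfaffian ((lam.colLen 0 + 1) / 2) (Matrix.of fun i j => QPair t (lam.rowLen i) (lam.rowLen j))

end Schur

/-- The variables `t = (t_1, t_2, t_3, …)` of the polynomial ring `ℂ[t_1, t_2, t_3, …]`. -/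
def tVar : ℕ+ → MvPolynomial ℕ+ ℂ := MvPolynomial.X

end

end MixedExpansion

/-! Both identities are instances of one expansion of the determinant of `h_{N-a+j-i}(t)` of size
`a`: the first with `N = 2m`, `a = 2m - n`, the second with `N = 2m + 1`, `a = n`. The expansion
comes from evaluating one Pfaffian functional in two ways.

Let K be the array of coefficients of q(x) q(y) (x - y)/(x + y), the two expansions of the rational
function being averaged. Because q(z) q(-z) = 1, K(a, b) is Q_{a,b} for non-negative indices, and
apart from these it is non-zero only on a + b = 0, where it is ±1. The functional `fock` on the
exterior algebra over vectors e_b (b an integer), with one auxiliary vector to complete products of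
odd length, takes Pfaffians of K as values.

First evaluation (`fock_ιMulti_momentVec`). The relation (x + y) K = (x - y) q(x) q(y), that is
`kernel_add_one`, persists when K is multiplied by a series in x² times a series in y².
Multiplication by the generating series of h_n(t^{(2)}) in these variables replaces q by h, since
h(z) = q(z) h^{(2)}(z²). For every array subject to such a relation, the Pfaffian of the entries
with even indices is a Hankel determinant up to sign (`pfaffian_eq_hankel`,
`pfaffian_eq_hankel_odd`): Schur's Pfaffian identity is transported to linear functionals on
polynomials and tested on a Vandermonde product. The Hankel determinant of the h_n, with columns
reversed, is the rectangular Schur function.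

Second evaluation (`det_rect_eq_sum`). Multilinearity gives a sum over `a`-subsets of `N` positions,
position x carrying the index 2x - (N - 1); the coefficients are minors of h_n(t^{(2)}), which are
the S_{μ[1]} up to sign. On a product of basis vectors `fock` vanishes if some negative index b
occurs without -b (`fockSet_eq_zero`); otherwise the pairs {b, -b} cancel at the cost of a sign and
the remaining indices give Q_{μ[0]} (`fockSet_eq_unpaired`).

The surviving subsets are the partitions of the theorem: row i has length 2b - 1, 2b or 2b + 1 with
b = N - 1 - 2i, and these lengths encode the three admissible states of {b, -b}, namely both, only
b, or neither. All signs combine to δ(μ) in `IsBarShape.term_eq`. -/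

namespace MixedExpansion

noncomputable section

/-! ### Generating functions -/

section GeneratingFunctions

open PowerSeries

variable {A : Type*} [CommRing A]

/-- The exponent `∑_{k ≥ 1} t_k z ^ k`. -/
def hExponent (t : ℕ+ → A) : PowerSeries A :=
  PowerSeries.mk fun k => if h : 0 < k then t (Nat.toPNat k h) else 0

/-- The exponent `∑_{k odd} t_k z ^ k`. -/
def qExponent (t : ℕ+ → A) : PowerSeries A :=
  PowerSeries.mk fun k => if h : Odd k then t (Nat.toPNat k h.pos) else 0

theorem constantCoeff_hExponent (t : ℕ+ → A) : constantCoeff (hExponent t) = 0 := by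
  rw [← coeff_zero_eq_constantCoeff_apply, hExponent, coeff_mk]
  simp

theorem constantCoeff_qExponent (t : ℕ+ → A) : constantCoeff (qExponent t) = 0 := by
  rw [← coeff_zero_eq_constantCoeff_apply, qExponent, coeff_mk]
  simp

theorem hExponent_eq (t : ℕ+ → A) :
    hExponent t = qExponent t + (hExponent fun j => t (2 * j)).subst (X ^ 2 : PowerSeries A) := by
  ext k
  rw [map_add, coeff_subst_X_pow two_ne_zero]
  simp only [hExponent, qExponent, coeff_mk, Algebra.algebraMap_self, RingHom.id_apply]
  by_cases hk : Odd k
  · have h2 : ¬ 2 ∣ k := by rw [← even_iff_two_dvd]; exact Nat.not_even_iff_odd.mpr hk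
    rw [dif_pos hk.pos, dif_pos hk, if_neg h2, add_zero]
  · have h2 : 2 ∣ k := by rw [← even_iff_two_dvd]; exact Nat.not_odd_iff_even.mp hk
    rw [dif_neg hk, if_pos h2, zero_add]
    obtain ⟨r, rfl⟩ := h2
    rcases Nat.eq_zero_or_pos r with rfl | hr
    · simp
    · have e : 2 * r / 2 = r := by omega
      rw [dif_pos (by omega), dif_pos (by omega)]
      congr 1
      apply PNat.eq
      change 2 * r = 2 * (2 * r / 2)
      omega

variable [Algebra ℚ A]

theorem constantCoeff_exp_subst {f : PowerSeries A} (hf : constantCoeff f = 0) :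
    constantCoeff ((PowerSeries.exp A).subst f : PowerSeries A) = 1 := by
  have h : PowerSeries.exp A = 1 + (PowerSeries.exp A - 1) := by ring
  have hs := HasSubst.of_constantCoeff_zero' hf
  rw [h, subst_add hs, ← coe_substAlgHom hs, map_one, map_add, coe_substAlgHom hs]
  have := constantCoeff_subst_eq_zero (R := A) (a := f) hf (PowerSeries.exp A - 1) (by simp)
  rw [show constantCoeff (1 : PowerSeries A) = 1 from map_one _]
  exact (congrArg (1 + ·) this).trans (add_zero 1)

theorem derivative_exp_subst {f : PowerSeries A} (hf : constantCoeff f = 0) :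
    derivative A ((PowerSeries.exp A).subst f : PowerSeries A)
      = (PowerSeries.exp A).subst f * derivative A f := by
  rw [derivative_subst (HasSubst.of_constantCoeff_zero' hf), derivative_exp]

theorem exp_subst_mul_neg [IsAddTorsionFree A] {f : PowerSeries A} (hf : constantCoeff f = 0) :
    ((PowerSeries.exp A).subst f : PowerSeries A) * (PowerSeries.exp A).subst (-f) = 1 := by
  have hf' : constantCoeff (-f) = 0 := by simp [hf]
  refine derivative.ext ?_ ?_
  · rw [Derivation.leibniz, derivative_exp_subst hf, derivative_exp_subst hf', derivative_one,
      map_neg, smul_eq_mul, smul_eq_mul]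
    ring
  · rw [map_mul, constantCoeff_exp_subst hf, constantCoeff_exp_subst hf', map_one, mul_one]

/-- The product exp(f + g) exp(-f) exp(-g) has zero derivative and constant term 1, so it is 1. -/
theorem exp_subst_add [IsAddTorsionFree A] {f g : PowerSeries A} (hf : constantCoeff f = 0)
    (hg : constantCoeff g = 0) :
    ((PowerSeries.exp A).subst (f + g) : PowerSeries A)
      = (PowerSeries.exp A).subst f * (PowerSeries.exp A).subst g := by
  have hf' : constantCoeff (-f) = 0 := by simp [hf]
  have hg' : constantCoeff (-g) = 0 := by simp [hg]
  have hfg : constantCoeff (f + g) = 0 := by simp [hf, hg]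
  have key : ((PowerSeries.exp A).subst (f + g) : PowerSeries A)
      * ((PowerSeries.exp A).subst (-f) * (PowerSeries.exp A).subst (-g)) = 1 := by
    refine derivative.ext ?_ ?_
    · simp only [Derivation.leibniz, derivative_exp_subst hf', derivative_exp_subst hg',
        derivative_exp_subst hfg, derivative_one, map_neg, map_add, smul_eq_mul]
      ring
    · rw [map_mul, map_mul, constantCoeff_exp_subst hfg, constantCoeff_exp_subst hf',
        constantCoeff_exp_subst hg', map_one, mul_one, mul_one]
  have h1 := exp_subst_mul_neg hf
  have h2 := exp_subst_mul_neg hg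
  linear_combination ((PowerSeries.exp A).subst f * (PowerSeries.exp A).subst g) * key
    - (PowerSeries.exp A).subst (f + g) * h1 *
      ((PowerSeries.exp A).subst g * (PowerSeries.exp A).subst (-g))
    - (PowerSeries.exp A).subst (f + g) * h2

theorem hPoly_zero (t : ℕ+ → A) : hPoly t 0 = 1 := by
  have := constantCoeff_exp_subst (constantCoeff_hExponent t)
  rwa [← coeff_zero_eq_constantCoeff_apply] at this

theorem qPoly_zero (t : ℕ+ → A) : qPoly t 0 = 1 := by
  have := constantCoeff_exp_subst (constantCoeff_qExponent t)
  rwa [← coeff_zero_eq_constantCoeff_apply] at this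

theorem exp_subst_subst_X_sq {f : PowerSeries A} (hf : constantCoeff f = 0) :
    ((PowerSeries.exp A).subst (f.subst (X ^ 2 : PowerSeries A)) : PowerSeries A)
      = PowerSeries.subst (X ^ 2 : PowerSeries A) ((PowerSeries.exp A).subst f : PowerSeries A) :=
  (subst_comp_subst_apply (HasSubst.of_constantCoeff_zero' hf) (HasSubst.X_pow two_ne_zero)
    _).symm

theorem hPoly_series_eq [IsAddTorsionFree A] (t : ℕ+ → A) :
    ((PowerSeries.exp A).subst (hExponent t) : PowerSeries A)
      = (PowerSeries.exp A).subst (qExponent t) *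
        PowerSeries.subst (X ^ 2 : PowerSeries A)
          ((PowerSeries.exp A).subst (hExponent fun j => t (2 * j)) : PowerSeries A) := by
  rw [hExponent_eq, exp_subst_add (constantCoeff_qExponent t),
    exp_subst_subst_X_sq (constantCoeff_hExponent _)]
  rw [← coeff_zero_eq_constantCoeff_apply, coeff_subst_X_pow two_ne_zero, if_pos (dvd_zero 2),
    Nat.zero_div, coeff_zero_eq_constantCoeff_apply, constantCoeff_hExponent, map_zero]

/-- `q_b`, extended by `0` to negative indices. -/
def qInt (t : ℕ+ → A) (b : ℤ) : A := if b < 0 then 0 else qPoly t b.toNat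

/-- `h_b`, extended by `0` to negative indices. -/
def hInt (t : ℕ+ → A) (b : ℤ) : A := if b < 0 then 0 else hPoly t b.toNat

theorem qInt_of_neg (t : ℕ+ → A) {b : ℤ} (h : b < 0) : qInt t b = 0 := if_pos h

theorem qInt_natCast (t : ℕ+ → A) (n : ℕ) : qInt t n = qPoly t n := by simp [qInt]

theorem hInt_of_neg (t : ℕ+ → A) {b : ℤ} (h : b < 0) : hInt t b = 0 := if_pos h

theorem hInt_natCast (t : ℕ+ → A) (n : ℕ) : hInt t n = hPoly t n := by simp [hInt]

/-- The factorization `∑ h_n z ^ n = (∑ q_n z ^ n) (∑ h_n(t^{(2)}) z ^ {2n})`. -/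
theorem hInt_eq_sum [IsAddTorsionFree A] (t : ℕ+ → A) (c : ℤ) (N : ℕ) (hN : c < 2 * N) :
    hInt t c = ∑ r ∈ Finset.range N, hPoly (fun j => t (2 * j)) r * qInt t (c - 2 * r) := by
  rcases lt_or_ge c 0 with hc | hc
  · rw [hInt_of_neg t hc, Finset.sum_eq_zero]
    intro r _
    rw [qInt_of_neg t (by omega), mul_zero]
  lift c to ℕ using hc
  rw [hInt_natCast, hPoly]
  have := congrArg (coeff c) (hPoly_series_eq t)
  refine this.trans ?_
  rw [mul_comm, coeff_mul, Finset.Nat.sum_antidiagonal_eq_sum_range_succ_mk]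
  simp only [coeff_subst_X_pow two_ne_zero, Algebra.algebraMap_self, RingHom.id_apply]
  refine Finset.sum_bij_ne_zero (fun k _ _ => k / 2) ?_ ?_ ?_ ?_
  · intro k hk _
    simp only [Finset.mem_range] at hk ⊢
    omega
  · intro k hk h1 k' hk' h2 h
    have e1 : 2 ∣ k := by by_contra hh; simp [hh] at h1
    have e2 : 2 ∣ k' := by by_contra hh; simp [hh] at h2
    omega
  · intro r hr h
    have hle : 2 * r ≤ c := by
      by_contra hh
      rw [qInt_of_neg t (by omega), mul_zero] at h
      exact h rfl
    have e : (c : ℤ) - 2 * r = ((c - 2 * r : ℕ) : ℤ) := by omega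
    rw [e, qInt_natCast] at h
    refine ⟨2 * r, by simp only [Finset.mem_range]; omega, ?_, by omega⟩
    rw [if_pos (Dvd.intro r rfl), Nat.mul_div_cancel_left r two_pos]
    exact h
  · intro k hk h
    have e1 : 2 ∣ k := by by_contra hh; simp [hh] at h
    obtain ⟨r, rfl⟩ := e1
    simp only [Finset.mem_range] at hk
    have e : (c : ℤ) - 2 * ((2 * r / 2 : ℕ) : ℤ) = ((c - 2 * r : ℕ) : ℤ) := by omega
    rw [if_pos (Dvd.intro r rfl), e, qInt_natCast]
    rfl

theorem exp_qExponent_mul_alternating [IsAddTorsionFree A] (t : ℕ+ → A) :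
    ((PowerSeries.exp A).subst (qExponent t) : PowerSeries A)
      * PowerSeries.mk (fun n => (-1) ^ n * qPoly t n) = 1 := by
  have hs := HasSubst.of_constantCoeff_zero' (constantCoeff_qExponent t)
  have e1 : (qExponent t).subst ((-1 : A) • X : PowerSeries A) = -qExponent t := by
    rw [← rescale_eq_subst]
    ext k
    rw [coeff_rescale, map_neg, qExponent, coeff_mk]
    split_ifs with hk
    · rw [hk.neg_one_pow, neg_one_mul]
    · simp
  have e2 : PowerSeries.mk (fun n => (-1) ^ n * qPoly t n)
      = (PowerSeries.exp A).subst (-qExponent t) := by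
    rw [← e1, ← subst_comp_subst_apply hs (HasSubst.smul_X' _), ← rescale_eq_subst]
    ext n
    rw [coeff_rescale, coeff_mk]
    rfl
  rw [e2]
  exact exp_subst_mul_neg (constantCoeff_qExponent t)

theorem sum_alternating_qPoly [IsAddTorsionFree A] (t : ℕ+ → A) {n : ℕ} (hn : n ≠ 0) :
    ∑ k ∈ Finset.range (n + 1), (-1) ^ k * qPoly t (n - k) * qPoly t k = 0 := by
  have := congrArg (coeff n) (exp_qExponent_mul_alternating t)
  rw [mul_comm, coeff_mul, Finset.Nat.sum_antidiagonal_eq_sum_range_succ_mk, coeff_one,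
    if_neg hn] at this
  rw [← this]
  refine Finset.sum_congr rfl fun k _ => ?_
  rw [coeff_mk]
  change _ = _ * qPoly t (n - k)
  ring

/-- This is the coefficient of z^{2b} in q(z) q(-z) = 1, folded about its middle term. It makes the
convention Q_{b,b} = 0 agree with the formula for Q_{a,b} on the diagonal, except at b = 0. -/
theorem QPairAux_self [IsAddTorsionFree A] (t : ℕ+ → A) {b : ℕ} (hb : b ≠ 0) : QPairAux t b b = 0 := by
  have h := sum_alternating_qPoly t (n := 2 * b) (by omega)
  have e1 : Finset.range (2 * b + 1) = Finset.range b ∪ {b} ∪ Finset.Ico (b + 1) (2 * b + 1) := by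
    ext x
    simp only [Finset.mem_range, Finset.mem_union, Finset.mem_singleton, Finset.mem_Ico]
    omega
  have e2 : ∑ k ∈ Finset.range b, (-1) ^ k * qPoly t (2 * b - k) * qPoly t k
      = (-1) ^ b * ∑ i ∈ Finset.Icc 1 b, (-1) ^ i * qPoly t (b + i) * qPoly t (b - i) := by
    rw [Finset.mul_sum]
    refine Finset.sum_bij' (fun k _ => b - k) (fun i _ => b - i) ?_ ?_ ?_ ?_ ?_
    · intro k hk; simp only [Finset.mem_range, Finset.mem_Icc] at hk ⊢; omega
    · intro k hk; simp only [Finset.mem_range, Finset.mem_Icc] at hk ⊢; omega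
    · intro k hk; simp only [Finset.mem_range] at hk; omega
    · intro k hk; simp only [Finset.mem_Icc] at hk; omega
    · intro k hk
      simp only [Finset.mem_range] at hk
      have p : ((-1 : A)) ^ k = (-1) ^ b * (-1) ^ (b - k) := by
        rw [← pow_add, show b + (b - k) = 2 * (b - k) + k by omega, pow_add, pow_mul]
        simp
      rw [p, show b + (b - k) = 2 * b - k by omega, show b - (b - k) = k by omega]
      ring
  have e3 : ∑ k ∈ Finset.Ico (b + 1) (2 * b + 1), (-1) ^ k * qPoly t (2 * b - k) * qPoly t k
      = (-1) ^ b * ∑ i ∈ Finset.Icc 1 b, (-1) ^ i * qPoly t (b + i) * qPoly t (b - i) := by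
    rw [Finset.mul_sum]
    refine Finset.sum_bij' (fun k _ => k - b) (fun i _ => b + i) ?_ ?_ ?_ ?_ ?_
    · intro k hk; simp only [Finset.mem_Ico, Finset.mem_Icc] at hk ⊢; omega
    · intro k hk; simp only [Finset.mem_Ico, Finset.mem_Icc] at hk ⊢; omega
    · intro k hk; simp only [Finset.mem_Ico] at hk; omega
    · intro k hk; simp only [Finset.mem_Icc] at hk; omega
    · intro k hk
      simp only [Finset.mem_Ico] at hk
      have p : ((-1 : A)) ^ k = (-1) ^ b * (-1) ^ (k - b) := by
        rw [← pow_add, show b + (k - b) = k by omega]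
      rw [p, show b + (k - b) = k by omega, show b - (k - b) = 2 * b - k by omega]
      ring
  rw [e1, Finset.sum_union, Finset.sum_union, Finset.sum_singleton, e2, e3,
    show 2 * b - b = b by omega] at h
  · have p : ((-1 : A)) ^ b * (-1) ^ b = 1 := by rw [← mul_pow]; simp
    rw [QPairAux]
    linear_combination (-1) ^ b * h - (qPoly t b * qPoly t b + 2 * ∑ i ∈ Finset.Icc 1 b,
      (-1) ^ i * qPoly t (b + i) * qPoly t (b - i)) * p
  · simp
  · rw [Finset.disjoint_left]
    intro x hx hx'
    simp only [Finset.mem_range, Finset.mem_union, Finset.mem_singleton, Finset.mem_Ico] at hx hx'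
    omega

end GeneratingFunctions

end

end MixedExpansion

namespace MixedExpansion

noncomputable section

/-! ### The kernel of the Schur `Q`-functions on all integers -/

section Kernel

variable {A : Type*} [CommRing A] [Algebra ℚ A]

/-- The skew-symmetric coefficients of `q(x) q(y) (x - y) / (x + y)`, where the two expansions of
the rational function are averaged. -/
def kernel (t : ℕ+ → A) (a b : ℤ) : A :=
  if 0 ≤ a ∧ 0 ≤ b then QPair t a.toNat b.toNat
  else if a + b = 0 then (if a < 0 then (-1) ^ a.natAbs else -(-1) ^ a.natAbs) else 0

theorem kernel_natCast (t : ℕ+ → A) (a b : ℕ) : kernel t a b = QPair t a b := by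
  simp [kernel]

theorem kernel_neg_self (t : ℕ+ → A) {a : ℤ} (ha : a < 0) : kernel t a (-a) = (-1) ^ a.natAbs := by
  rw [kernel, if_neg (by omega), if_pos (by omega), if_pos ha]

theorem kernel_self_neg (t : ℕ+ → A) {a : ℤ} (ha : 0 < a) :
    kernel t a (-a) = -(-1) ^ a.natAbs := by
  rw [kernel, if_neg (by omega), if_pos (by omega), if_neg (by omega)]

theorem kernel_of_neg_left (t : ℕ+ → A) {a b : ℤ} (ha : a < 0) (h : a + b ≠ 0) :
    kernel t a b = 0 := by
  rw [kernel, if_neg (by omega), if_neg h]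

theorem kernel_of_neg_right (t : ℕ+ → A) {a b : ℤ} (hb : b < 0) (h : a + b ≠ 0) :
    kernel t a b = 0 := by
  rw [kernel, if_neg (by omega), if_neg h]

theorem QPair_self (t : ℕ+ → A) (a : ℕ) : QPair t a a = 0 := by simp [QPair]

theorem QPair_swap (t : ℕ+ → A) (a b : ℕ) : QPair t a b = -QPair t b a := by
  rcases lt_trichotomy a b with h | rfl | h
  · simp [QPair, h, h.not_gt]
  · simp [QPair]
  · simp [QPair, h, h.not_gt]

theorem QPair_zero_right (t : ℕ+ → A) {a : ℕ} (ha : 0 < a) : QPair t a 0 = qPoly t a := by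
  simp [QPair, ha, QPairAux, qPoly_zero]

theorem kernel_self (t : ℕ+ → A) (a : ℤ) : kernel t a a = 0 := by
  rcases lt_or_ge a 0 with h | h
  · exact kernel_of_neg_left t h (by omega)
  · lift a to ℕ using h
    rw [kernel_natCast, QPair_self]

theorem kernel_swap (t : ℕ+ → A) (a b : ℤ) : kernel t a b = -kernel t b a := by
  by_cases h : 0 ≤ a ∧ 0 ≤ b
  · obtain ⟨ha, hb⟩ := h
    lift a to ℕ using ha
    lift b to ℕ using hb
    rw [kernel_natCast, kernel_natCast, QPair_swap]
  · by_cases h0 : a + b = 0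
    · obtain rfl : b = -a := by omega
      rcases lt_trichotomy a 0 with ha | ha | ha
      · have := kernel_self_neg t (a := -a) (by omega)
        rw [neg_neg, Int.natAbs_neg] at this
        rw [kernel_neg_self t ha, this, neg_neg]
      · omega
      · have := kernel_neg_self t (a := -a) (by omega)
        rw [neg_neg, Int.natAbs_neg] at this
        rw [kernel_self_neg t ha, this]
    · rw [kernel, if_neg h, if_neg h0, kernel, if_neg (by omega), if_neg (by omega), neg_zero]

theorem QPairAux_succ (t : ℕ+ → A) (a b : ℕ) :
    QPairAux t a (b + 1) + QPairAux t (a + 1) b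
      = qPoly t a * qPoly t (b + 1) - qPoly t (a + 1) * qPoly t b := by
  have e : ∑ i ∈ Finset.Icc 1 (b + 1), (-1) ^ i * qPoly t (a + i) * qPoly t (b + 1 - i)
      = -(qPoly t (a + 1) * qPoly t b)
        - ∑ i ∈ Finset.Icc 1 b, (-1) ^ i * qPoly t (a + 1 + i) * qPoly t (b - i) := by
    rw [← Finset.add_sum_Ioc_eq_sum_Icc (by omega), sub_eq_add_neg, ← Finset.sum_neg_distrib]
    congr 1
    · simp
    · refine Finset.sum_bij' (fun i _ => i - 1) (fun i _ => i + 1) ?_ ?_ ?_ ?_ ?_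
      · intro i hi; simp only [Finset.mem_Ioc, Finset.mem_Icc] at hi ⊢; omega
      · intro i hi; simp only [Finset.mem_Ioc, Finset.mem_Icc] at hi ⊢; omega
      · intro i hi; simp only [Finset.mem_Ioc] at hi; omega
      · intro i hi; omega
      · intro i hi
        simp only [Finset.mem_Ioc] at hi
        obtain ⟨j, rfl⟩ : ∃ j, i = j + 1 := ⟨i - 1, by omega⟩
        rw [Nat.add_sub_cancel, pow_succ, show a + 1 + j = a + (j + 1) by omega,
          show b + 1 - (j + 1) = b - j by omega]
        ring
  rw [QPairAux, QPairAux, e]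
  ring

theorem QPair_succ_of_le [IsAddTorsionFree A] (t : ℕ+ → A) {a b : ℕ} (h : b < a) :
    QPair t a (b + 1) + QPair t (a + 1) b
      = qPoly t a * qPoly t (b + 1) - qPoly t (a + 1) * qPoly t b := by
  rw [← QPairAux_succ]
  congr 1
  -- When a = b + 1 the first term is a diagonal entry, which is 0 by definition rather than by the
  -- formula.
  · rcases eq_or_lt_of_le (show b + 1 ≤ a from h) with h' | h'
    · subst h'
      rw [QPair_self, QPairAux_self t (by omega)]
    · rw [QPair, if_pos h']
  · rw [QPair, if_pos (by omega)]

theorem QPair_succ [IsAddTorsionFree A] (t : ℕ+ → A) (a b : ℕ) :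
    QPair t a (b + 1) + QPair t (a + 1) b
      = qPoly t a * qPoly t (b + 1) - qPoly t (a + 1) * qPoly t b := by
  rcases lt_trichotomy a b with h | rfl | h
  · rw [QPair_swap t a, QPair_swap t (a + 1)]
    have := QPair_succ_of_le t h
    linear_combination -this
  · rw [QPair_swap]
    ring
  · exact QPair_succ_of_le t h

/-- Coefficient form of (x + y) K = (x - y) q(x) q(y). Averaging the two expansions of (x - y)/(x +
y) is what makes K skew-symmetric while the relation stays valid at all integers. -/
theorem kernel_add_one [IsAddTorsionFree A] (t : ℕ+ → A) (a b : ℤ) :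
    kernel t a (b + 1) + kernel t (a + 1) b
      = qInt t a * qInt t (b + 1) - qInt t (a + 1) * qInt t b := by
  have hz : qInt t 0 = 1 := by
    have := qInt_natCast t 0
    rwa [qPoly_zero] at this
  -- The border case b = -1, where q_0 = 1 enters; the case a = -1 follows by skew-symmetry.
  have key : ∀ a : ℤ, kernel t a (-1 + 1) + kernel t (a + 1) (-1)
      = qInt t a * qInt t (-1 + 1) - qInt t (a + 1) * qInt t (-1) := by
    intro a
    rw [neg_add_cancel, hz, qInt_of_neg t (b := -1) (by omega)]
    rcases lt_trichotomy a 0 with ha | rfl | ha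
    · rw [kernel_of_neg_left t ha (by omega), kernel_of_neg_right t (by omega) (by omega),
        qInt_of_neg t ha]
      ring
    · have := kernel_self_neg t (a := 1) (by omega)
      rw [kernel_self, zero_add, zero_add, this, hz]
      simp
    · rw [kernel_of_neg_right t (a := a + 1) (by omega) (by omega)]
      lift a to ℕ using ha.le
      have := kernel_natCast t a 0
      rw [Nat.cast_zero] at this
      rw [this, QPair_zero_right t (by omega), qInt_natCast]
      ring
  rcases lt_trichotomy b (-1) with hb | rfl | hb
  · rw [qInt_of_neg t (b := b + 1) (by omega), qInt_of_neg t (b := b) (by omega)]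
    by_cases h : a + b + 1 = 0
    · obtain rfl : b = -(a + 1) := by omega
      have e := kernel_self_neg t (a := a) (by omega)
      rw [show -(a + 1) + 1 = -a by omega, e, kernel_self_neg t (by omega),
        show (a + 1).natAbs = a.natAbs + 1 by omega, pow_succ]
      ring
    · rw [kernel_of_neg_right t (by omega) (by omega), kernel_of_neg_right t (by omega) (by omega)]
      ring
  · exact key a
  · rcases lt_trichotomy a (-1) with ha | rfl | ha
    · rw [qInt_of_neg t (b := a + 1) (by omega), qInt_of_neg t (b := a) (by omega)]
      by_cases h : a + b + 1 = 0
      · obtain rfl : b = -(a + 1) := by omega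
        have e := kernel_neg_self t (a := a) (by omega)
        rw [show -(a + 1) + 1 = -a by omega, e, kernel_neg_self t (by omega),
          show a.natAbs = (a + 1).natAbs + 1 by omega, pow_succ]
        ring
      · rw [kernel_of_neg_left t (by omega) (by omega), kernel_of_neg_left t (by omega) (by omega)]
        ring
    · have := key b
      rw [kernel_swap, kernel_swap t (-1 + 1)]
      linear_combination -this
    · obtain ⟨a, rfl⟩ := Int.eq_ofNat_of_zero_le (show 0 ≤ a by omega)
      obtain ⟨b, rfl⟩ := Int.eq_ofNat_of_zero_le (show 0 ≤ b by omega)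
      have := QPair_succ t a b
      simp only [← kernel_natCast, ← qInt_natCast] at this
      exact_mod_cast this

end Kernel

end

end MixedExpansion

namespace MixedExpansion

noncomputable section

/-! ### Pfaffians and the exterior algebra -/

section Pfaffian

open ExteriorAlgebra

variable {R M : Type*} [CommRing R] [AddCommGroup M] [Module R M]

theorem toQuadraticMap_neg_of_isAlt {B : LinearMap.BilinForm R M} (hB : ∀ x, B x x = 0) :
    (-B).toQuadraticMap = (0 : QuadraticForm R M) - 0 := by
  ext x
  simp [hB]

/-- The linear functional on the exterior algebra which is the Pfaffian of the Gram matrix of an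
alternating form on products of vectors. -/
def pfaffianForm (B : LinearMap.BilinForm R M) (hB : ∀ x, B x x = 0) : ExteriorAlgebra R M →ₗ[R] R :=
  algebraMapInv.toLinearMap ∘ₗ CliffordAlgebra.changeForm (toQuadraticMap_neg_of_isAlt hB)

variable {B : LinearMap.BilinForm R M} (hB : ∀ x, B x x = 0)

theorem pfaffianForm_one : pfaffianForm B hB 1 = 1 := by
  have := CliffordAlgebra.changeForm_one (toQuadraticMap_neg_of_isAlt hB)
  simp only [pfaffianForm, LinearMap.comp_apply]
  erw [this]
  exact map_one algebraMapInv

/-- Changing the form by the alternating `B` deforms the exterior product, and the scalar part of a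
deformed product starting with `x` retains only the contraction term. Iterating this is the
expansion of a Pfaffian along its first row. -/
theorem pfaffianForm_ι_mul (x : M) (w : ExteriorAlgebra R M) :
    pfaffianForm B hB (ι R x * w) = pfaffianForm B hB (CliffordAlgebra.contractLeft (B x) w) := by
  have h1 := CliffordAlgebra.changeForm_ι_mul (toQuadraticMap_neg_of_isAlt hB) x w
  have h2 := CliffordAlgebra.changeForm_contractLeft (toQuadraticMap_neg_of_isAlt hB) (B x) w
  simp only [pfaffianForm, LinearMap.comp_apply]
  erw [h1, h2]
  have h3 : algebraMapInv (R := R) (M := M) (ι R x) = 0 := by simp [algebraMapInv]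
  rw [LinearMap.neg_apply, map_neg, LinearMap.neg_apply, sub_neg_eq_add, map_add]
  erw [map_mul algebraMapInv, h3]
  rw [zero_mul, zero_add]

theorem contractLeft_ι_mul' (d : Module.Dual R M) (a : M) (b : ExteriorAlgebra R M) :
    CliffordAlgebra.contractLeft d (ι R a * b)
      = d a • b - ι R a * CliffordAlgebra.contractLeft d b :=
  CliffordAlgebra.contractLeft_ι_mul d a b

theorem contractLeft_ιMulti (d : Module.Dual R M) :
    ∀ {n : ℕ} (v : Fin (n + 1) → M), CliffordAlgebra.contractLeft d (ιMulti R (n + 1) v)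
      = ∑ j : Fin (n + 1), ((-1) ^ (j : ℕ) * d (v j)) • ιMulti R n (fun i => v (j.succAbove i))
  | 0, v => by
    rw [ιMulti_succ_apply, contractLeft_ι_mul', ιMulti_zero_apply]
    have : CliffordAlgebra.contractLeft d (1 : ExteriorAlgebra R M) = 0 :=
      CliffordAlgebra.contractLeft_one _ d
    rw [this]
    simp
  | n + 1, v => by
    rw [ιMulti_succ_apply, contractLeft_ι_mul', Fin.sum_univ_succ, contractLeft_ιMulti d,
      Finset.mul_sum, sub_eq_add_neg, ← Finset.sum_neg_distrib]
    congr 1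
    · simp [Matrix.vecTail, Function.comp_def]
    · refine Finset.sum_congr rfl fun j _ => ?_
      rw [ιMulti_succ_apply (v := fun i => v (j.succ.succAbove i)), mul_smul_comm, ← neg_smul]
      congr 1
      · simp [Matrix.vecTail, pow_succ]
      · congr 2
        funext i
        simp [Matrix.vecTail]

theorem pfaffianForm_ιMulti :
    ∀ (n : ℕ) (v : Fin (2 * n) → M),
      pfaffianForm B hB (ιMulti R (2 * n) v) = pfaffian n (Matrix.of fun i j => B (v i) (v j))
  | 0, v => by
    rw [pfaffian]
    erw [ιMulti_zero_apply]
    exact pfaffianForm_one hB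
  | n + 1, v => by
    rw [pfaffian]
    erw [ιMulti_succ_apply (n := 2 * n + 1) v]
    rw [pfaffianForm_ι_mul, contractLeft_ιMulti, map_sum]
    refine Finset.sum_congr rfl fun j _ => ?_
    rw [map_smul, smul_eq_mul]
    congr 1
    exact pfaffianForm_ιMulti n _

theorem pfaffianForm_ιMulti_odd :
    ∀ (n : ℕ) (v : Fin (2 * n + 1) → M),
      pfaffianForm B hB (ιMulti R (2 * n + 1) v) = 0
  | 0, v => by
    rw [ιMulti_succ_apply, pfaffianForm_ι_mul]
    erw [ιMulti_zero_apply]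
    have : CliffordAlgebra.contractLeft (B (v 0)) (1 : ExteriorAlgebra R M) = 0 :=
      CliffordAlgebra.contractLeft_one _ _
    rw [this, map_zero]
  | n + 1, v => by
    rw [ιMulti_succ_apply, pfaffianForm_ι_mul]
    erw [contractLeft_ιMulti (n := 2 * n + 1)]
    rw [map_sum]
    refine Finset.sum_eq_zero fun j _ => ?_
    rw [map_smul, pfaffianForm_ιMulti_odd n, smul_zero]

end Pfaffian

end

end MixedExpansion

namespace MixedExpansion

noncomputable section

/-! ### Schur's Pfaffian identity, expanded along the first row -/

section PairProd

variable {R : Type*} [CommRing R]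

/-- The product of `v i + s * v j` over all pairs `i < j`. -/
def pairProd (s : R) : (n : ℕ) → (Fin n → R) → R
  | 0, _ => 1
  | n + 1, v => (∏ j : Fin n, (v 0 + s * v j.succ)) * pairProd s n fun i => v i.succ

/-- Moving `v j` to the front reverses its pairs with the `j` earlier entries, and each reversal
costs a factor `s` because v_i + s v_j = s (v_j + s v_i). -/
theorem pairProd_succAbove (s : R) (hs : s * s = 1) :
    ∀ (n : ℕ) (v : Fin (n + 1) → R) (j : Fin (n + 1)),
      pairProd s (n + 1) v = s ^ (j : ℕ) * (∏ k, (v j + s * v (j.succAbove k))) *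
        pairProd s n fun k => v (j.succAbove k)
  | 0, v, j => by
    obtain rfl : j = 0 := Fin.fin_one_eq_zero j
    simp [pairProd]
  | n + 1, v, j => by
    refine Fin.cases ?_ (fun j => ?_) j
    · simp [pairProd]
    · rw [pairProd, pairProd_succAbove s hs n _ j, Fin.prod_univ_succAbove _ j, pairProd,
        Fin.prod_univ_succ (fun k => v j.succ + s * v (j.succ.succAbove k))]
      simp only [Fin.succ_succAbove_zero, Fin.succ_succAbove_succ, Fin.val_succ, pow_succ]
      linear_combination (v 0 * s ^ (j : ℕ)) *
        (∏ k, (v 0 + s * v (j.succAbove k).succ)) *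
        (∏ k, (v j.succ + s * v (j.succAbove k).succ)) *
        (pairProd s n fun k => v (j.succAbove k).succ) * (-hs)

theorem pairProd_mul_pairProd_neg :
    ∀ (n : ℕ) (v : Fin n → R),
      pairProd 1 n v * pairProd (-1) n v = pairProd (-1) n fun i => v i ^ 2
  | 0, v => by simp [pairProd]
  | n + 1, v => by
    rw [pairProd, pairProd, pairProd, ← pairProd_mul_pairProd_neg n, mul_mul_mul_comm,
      ← Finset.prod_mul_distrib]
    congr 1
    exact Finset.prod_congr rfl fun j _ => by ring

theorem pairProd_neg_one_eq :
    ∀ (n : ℕ) (v : Fin n → R),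
      pairProd (-1) n v = ∏ i, ∏ j ∈ Finset.Ioi i, (v i - v j)
  | 0, v => by simp [pairProd]
  | n + 1, v => by
    rw [pairProd, pairProd_neg_one_eq n, Fin.prod_univ_succ]
    simp only [Fin.prod_Ioi_zero, Fin.prod_Ioi_succ, neg_one_mul, ← sub_eq_add_neg]

theorem pairProd_neg_one_eq_det (n : ℕ) (v : Fin n → R) :
    pairProd (-1) n v = (∏ i : Fin n, (-1) ^ (i : ℕ)) * (Matrix.vandermonde v).det := by
  rw [← Matrix.det_mul_row]
  have := Matrix.det_vandermonde fun i => -v i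
  rw [pairProd_neg_one_eq]
  simp only [neg_sub_neg] at this
  rw [← this]
  congr 1
  ext i j
  simp only [Matrix.vandermonde_apply, Matrix.of_apply]
  rw [← mul_pow, neg_one_mul]

end PairProd

/-! ### The recursion behind Schur's Pfaffian identity, by Lagrange interpolation. -/

section Lagrange

variable {K : Type*} [Field K]

/-- The leading terms cancel, so the left side has degree below `n` in x and is determined by its
values at the points -y_j, where the second product vanishes. -/
theorem prod_sub_sub_prod_add {n : ℕ} {y : Fin n → K} (hy : Function.Injective y)
    (x : K) :
    ∏ k, (x - y k) - ∏ k, (x + y k)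
      = ∑ j, (∏ k, (-y j - y k)) * ∏ k ∈ Finset.univ.erase j, (y k - y j)⁻¹ * (x + y k) := by
  classical
  set f : Polynomial K := ∏ k, (Polynomial.X - Polynomial.C (y k))
  set g : Polynomial K := ∏ k, (Polynomial.X + Polynomial.C (y k))
  have hf : f.Monic := Polynomial.monic_prod_of_monic _ _ fun k _ => Polynomial.monic_X_sub_C _
  have hg : g.Monic := Polynomial.monic_prod_of_monic _ _ fun k _ => Polynomial.monic_X_add_C _
  have df : f.degree = n := by
    rw [Polynomial.degree_prod]; simp
  have dg : g.degree = n := by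
    rw [Polynomial.degree_prod]; simp
  have hd : (f - g).degree < (Finset.univ : Finset (Fin n)).card := by
    rw [Finset.card_univ, Fintype.card_fin, ← df]
    exact Polynomial.degree_sub_lt_left (df.trans dg.symm) hf.ne_zero (by rw [hf, hg])
  have hinj : Set.InjOn (fun k => -y k) (Finset.univ : Finset (Fin n)) :=
    fun a _ b _ h => hy (neg_injective h)
  have h := congrArg (Polynomial.eval x) (Lagrange.eq_interpolate hinj hd)
  rw [Lagrange.interpolate_apply, Polynomial.eval_finsetSum] at h
  have ef : ∀ z, f.eval z = ∏ k, (z - y k) := fun z => by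
    simp [f, Polynomial.eval_prod]
  have eg : ∀ z, g.eval z = ∏ k, (z + y k) := fun z => by
    simp [g, Polynomial.eval_prod]
  rw [Polynomial.eval_sub, ef, eg] at h
  rw [h]
  refine Finset.sum_congr rfl fun j _ => ?_
  have z : ∏ k, (-y j + y k) = 0 := Finset.prod_eq_zero (Finset.mem_univ j) (by ring)
  rw [Polynomial.eval_mul, Polynomial.eval_C, Polynomial.eval_sub, ef, eg, z, sub_zero]
  congr 1
  rw [Lagrange.basis, Polynomial.eval_prod]
  refine Finset.prod_congr rfl fun k _ => ?_
  rw [Lagrange.basisDivisor]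
  simp only [Polynomial.eval_mul, Polynomial.eval_C, Polynomial.eval_sub, Polynomial.eval_X]
  rw [sub_neg_eq_add, sub_neg_eq_add, neg_add_eq_sub]

theorem prod_erase_eq_prod_succAbove {M : Type*} [CommMonoid M] {n : ℕ} (j : Fin (n + 1))
    (f : Fin (n + 1) → M) : ∏ k ∈ Finset.univ.erase j, f k = ∏ k, f (j.succAbove k) := by
  have : (Finset.univ.erase j : Finset (Fin (n + 1)))
      = Finset.univ.map (Fin.succAboveEmb j) := by
    ext k
    simp [Fin.exists_succAbove_eq_iff]
  rw [this, Finset.prod_map]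
  rfl

theorem sum_prod_div [CharZero K] {n : ℕ} {y : Fin (2 * n + 1) → K} (hy : Function.Injective y)
    (h0 : ∀ k, y k ≠ 0) (x : K) :
    ∑ j, (∏ k, (y j + y (j.succAbove k)) / (y j - y (j.succAbove k))) *
      ((x - y j) * ∏ k, (x + y (j.succAbove k))) = ∏ k, (x - y k) := by
  set c : Fin (2 * n + 1) → K := fun j => ∏ k, (y j + y (j.succAbove k)) / (y j - y (j.succAbove k))
    with hc
  have key : ∀ x, ∏ k, (x - y k) - ∏ k, (x + y k)
      = ∑ j, (-2 * y j) * c j * ∏ k, (x + y (j.succAbove k)) := by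
    intro x
    rw [prod_sub_sub_prod_add hy]
    refine Finset.sum_congr rfl fun j _ => ?_
    rw [prod_erase_eq_prod_succAbove, Fin.prod_univ_succAbove _ j, Finset.prod_mul_distrib]
    have e : (∏ k, (-y j - y (j.succAbove k))) * ∏ k, (y (j.succAbove k) - y j)⁻¹ = c j := by
      rw [hc, ← Finset.prod_mul_distrib]
      refine Finset.prod_congr rfl fun k _ => ?_
      have : y j - y (j.succAbove k) ≠ 0 :=
        sub_ne_zero.mpr fun h => Fin.succAbove_ne j k (hy h).symm
      have : y (j.succAbove k) - y j ≠ 0 := by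
        rw [← neg_sub]; exact neg_ne_zero.mpr this
      field_simp
      ring
    rw [← e]
    ring
  -- Evaluate at x = 0: the number of variables is odd, so the two products on the left differ only
  -- in sign, and the non-zero product of all y_k cancels.
  have hsum : ∑ j, c j = 1 := by
    have h := key 0
    have hp : ∏ k, y k ≠ 0 := Finset.prod_ne_zero_iff.mpr fun k _ => h0 k
    have e1 : ∏ k, (0 - y k) = -∏ k, y k := by
      simp only [zero_sub]
      rw [Finset.prod_neg]
      simp [pow_succ, pow_mul]
    have e2 : ∀ j, (-2 * y j) * c j * ∏ k, (0 + y (j.succAbove k)) = (-2 * ∏ k, y k) * c j := by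
      intro j
      rw [Fin.prod_univ_succAbove (fun k => y k) j]
      simp only [zero_add]
      ring
    rw [Finset.sum_congr rfl fun j _ => e2 j, ← Finset.mul_sum, e1] at h
    simp only [zero_add] at h
    have h2 : (-2 * ∏ k, y k) ≠ 0 := mul_ne_zero (by norm_num) hp
    apply mul_left_cancel₀ h2
    linear_combination -h
  have h := key x
  have e : ∑ j, c j * ((x - y j) * ∏ k, (x + y (j.succAbove k)))
      = (∑ j, c j) * ∏ k, (x + y k) + ∑ j, (-2 * y j) * c j * ∏ k, (x + y (j.succAbove k)) := by
    rw [Finset.sum_mul, ← Finset.sum_add_distrib]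
    refine Finset.sum_congr rfl fun j _ => ?_
    rw [Fin.prod_univ_succAbove (fun k => x + y k) j]
    ring
  rw [e, hsum, ← h]
  ring

theorem sum_pairProd_field [CharZero K] {n : ℕ} {y : Fin (2 * n + 1) → K}
    (hy : Function.Injective y) (h0 : ∀ k, y k ≠ 0) (x : K) :
    ∑ j : Fin (2 * n + 1), (-1) ^ (j : ℕ) * ((x - y j) * ((∏ k, (x + y (j.succAbove k))) *
      (∏ k, (y j + y (j.succAbove k))) * pairProd (-1) (2 * n) fun k => y (j.succAbove k)))
      = (∏ k, (x - y k)) * pairProd (-1) (2 * n + 1) y := by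
  rw [← sum_prod_div hy h0 x, Finset.sum_mul]
  refine Finset.sum_congr rfl fun j _ => ?_
  rw [pairProd_succAbove (-1) (by ring) _ y j, Finset.prod_div_distrib]
  have hne : ∏ k, (y j - y (j.succAbove k)) ≠ 0 := Finset.prod_ne_zero_iff.mpr fun k _ =>
    sub_ne_zero.mpr fun h => Fin.succAbove_ne j k (hy h).symm
  simp only [neg_one_mul, ← sub_eq_add_neg]
  field_simp

/-- Schur's Pfaffian identity cleared of denominators. This polynomial form can be fed to a linear
functional, for which quotients make no sense. -/
theorem sum_pairProd {S : Type*} [CommRing S] [IsDomain S] [CharZero S] {n : ℕ}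
    {y : Fin (2 * n + 1) → S} (hy : Function.Injective y) (h0 : ∀ k, y k ≠ 0) (x : S) :
    ∑ j : Fin (2 * n + 1), (-1) ^ (j : ℕ) * ((x - y j) * ((∏ k, (x + y (j.succAbove k))) *
      (∏ k, (y j + y (j.succAbove k))) * pairProd (-1) (2 * n) fun k => y (j.succAbove k)))
      = (∏ k, (x - y k)) * pairProd (-1) (2 * n + 1) y := by
  have hinj := IsFractionRing.injective S (FractionRing S)
  have : CharZero (FractionRing S) := charZero_of_injective_algebraMap hinj
  have hpp : ∀ (m : ℕ) (v : Fin m → S), algebraMap S (FractionRing S) (pairProd (-1) m v)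
      = pairProd (-1) m fun i => algebraMap S (FractionRing S) (v i) := fun m v => by
    simp only [pairProd_neg_one_eq, map_prod, map_sub]
  apply hinj
  have := sum_pairProd_field (K := FractionRing S) (n := n)
    (y := fun k => algebraMap S (FractionRing S) (y k)) (hinj.comp hy)
    (fun k h => h0 k (hinj (by rw [h, map_zero]))) (algebraMap S (FractionRing S) x)
  simp only [map_sum, map_mul, map_prod, map_sub, map_add, map_pow, map_neg, map_one, hpp]
  exact this

end Lagrange

end

end MixedExpansion

namespace MixedExpansion

noncomputable section

/-! ### Hankel determinants as Pfaffians -/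

section Hankel

variable {R σ : Type*} [CommRing R]

/-- The linear functional on polynomials with prescribed values on monomials. -/
def monomialFunctional (f : (σ →₀ ℕ) → R) : MvPolynomial σ R →ₗ[R] R :=
  (MvPolynomial.basisMonomials σ R).constr R f

theorem monomialFunctional_monomial (f : (σ →₀ ℕ) → R) (u : σ →₀ ℕ) :
    monomialFunctional f (MvPolynomial.monomial u 1) = f u := by
  have := (MvPolynomial.basisMonomials σ R).constr_basis R f u
  rwa [MvPolynomial.coe_basisMonomials] at this

theorem linearMap_ext_monomial {f g : MvPolynomial σ R →ₗ[R] R}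
    (h : ∀ u, f (MvPolynomial.monomial u 1) = g (MvPolynomial.monomial u 1)) : f = g := by
  refine (MvPolynomial.basisMonomials σ R).ext fun u => ?_
  rw [MvPolynomial.coe_basisMonomials]
  exact h u

theorem monomialFunctional_X_mul (f : (σ →₀ ℕ) → R) (i : σ) (P : MvPolynomial σ R) :
    monomialFunctional f (MvPolynomial.X i * P)
      = monomialFunctional (fun u => f (u + Finsupp.single i 1)) P := by
  have : monomialFunctional f ∘ₗ LinearMap.mulLeft R (MvPolynomial.X i)
      = monomialFunctional fun u => f (u + Finsupp.single i 1) := by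
    refine linearMap_ext_monomial fun u => ?_
    rw [LinearMap.comp_apply, LinearMap.mulLeft_apply, monomialFunctional_monomial,
      MvPolynomial.X, MvPolynomial.monomial_mul, one_mul, monomialFunctional_monomial, add_comm]
  exact LinearMap.congr_fun this P

theorem monomialFunctional_sum {ι : Type*} (s : Finset ι) (f : ι → (σ →₀ ℕ) → R)
    (P : MvPolynomial σ R) :
    monomialFunctional (fun u => ∑ i ∈ s, f i u) P = ∑ i ∈ s, monomialFunctional (f i) P := by
  have : monomialFunctional (fun u => ∑ i ∈ s, f i u) = ∑ i ∈ s, monomialFunctional (f i) := by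
    refine linearMap_ext_monomial fun u => ?_
    simp only [LinearMap.sum_apply, monomialFunctional_monomial]
  rw [this, LinearMap.sum_apply]

theorem monomialFunctional_mul_left (c : R) (f : (σ →₀ ℕ) → R) (P : MvPolynomial σ R) :
    monomialFunctional (fun u => c * f u) P = c * monomialFunctional f P := by
  have : monomialFunctional (fun u => c * f u) = c • monomialFunctional f := by
    refine linearMap_ext_monomial fun u => ?_
    simp only [LinearMap.smul_apply, monomialFunctional_monomial, smul_eq_mul]
  rw [this, LinearMap.smul_apply, smul_eq_mul]

/-- Multiplication by a variable shifts the array of moments, so a relation between shifted arrays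
exchanges the factors X_i + X_j and X_i - X_j. -/
theorem monomialFunctional_X_add_X_mul {f g : (σ →₀ ℕ) → R} {i j : σ}
    (h : ∀ u, f (u + Finsupp.single i 1) + f (u + Finsupp.single j 1)
      = g (u + Finsupp.single i 1) - g (u + Finsupp.single j 1)) (P : MvPolynomial σ R) :
    monomialFunctional f ((MvPolynomial.X i + MvPolynomial.X j) * P)
      = monomialFunctional g ((MvPolynomial.X i - MvPolynomial.X j) * P) := by
  rw [add_mul, sub_mul, map_add, map_sub]
  simp only [monomialFunctional_X_mul]
  have : monomialFunctional (fun u => f (u + Finsupp.single i 1))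
      + monomialFunctional (fun u => f (u + Finsupp.single j 1))
      = monomialFunctional (fun u => g (u + Finsupp.single i 1))
        - monomialFunctional (fun u => g (u + Finsupp.single j 1)) := by
    refine linearMap_ext_monomial fun u => ?_
    simp only [LinearMap.add_apply, LinearMap.sub_apply, monomialFunctional_monomial, h]
  exact LinearMap.congr_fun this P

variable [IsDomain R] [CharZero R]

/-- Umbral version of Pf((x_i - x_j)/(x_i + x_j)) = ∏ (x_i - x_j)/(x_i + x_j): the functional with
Pfaffian moments against ∏ (x_i + x_j) equals the functional with product moments against ∏ (x_i -
x_j). The weight `θ`, blind to the variables in play, and the arbitrary cofactor `P` carry what the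
induction has already split off. -/
theorem monomialFunctional_pfaffian {L : ℕ → R} {β : ℕ → ℕ → R}
    (hβ : ∀ u v, β (u + 1) v + β u (v + 1) = L (u + 1) * L v - L u * L (v + 1)) :
    ∀ (n : ℕ) (v : Fin (2 * n) → σ), Function.Injective v → ∀ θ : (σ →₀ ℕ) → R,
      (∀ u i, θ (u + Finsupp.single (v i) 1) = θ u) → ∀ P : MvPolynomial σ R,
      monomialFunctional
        (fun u => θ u * pfaffian n (Matrix.of fun i j => β (u (v i)) (u (v j))))
        (pairProd 1 (2 * n) (fun i => MvPolynomial.X (v i)) * P)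
      = monomialFunctional (fun u => θ u * ∏ i, L (u (v i)))
        (pairProd (-1) (2 * n) (fun i => MvPolynomial.X (v i)) * P)
  | 0, v, _, θ, _, P => by
    simp only [pfaffian]
    rfl
  | n + 1, v, hv, θ, hθ, P => by
    let v' : Fin (2 * n + 1 + 1) → σ := v
    change monomialFunctional (fun u => θ u * pfaffian (n + 1)
        (Matrix.of fun i j => β (u (v' i)) (u (v' j))))
        (pairProd 1 (2 * n + 1 + 1) (fun i => MvPolynomial.X (v' i)) * P)
      = monomialFunctional (fun u => θ u * ∏ i : Fin (2 * n + 1 + 1), L (u (v' i)))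
        (pairProd (-1) (2 * n + 1 + 1) (fun i => MvPolynomial.X (v' i)) * P)
    have hv' : Function.Injective v' := hv
    have hθ' : ∀ u (i : Fin (2 * n + 1 + 1)), θ (u + Finsupp.single (v' i) 1) = θ u := hθ
    clear_value v'
    clear hv hθ v
    set w : Fin (2 * n + 1) → σ := fun i => v' i.succ with hw
    have hwinj : Function.Injective w := fun a b h => Fin.succ_injective _ (hv' h)
    have hw0 : ∀ i, w i ≠ v' 0 := fun i h => Fin.succ_ne_zero i (hv' h)
    have hsa : ∀ j k, w (Fin.succAbove j k) ≠ w j := fun j k h => Fin.succAbove_ne j k (hwinj h)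
    have e1 : ∀ u : σ →₀ ℕ, θ u * pfaffian (n + 1) (Matrix.of fun i j => β (u (v' i)) (u (v' j)))
        = ∑ j : Fin (2 * n + 1), (θ u * (-1) ^ (j : ℕ) * β (u (v' 0)) (u (w j))) *
          pfaffian n (Matrix.of fun i k => β (u (w (j.succAbove i))) (u (w (j.succAbove k)))) := by
      intro u
      rw [pfaffian, Finset.mul_sum]
      refine Finset.sum_congr rfl fun j _ => ?_
      rw [← mul_assoc, ← mul_assoc]
      rfl
    simp only [e1]
    rw [monomialFunctional_sum]
    -- One term of the first-row expansion. Its entry of `β` does not involve the remaining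
    -- variables and joins the weight in the induction hypothesis; afterwards the factor X_0 + X_j
    -- of the product turns this entry into moments `L`.
    have e2 : ∀ j : Fin (2 * n + 1),
        monomialFunctional (fun u => (θ u * (-1) ^ (j : ℕ) * β (u (v' 0)) (u (w j))) *
          pfaffian n (Matrix.of fun i k => β (u (w (j.succAbove i))) (u (w (j.succAbove k)))))
          (pairProd 1 (2 * n + 1 + 1) (fun i => MvPolynomial.X (v' i)) * P)
        = monomialFunctional (fun u => θ u * ∏ i : Fin (2 * n + 1 + 1), L (u (v' i)))
          ((-1) ^ (j : ℕ) * ((MvPolynomial.X (v' 0) - MvPolynomial.X (w j)) *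
            ((∏ k, (MvPolynomial.X (v' 0) + MvPolynomial.X (w (j.succAbove k)))) *
              (∏ k, (MvPolynomial.X (w j) + MvPolynomial.X (w (j.succAbove k)))) *
              pairProd (-1) (2 * n) fun k => MvPolynomial.X (w (j.succAbove k)))) * P) := by
      intro j
      set T : MvPolynomial σ R :=
        ((∏ k, (MvPolynomial.X (v' 0) + MvPolynomial.X (w (j.succAbove k)))) *
          (∏ k, (MvPolynomial.X (w j) + MvPolynomial.X (w (j.succAbove k))))) * P with hT
      have s1 : pairProd 1 (2 * n + 1 + 1) (fun i => (MvPolynomial.X (v' i) : MvPolynomial σ R)) * P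
          = pairProd 1 (2 * n) (fun k => MvPolynomial.X (w (j.succAbove k))) *
            ((MvPolynomial.X (v' 0) + MvPolynomial.X (w j)) * T) := by
        rw [pairProd, pairProd_succAbove 1 (by ring) (2 * n) _ j, Fin.prod_univ_succAbove _ j, hT]
        simp only [one_mul, one_pow, hw]
        ring
      rw [s1, monomialFunctional_pfaffian hβ n (fun k => w (j.succAbove k))
        (hwinj.comp Fin.succAbove_right_injective)
        (fun u => θ u * (-1) ^ (j : ℕ) * β (u (v' 0)) (u (w j)))]
      · rw [mul_left_comm]
        have s2 : ∀ Q : MvPolynomial σ R, monomialFunctional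
            (fun u => θ u * (-1) ^ (j : ℕ) * β (u (v' 0)) (u (w j)) *
              ∏ i, L (u (w (j.succAbove i)))) ((MvPolynomial.X (v' 0) + MvPolynomial.X (w j)) * Q)
            = monomialFunctional (fun u => (-1) ^ (j : ℕ) *
              (θ u * ∏ i : Fin (2 * n + 1 + 1), L (u (v' i))))
              ((MvPolynomial.X (v' 0) - MvPolynomial.X (w j)) * Q) := by
          intro Q
          refine monomialFunctional_X_add_X_mul (fun u => ?_) Q
          have r1 : ∀ k, (u + Finsupp.single (v' 0) 1 : σ →₀ ℕ) (w (j.succAbove k))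
              = u (w (j.succAbove k)) := fun k => by
            simp [(hw0 (j.succAbove k)).symm]
          have r2 : ∀ k, (u + Finsupp.single (w j) 1 : σ →₀ ℕ) (w (j.succAbove k))
              = u (w (j.succAbove k)) := fun k => by
            simp [(hsa j k).symm]
          have r3 : (u + Finsupp.single (v' 0) 1 : σ →₀ ℕ) (w j) = u (w j) := by
            simp [(hw0 j).symm]
          have r4 : (u + Finsupp.single (w j) 1 : σ →₀ ℕ) (v' 0) = u (v' 0) := by
            simp [hw0 j]
          have r5 : (u + Finsupp.single (v' 0) 1 : σ →₀ ℕ) (v' 0) = u (v' 0) + 1 := by simp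
          have r6 : (u + Finsupp.single (w j) 1 : σ →₀ ℕ) (w j) = u (w j) + 1 := by simp
          have r7 : θ (u + Finsupp.single (v' 0) 1) = θ u := hθ' u 0
          have r8 : θ (u + Finsupp.single (w j) 1) = θ u := hθ' u j.succ
          have r9 : ∀ u : σ →₀ ℕ, ∏ i : Fin (2 * n + 1 + 1), L (u (v' i))
              = L (u (v' 0)) * (L (u (w j)) * ∏ k, L (u (w (j.succAbove k)))) := fun u => by
            rw [Fin.prod_univ_succ, Fin.prod_univ_succAbove _ j]
          simp only [r9, r1, r2, r3, r4, r5, r6, r7, r8]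
          linear_combination (θ u * (-1) ^ (j : ℕ) * ∏ k, L (u (w (j.succAbove k)))) *
            hβ (u (v' 0)) (u (w j))
        rw [s2, monomialFunctional_mul_left]
        have s3 : ∀ (Q : MvPolynomial σ R) (F : MvPolynomial σ R →ₗ[R] R),
            (-1) ^ (j : ℕ) * F Q = F ((-1) ^ (j : ℕ) * Q) := fun Q F => by
          rcases Nat.even_or_odd (j : ℕ) with hj | hj
          · rw [hj.neg_one_pow, hj.neg_one_pow, one_mul, one_mul]
          · rw [hj.neg_one_pow, hj.neg_one_pow, neg_one_mul, neg_one_mul, map_neg]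
        rw [s3]
        congr 1
        rw [hT]
        ring
      · intro u k
        have r1 : (u + Finsupp.single (w (j.succAbove k)) 1 : σ →₀ ℕ) (v' 0) = u (v' 0) := by
          simp [hw0 (j.succAbove k)]
        have r2 : (u + Finsupp.single (w (j.succAbove k)) 1 : σ →₀ ℕ) (w j) = u (w j) := by
          simp [hsa j k]
        rw [r1, r2]
        congr 2
        exact hθ' u (j.succAbove k).succ
    rw [Finset.sum_congr rfl fun j _ => e2 j, ← map_sum, ← Finset.sum_mul,
      sum_pairProd (S := MvPolynomial σ R) (y := fun k => MvPolynomial.X (w k))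
        ((MvPolynomial.X_injective).comp hwinj) (fun k => MvPolynomial.X_ne_zero _)]
    have e3 : pairProd (-1) (2 * n + 1 + 1) (fun i => (MvPolynomial.X (v' i) : MvPolynomial σ R))
        = (∏ j, (MvPolynomial.X (v' 0) + -1 * MvPolynomial.X (w j))) *
          pairProd (-1) (2 * n + 1) fun i => MvPolynomial.X (w i) := rfl
    rw [e3]
    simp only [neg_one_mul, ← sub_eq_add_neg]

end Hankel

end

end MixedExpansion

namespace MixedExpansion

noncomputable section

/-! ### From the functional identity to Hankel determinants. -/

section HankelPfaffian

variable {R : Type*} [CommRing R]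

/-- The bilinear form on a free module with a given Gram matrix. -/
def gramForm {ι : Type*} (β : ι → ι → R) : LinearMap.BilinForm R (ι →₀ R) :=
  Finsupp.linearCombination R fun i => Finsupp.linearCombination R (β i)

theorem gramForm_single {ι : Type*} (β : ι → ι → R) (i j : ι) :
    gramForm β (Finsupp.single i 1) (Finsupp.single j 1) = β i j := by
  simp [gramForm, Finsupp.linearCombination_single]

theorem monomialFunctional_prod_X_pow {k : ℕ} (f : (Fin k →₀ ℕ) → R) (e : Fin k → ℕ) :
    monomialFunctional f (∏ i, MvPolynomial.X i ^ e i)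
      = f (Finsupp.equivFunOnFinite.symm e) := by
  rw [← monomialFunctional_monomial f, MvPolynomial.monomial_eq, Finsupp.prod_fintype]
  · simp
  · simp

theorem det_vandermonde_eq_sum {S : Type*} [CommRing S] {k : ℕ} (w : Fin k → S) :
    (Matrix.vandermonde w).det
      = ∑ τ : Equiv.Perm (Fin k), ((Equiv.Perm.sign τ : ℤ) : S) * ∏ i, w i ^ (τ i : ℕ) := by
  rw [← Matrix.det_transpose, Matrix.det_apply']
  rfl

theorem monomialFunctional_int_mul {σ : Type*} (f : (σ →₀ ℕ) → R) (c : ℤ) (P : MvPolynomial σ R) :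
    monomialFunctional f (c * P) = c * monomialFunctional f P := by
  rw [← zsmul_eq_mul, map_zsmul, zsmul_eq_mul]

theorem prod_neg_one_pow_mul_self {S : Type*} [CommRing S] (k : ℕ) :
    (∏ i : Fin k, (-1 : S) ^ (i : ℕ)) * ∏ i : Fin k, (-1 : S) ^ (i : ℕ) = 1 := by
  rw [← Finset.prod_mul_distrib]
  exact Finset.prod_eq_one fun i _ => by rw [← mul_pow]; simp

theorem sign_mul_sign {k : ℕ} (τ : Equiv.Perm (Fin k)) :
    ((Equiv.Perm.sign τ : ℤ) : R) * ((Equiv.Perm.sign τ : ℤ) : R) = 1 := by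
  rw [← Int.cast_mul, ← Units.val_mul, Int.units_mul_self]
  simp

variable [IsDomain R] [CharZero R]

theorem gramForm_self {ι : Type*} {β : ι → ι → R} (hβ : ∀ i j, β i j = -β j i) (x : ι →₀ R) :
    gramForm β x x = 0 := by
  have h : gramForm β = -(gramForm β).flip := by
    refine Finsupp.lhom_ext' fun i => LinearMap.ext_ring (Finsupp.lhom_ext' fun j =>
      LinearMap.ext_ring ?_)
    change gramForm β (Finsupp.single i 1) (Finsupp.single j 1)
      = -gramForm β (Finsupp.single j 1) (Finsupp.single i 1)
    rw [gramForm_single, gramForm_single, hβ]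
  have h2 : gramForm β x x = -gramForm β x x := LinearMap.congr_fun (LinearMap.congr_fun h x) x
  have h3 : 2 * gramForm β x x = 0 := by linear_combination h2
  exact (mul_eq_zero.mp h3).resolve_left two_ne_zero

theorem pfaffian_perm {ι : Type*} {β : ι → ι → R} (hβ : ∀ i j, β i j = -β j i) {n : ℕ}
    (v : Fin (2 * n) → ι) (τ : Equiv.Perm (Fin (2 * n))) :
    pfaffian n (Matrix.of fun i j => β (v (τ i)) (v (τ j)))
      = (Equiv.Perm.sign τ : ℤ) * pfaffian n (Matrix.of fun i j => β (v i) (v j)) := by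
  have h : ∀ w : Fin (2 * n) → ι, pfaffian n (Matrix.of fun i j => β (w i) (w j))
      = pfaffianForm (gramForm β) (gramForm_self hβ)
        (ExteriorAlgebra.ιMulti R (2 * n) fun i => Finsupp.single (w i) 1) := by
    intro w
    rw [pfaffianForm_ιMulti]
    simp only [gramForm_single]
  rw [h, h]
  have := AlternatingMap.map_perm (ExteriorAlgebra.ιMulti R (2 * n) (M := ι →₀ R))
    (fun i => Finsupp.single (v i) 1) τ
  simp only [Function.comp_def] at this
  rw [this, Units.smul_def, map_zsmul, zsmul_eq_mul]

/-- If `β` is skew-symmetric and satisfies the relation of `(x - y) / (x + y)` with respect to the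
moments `L`, then the Pfaffian of its even part is the Hankel determinant of `L`, up to sign. -/
theorem pfaffian_eq_hankel {L : ℕ → R} {β : ℕ → ℕ → R} (hskew : ∀ u v, β u v = -β v u)
    (hβ : ∀ u v, β (u + 1) v + β u (v + 1) = L (u + 1) * L v - L u * L (v + 1)) (n : ℕ) :
    pfaffian n (Matrix.of fun i j => β (2 * i) (2 * j))
      = (∏ i : Fin (2 * n), (-1) ^ (i : ℕ)) *
        (Matrix.of fun i j : Fin (2 * n) => L (i + j)).det := by
  -- Testing on P = ∏ (x_i - x_j) gives a Vandermonde product in the squares on one side, hence even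
  -- indices, and a squared Vandermonde product on the other, hence Hankel entries. Each permutation
  -- contributes equally, so both sides carry a factor (2n)!.
  have h := monomialFunctional_pfaffian (σ := Fin (2 * n)) hβ n id Function.injective_id
    (fun _ => 1) (fun _ _ => rfl) (pairProd (-1) (2 * n) MvPolynomial.X)
  simp only [id_eq, one_mul] at h
  have e1 : pairProd 1 (2 * n) (fun i => (MvPolynomial.X i : MvPolynomial (Fin (2 * n)) R)) *
      pairProd (-1) (2 * n) MvPolynomial.X
      = ∑ τ : Equiv.Perm (Fin (2 * n)), (((∏ i : Fin (2 * n), (-1) ^ (i : ℕ)) *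
        (Equiv.Perm.sign τ : ℤ) : ℤ) : MvPolynomial (Fin (2 * n)) R) *
        ∏ i, MvPolynomial.X i ^ (2 * (τ i : ℕ)) := by
    rw [pairProd_mul_pairProd_neg, pairProd_neg_one_eq_det, det_vandermonde_eq_sum, Finset.mul_sum]
    refine Finset.sum_congr rfl fun τ _ => ?_
    push_cast
    simp only [pow_mul, mul_assoc]
  have e2 : pairProd (-1) (2 * n) (fun i => (MvPolynomial.X i : MvPolynomial (Fin (2 * n)) R)) *
      pairProd (-1) (2 * n) MvPolynomial.X
      = ∑ τ : Equiv.Perm (Fin (2 * n)), ∑ ρ : Equiv.Perm (Fin (2 * n)),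
        (((Equiv.Perm.sign τ : ℤ) * (Equiv.Perm.sign ρ : ℤ) : ℤ) :
          MvPolynomial (Fin (2 * n)) R) * ∏ i, MvPolynomial.X i ^ ((τ i : ℕ) + (ρ i : ℕ)) := by
    rw [pairProd_neg_one_eq_det, mul_mul_mul_comm, prod_neg_one_pow_mul_self, one_mul,
      det_vandermonde_eq_sum, Finset.sum_mul_sum]
    refine Finset.sum_congr rfl fun τ _ => Finset.sum_congr rfl fun ρ _ => ?_
    push_cast
    simp only [pow_add, Finset.prod_mul_distrib]
    ring
  rw [e1, e2] at h
  simp only [map_sum, monomialFunctional_int_mul, monomialFunctional_prod_X_pow,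
    Finsupp.equivFunOnFinite_symm_apply_apply] at h
  set s : R := ∏ i : Fin (2 * n), (-1) ^ (i : ℕ) with hs
  have l1 : ∀ τ : Equiv.Perm (Fin (2 * n)),
      (((∏ i : Fin (2 * n), (-1) ^ (i : ℕ)) * (Equiv.Perm.sign τ : ℤ) : ℤ) : R) *
        pfaffian n (Matrix.of fun i j => β (2 * (τ i : ℕ)) (2 * (τ j : ℕ)))
      = s * pfaffian n (Matrix.of fun i j : Fin (2 * n) => β (2 * (i : ℕ)) (2 * (j : ℕ))) := by
    intro τ
    rw [pfaffian_perm hskew (fun i : Fin (2 * n) => 2 * (i : ℕ)) τ]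
    push_cast
    rw [← hs]
    linear_combination s * pfaffian n
      (Matrix.of fun i j : Fin (2 * n) => β (2 * (i : ℕ)) (2 * (j : ℕ))) * sign_mul_sign (R := R) τ
  have l2 : ∀ τ : Equiv.Perm (Fin (2 * n)),
      ∑ ρ : Equiv.Perm (Fin (2 * n)),
        (((Equiv.Perm.sign τ : ℤ) * (Equiv.Perm.sign ρ : ℤ) : ℤ) : R) *
          ∏ i, L ((τ i : ℕ) + (ρ i : ℕ))
      = (Matrix.of fun i j : Fin (2 * n) => L (i + j)).det := by
    intro τ
    have := Matrix.det_permute τ (Matrix.of fun i j : Fin (2 * n) => L (i + j))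
    have h2 : (Matrix.submatrix (Matrix.of fun i j : Fin (2 * n) => L (i + j)) τ id).det
        = ∑ ρ : Equiv.Perm (Fin (2 * n)), ((Equiv.Perm.sign ρ : ℤ) : R) *
          ∏ i, L ((τ i : ℕ) + (ρ i : ℕ)) := by
      rw [← Matrix.det_transpose, Matrix.det_apply']
      rfl
    push_cast
    simp only [mul_assoc]
    rw [← Finset.mul_sum, ← h2, this, ← mul_assoc, sign_mul_sign, one_mul]
  rw [Finset.sum_congr rfl fun τ _ => l1 τ, Finset.sum_congr rfl fun τ _ => l2 τ, Finset.sum_const,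
    Finset.sum_const, nsmul_eq_mul, nsmul_eq_mul] at h
  have hc : ((Finset.univ : Finset (Equiv.Perm (Fin (2 * n)))).card : R) ≠ 0 :=
    Nat.cast_ne_zero.mpr (Finset.card_ne_zero.mpr Finset.univ_nonempty)
  have h' := mul_left_cancel₀ hc h
  rw [← h', ← mul_assoc, prod_neg_one_pow_mul_self, one_mul]

/-- The version of `pfaffian_eq_hankel` for an odd number of vectors. -/
theorem pfaffian_eq_hankel_odd {L : ℕ → R} {β : ℕ → ℕ → R} (hskew : ∀ u v, β u v = -β v u)
    (hβ : ∀ u v, β (u + 1) v + β u (v + 1) = L (u + 1) * L v - L u * L (v + 1)) (n : ℕ) :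
    ∑ j : Fin (2 * n + 1), (-1) ^ (j : ℕ) * L (2 * (j + 1)) *
      pfaffian n (Matrix.of fun i k =>
        β (2 * ((j.succAbove i : ℕ) + 1)) (2 * ((j.succAbove k : ℕ) + 1)))
      = (∏ i : Fin (2 * n + 1), (-1) ^ (i : ℕ)) *
        (Matrix.of fun i j : Fin (2 * n + 1) => L (i + j + 2)).det := by
  -- Adding 1 to L(0) and a matching rank-two term to `β` preserves both hypotheses. In the even
  -- identity of size 2n + 2, the change of the determinant is the cofactor of its corner, and that
  -- of the Pfaffian is the required sum up to sign.
  obtain ⟨L', γ, hL0, hL, hγ0, hγ, hγskew, hγrel⟩ : ∃ (L' : ℕ → R) (γ : ℕ → ℕ → R),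
      L' 0 = L 0 + 1 ∧ (∀ u, L' (u + 1) = L (u + 1)) ∧
      (∀ v, γ 0 (v + 1) = β 0 (v + 1) - L (v + 1)) ∧
      (∀ u v, γ (u + 1) (v + 1) = β (u + 1) (v + 1)) ∧ (∀ u v, γ u v = -γ v u) ∧
      ∀ u v, γ (u + 1) v + γ u (v + 1) = L' (u + 1) * L' v - L' u * L' (v + 1) := by
    let ε : ℕ → R := fun u => if u = 0 then 1 else 0
    have hε : ∀ u, ε (u + 1) = 0 := fun u => if_neg (Nat.succ_ne_zero u)
    have hε0 : ε 0 = 1 := if_pos rfl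
    refine ⟨fun u => L u + ε u, fun u v => β u v + (L u * ε v - ε u * L v), ?_, ?_, ?_, ?_, ?_, ?_⟩
    · simp only [hε0]
    · intro u
      simp only [hε, add_zero]
    · intro v
      simp only [hε, hε0]
      ring
    · intro u v
      simp only [hε]
      ring
    · intro u v
      simp only [hskew u v]
      ring
    · intro u v
      simp only [hε]
      linear_combination hβ u v
  have h0 := pfaffian_eq_hankel hskew hβ (n + 1)
  have h1 := pfaffian_eq_hankel hγskew hγrel (n + 1)
  have p1 : ∀ γ : ℕ → ℕ → R, pfaffian (n + 1)
      (Matrix.of fun i j : Fin (2 * (n + 1)) => γ (2 * (i : ℕ)) (2 * (j : ℕ)))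
      = ∑ j : Fin (2 * n + 1), (-1) ^ (j : ℕ) * γ 0 (2 * (j + 1)) *
      pfaffian n (Matrix.of fun i k =>
        γ (2 * ((j.succAbove i : ℕ) + 1)) (2 * ((j.succAbove k : ℕ) + 1))) := by
    intro γ
    rw [pfaffian]
    refine Finset.sum_congr rfl fun j _ => ?_
    congr 1
  have d1 : ∀ M : ℕ → R, (Matrix.of fun i j : Fin (2 * n + 1 + 1) => M (i + j)).det
      = M 0 * (Matrix.of fun i j : Fin (2 * n + 1) => M (i + j + 2)).det
        + ∑ j : Fin (2 * n + 1), (-1) ^ (j + 1 : ℕ) * M (j + 1) *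
          (Matrix.of fun i k : Fin (2 * n + 1) => M (i + 1 + (j.succ.succAbove k : ℕ))).det := by
    intro M
    rw [Matrix.det_succ_row_zero, Fin.sum_univ_succ]
    congr 1
    · simp only [Fin.val_zero, pow_zero, one_mul, Matrix.of_apply, add_zero, Fin.succAbove_zero]
      congr 2
      ext i j
      simp only [Matrix.submatrix_apply, Matrix.of_apply, Fin.val_succ]
      congr 1
      ring
    · refine Finset.sum_congr rfl fun j _ => ?_
      simp only [Fin.val_zero, zero_add, Matrix.of_apply, Fin.val_succ]
      congr 2
  rw [p1] at h0 h1
  have h0' := h0.trans (congrArg (_ * ·) (d1 L))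
  have h1' := h1.trans (congrArg (_ * ·) (d1 L'))
  have e1 : ∀ a b : ℕ, γ (2 * (a + 1)) (2 * (b + 1)) = β (2 * (a + 1)) (2 * (b + 1)) :=
    fun a b => hγ (2 * a + 1) (2 * b + 1)
  have e2 : ∀ b : ℕ, γ 0 (2 * (b + 1)) = β 0 (2 * (b + 1)) - L (2 * (b + 1)) :=
    fun b => hγ0 (2 * b + 1)
  have e3 : ∀ (a b : ℕ), L' (a + 1 + b) = L (a + 1 + b) := fun a b => by
    rw [show a + 1 + b = a + b + 1 by ring, hL]
  have e4 : ∀ a : ℕ, L' (a + 2) = L (a + 2) := fun a => hL (a + 1)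
  simp only [e1, e2, e3, e4, hL, hL0, mul_sub, sub_mul, Finset.sum_sub_distrib] at h1'
  have hs : (∏ i : Fin (2 * (n + 1)), (-1 : R) ^ (i : ℕ))
      = -∏ i : Fin (2 * n + 1), (-1 : R) ^ (i : ℕ) := by
    have := Fin.prod_univ_castSucc fun i : Fin (2 * n + 1 + 1) => (-1 : R) ^ (i : ℕ)
    refine this.trans ?_
    simp only [Fin.val_castSucc, Fin.val_last]
    rw [pow_succ, pow_mul]
    simp
  rw [hs] at h0' h1'
  linear_combination h0' - h1'

end HankelPfaffian

end

end MixedExpansion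

namespace MixedExpansion

noncomputable section

/-! ### Expansion of rectangular Schur functions -/

section AlternatingExpansion

variable {R : Type*} [CommRing R]

/-- An alternating map in terms of the minors of its arguments. -/
theorem alternatingMap_eq_sum_det {N a : ℕ} (f : (Fin N → R) [⋀^Fin a]→ₗ[R] R)
    (v : Fin a → Fin N → R) :
    f v = ∑ s : Set.powersetCard (Fin N) a,
      (Matrix.of fun i j => v i (Set.powersetCard.ofFinEmbEquiv.symm s j)).det *
        f fun j => Pi.single (Set.powersetCard.ofFinEmbEquiv.symm s j) 1 := by
  set b := (Pi.basisFun R (Fin N)).exteriorPower a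
  have h := b.sum_repr (exteriorPower.ιMulti R a v)
  have h2 := congrArg (exteriorPower.alternatingMapLinearEquiv f) h
  rw [exteriorPower.alternatingMapLinearEquiv_apply_ιMulti, map_sum] at h2
  rw [← h2]
  refine Finset.sum_congr rfl fun s _ => ?_
  rw [map_smul, smul_eq_mul, exteriorPower.basis_repr_apply,
    exteriorPower.ιMultiDual_apply_ιMulti, exteriorPower.basis_apply,
    exteriorPower.ιMulti_family, exteriorPower.alternatingMapLinearEquiv_apply_ιMulti]
  congr 2
  funext j
  simp

theorem sign_revPerm (a : ℕ) :
    ((Equiv.Perm.sign (Fin.revPerm : Equiv.Perm (Fin a)) : ℤ) : R)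
      = ∏ i : Fin a, (-1) ^ (i : ℕ) := by
  have h : Equiv.Perm.sign (Fin.revPerm : Equiv.Perm (Fin a)) = ∏ i : Fin a, (-1) ^ (i : ℕ) := by
    rw [Equiv.Perm.sign_eq_prod_prod_Ioi, ← Equiv.prod_comp Fin.revPerm]
    refine Finset.prod_congr rfl fun i _ => ?_
    have : ∀ j ∈ Finset.Ioi (Fin.revPerm i),
        (if Fin.revPerm (Fin.revPerm i) < Fin.revPerm j then (1 : ℤˣ) else -1) = -1 := by
      intro j hj
      rw [Finset.mem_Ioi] at hj
      rw [if_neg]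
      rw [not_lt]
      exact (Fin.rev_lt_rev.mpr hj).le
    rw [Finset.prod_congr rfl this, Finset.prod_const, Fin.card_Ioi, Fin.revPerm_apply,
      Fin.val_rev]
    congr 1
    omega
  rw [h]
  simp

theorem det_reverse_columns {a : ℕ} (f : Fin a → Fin a → R) :
    (Matrix.of fun i j => f i j.rev).det
      = (∏ i : Fin a, (-1) ^ (i : ℕ)) * (Matrix.of f).det := by
  rw [← sign_revPerm, ← Matrix.det_permute']
  rfl

end AlternatingExpansion

/-! ### The Pfaffian functional and the auxiliary vector. -/

section Fock

variable {R : Type*} [CommRing R] [Algebra ℚ R]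

/-- The kernel on the integers and one more index, which stands for the constant `1`. -/
def extKernel (t : ℕ+ → R) : Option ℤ → Option ℤ → R
  | some a, some b => kernel t a b
  | none, some b => qInt t b
  | some a, none => -qInt t a
  | none, none => 0

theorem extKernel_swap (t : ℕ+ → R) : ∀ a b, extKernel t a b = -extKernel t b a
  | some a, some b => kernel_swap t a b
  | none, some _ => (neg_neg _).symm
  | some _, none => rfl
  | none, none => neg_zero.symm

/-- The basis vector of index `a`. -/
def basisVec (R : Type*) [CommRing R] (a : ℤ) : Option ℤ →₀ R := Finsupp.single (some a) 1

/-- The additional basis vector. -/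
def basisInf (R : Type*) [CommRing R] : Option ℤ →₀ R := Finsupp.single none 1

theorem gramForm_sum_sum (t : ℕ+ → R) {ι : Type*} (s s' : Finset ι) (c c' : ι → R) (φ φ' : ι → ℤ) :
    gramForm (extKernel t) (∑ j ∈ s, c j • basisVec R (φ j)) (∑ j ∈ s', c' j • basisVec R (φ' j))
      = ∑ j ∈ s, ∑ k ∈ s', c j * (c' k * kernel t (φ j) (φ' k)) := by
  simp only [map_sum, LinearMap.sum_apply, map_smul, LinearMap.smul_apply, smul_eq_mul, basisVec,
    gramForm_single, extKernel]
  simp only [Finset.mul_sum]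
  rw [Finset.sum_comm]
  exact Finset.sum_congr rfl fun j _ => Finset.sum_congr rfl fun k _ => by ring

theorem gramForm_inf_sum (t : ℕ+ → R) {ι : Type*} (s : Finset ι) (c : ι → R) (φ : ι → ℤ) :
    gramForm (extKernel t) (basisInf R) (∑ j ∈ s, c j • basisVec R (φ j))
      = ∑ j ∈ s, c j * qInt t (φ j) := by
  simp only [map_sum, map_smul, smul_eq_mul, basisVec, basisInf, gramForm_single, extKernel]

variable [IsDomain R] [CharZero R]

/-- The Pfaffian functional of the extended kernel. -/
def fockPf (t : ℕ+ → R) : ExteriorAlgebra R (Option ℤ →₀ R) →ₗ[R] R :=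
  pfaffianForm (gramForm (extKernel t)) (gramForm_self (extKernel_swap t))

/-- The functional giving Schur `Q`-functions on products of any number of basis vectors: a product
of odd length is completed by the additional basis vector. -/
def fock (t : ℕ+ → R) : ExteriorAlgebra R (Option ℤ →₀ R) →ₗ[R] R :=
  fockPf t + fockPf t ∘ₗ LinearMap.mulLeft R (ExteriorAlgebra.ι R (basisInf R))

theorem fock_apply (t : ℕ+ → R) (x : ExteriorAlgebra R (Option ℤ →₀ R)) :
    fock t x = fockPf t x + fockPf t (ExteriorAlgebra.ι R (basisInf R) * x) := rfl

theorem fock_ιMulti_even (t : ℕ+ → R) (n : ℕ) (v : Fin (2 * n) → Option ℤ →₀ R) :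
    fock t (ExteriorAlgebra.ιMulti R (2 * n) v)
      = pfaffian n (Matrix.of fun i j => gramForm (extKernel t) (v i) (v j)) := by
  have h := pfaffianForm_ιMulti_odd (gramForm_self (extKernel_swap t)) n
    (Fin.cons (basisInf R) v)
  rw [ExteriorAlgebra.ιMulti_succ_apply] at h
  rw [fock_apply, fockPf, pfaffianForm_ιMulti]
  have h' : pfaffianForm (gramForm (extKernel t)) (gramForm_self (extKernel_swap t))
    (ExteriorAlgebra.ι R (basisInf R) * ExteriorAlgebra.ιMulti R (2 * n) v) = 0 := h
  rw [h', add_zero]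

theorem fock_ιMulti_odd (t : ℕ+ → R) (n : ℕ) (v : Fin (2 * n + 1) → Option ℤ →₀ R) :
    fock t (ExteriorAlgebra.ιMulti R (2 * n + 1) v)
      = ∑ j : Fin (2 * n + 1), (-1) ^ (j : ℕ) * gramForm (extKernel t) (basisInf R) (v j) *
        pfaffian n (Matrix.of fun i k =>
          gramForm (extKernel t) (v (j.succAbove i)) (v (j.succAbove k))) := by
  rw [fock_apply, fockPf, pfaffianForm_ιMulti_odd, zero_add, pfaffianForm_ι_mul,
    contractLeft_ιMulti, map_sum]
  refine Finset.sum_congr rfl fun j _ => ?_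
  rw [map_smul, pfaffianForm_ιMulti, smul_eq_mul]

end Fock

/-! ### Evaluation on moment vectors, and the expansion into minors. -/

section Moments

variable {R : Type*} [CommRing R] [Algebra ℚ R]

/-- Truncation: only the indices `-(N-1), …, N-1` matter. -/
theorem sum_range_eq_sum_fin (t : ℕ+ → R) (N i K : ℕ) (hK : N ≤ K) (F : ℤ → R)
    (hF : ∀ b : ℤ, b < -(N - 1) → b < 0 → F b = 0) :
    ∑ r ∈ Finset.range K, hPoly t r * F (N - 1 - 2 * i - 2 * r)
      = ∑ j : Fin N, hInt t (N - 1 - j - i) * F (2 * j - (N - 1)) := by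
  refine Finset.sum_bij_ne_zero (fun r _ h => (⟨N - 1 - i - r, ?_⟩ : Fin N)) ?_ ?_ ?_ ?_
  · by_contra hc
    rw [hF _ (by omega) (by omega), mul_zero] at h
    exact h rfl
  · intro r hr h
    exact Finset.mem_univ _
  · intro r hr h r' hr' h' e
    have b : ∀ r : ℕ, hPoly t r * F (N - 1 - 2 * i - 2 * r) ≠ 0 → i + r ≤ N - 1 ∧ 0 < N := by
      intro r h
      by_contra hc
      rw [hF _ (by omega) (by omega), mul_zero] at h
      exact h rfl
    have b1 := b r h
    have b2 := b r' h'
    rw [Fin.mk.injEq] at e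
    omega
  · intro j _ h
    have hj := j.isLt
    have hle : 0 ≤ (N : ℤ) - 1 - j - i := by
      by_contra hc
      rw [hInt_of_neg t (by omega), zero_mul] at h
      exact h rfl
    have e : (N : ℤ) - 1 - j - i = ((N - 1 - j - i : ℕ) : ℤ) := by omega
    have e2 : (N : ℤ) - 1 - 2 * i - 2 * ((N - 1 - j - i : ℕ) : ℤ) = 2 * j - (N - 1) := by omega
    refine ⟨N - 1 - j - i, by simp only [Finset.mem_range]; omega, ?_, ?_⟩
    · rwa [e2, ← hInt_natCast, ← e]
    · ext
      simp only
      omega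
  · intro r hr h
    have b : i + r ≤ N - 1 ∧ 0 < N := by
      by_contra hc
      rw [hF _ (by omega) (by omega), mul_zero] at h
      exact h rfl
    have e1 : (N : ℤ) - 1 - ((N - 1 - i - r : ℕ) : ℤ) - i = r := by omega
    have e2 : 2 * ((N - 1 - i - r : ℕ) : ℤ) - (N - 1) = N - 1 - 2 * i - 2 * r := by omega
    simp only [e1, e2, hInt_natCast]

/-- The form whose even part is the Gram matrix of the vectors `momentVec`. -/
def momentForm (t t' : ℕ+ → R) (c : ℤ) (K u v : ℕ) : R :=
  ∑ r ∈ Finset.range K, ∑ s ∈ Finset.range K,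
    hPoly t' r * (hPoly t' s * kernel t (c - u - 2 * r) (c - v - 2 * s))

theorem momentForm_swap (t t' : ℕ+ → R) (c : ℤ) (K u v : ℕ) :
    momentForm t t' c K u v = -momentForm t t' c K v u := by
  rw [momentForm, momentForm, Finset.sum_comm, ← Finset.sum_neg_distrib]
  refine Finset.sum_congr rfl fun s _ => ?_
  rw [← Finset.sum_neg_distrib]
  refine Finset.sum_congr rfl fun r _ => ?_
  rw [kernel_swap]
  ring

/-- The relation of the kernel is linear and invariant under shifts of the indices, so it passes to
the convolution; there h(z) = q(z) h^{(2)}(z²) assembles the q's into h's. The bound on `c` ensures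
that the truncation at `K` loses nothing. -/
theorem momentForm_add_one [IsAddTorsionFree R] (t : ℕ+ → R) (c : ℤ) (K : ℕ) (hc : c < 2 * K)
    (u v : ℕ) :
    momentForm t (fun j => t (2 * j)) c K (u + 1) v + momentForm t (fun j => t (2 * j)) c K u (v + 1)
      = hInt t (c - (u + 1 : ℕ)) * hInt t (c - v) - hInt t (c - u) * hInt t (c - (v + 1 : ℕ)) := by
  rw [hInt_eq_sum t (c - u) K (by omega), hInt_eq_sum t (c - v) K (by omega),
    hInt_eq_sum t (c - (u + 1 : ℕ)) K (by omega), hInt_eq_sum t (c - (v + 1 : ℕ)) K (by omega),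
    Finset.sum_mul_sum, Finset.sum_mul_sum, momentForm, momentForm, ← Finset.sum_add_distrib,
    ← Finset.sum_sub_distrib]
  refine Finset.sum_congr rfl fun r _ => ?_
  rw [← Finset.sum_add_distrib, ← Finset.sum_sub_distrib]
  refine Finset.sum_congr rfl fun s _ => ?_
  have h := kernel_add_one t (c - (u + 1 : ℕ) - 2 * r) (c - (v + 1 : ℕ) - 2 * s)
  rw [show c - (u + 1 : ℕ) - 2 * r + 1 = c - u - 2 * r by push_cast; ring,
    show c - (v + 1 : ℕ) - 2 * s + 1 = c - v - 2 * s by push_cast; ring] at h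
  linear_combination (hPoly (fun j => t (2 * j)) r * hPoly (fun j => t (2 * j)) s) * h

/-- The vector `∑_j h_{N-1-j-i} e_{2j-(N-1)}`. -/
def momentVec (t' : ℕ+ → R) (N i : ℕ) : Option ℤ →₀ R :=
  ∑ j : Fin N, hInt t' (N - 1 - j - i) • basisVec R (2 * j - (N - 1))

/-- With r = N - 1 - j - i the index 2j - (N - 1) becomes N - 1 - 2i - 2r. The additional terms of
the longer sums have indices below -(N - 1), which the kernel pairs to zero with every index up to N
- 1. -/
theorem gramForm_momentVec (t t' : ℕ+ → R) (N K : ℕ) (hK : N ≤ K) (i k : ℕ) :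
    gramForm (extKernel t) (momentVec t' N i) (momentVec t' N k)
      = ∑ r ∈ Finset.range K, ∑ s ∈ Finset.range K,
        hPoly t' r * (hPoly t' s * kernel t (N - 1 - 2 * i - 2 * r) (N - 1 - 2 * k - 2 * s)) := by
  rw [momentVec, momentVec, gramForm_sum_sum]
  simp only [← Finset.mul_sum]
  symm
  have hz : ∀ r ∈ Finset.range K, hPoly t' r * ∑ s ∈ Finset.range K,
      hPoly t' s * kernel t (N - 1 - 2 * i - 2 * r) (N - 1 - 2 * k - 2 * s)
      = hPoly t' r * ∑ j : Fin N, hInt t' (N - 1 - j - k) *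
        kernel t (N - 1 - 2 * i - 2 * r) (2 * j - (N - 1)) := by
    intro r _
    rw [sum_range_eq_sum_fin t' N k K hK fun b => kernel t (N - 1 - 2 * i - 2 * r) b]
    intro b hb hb'
    exact kernel_of_neg_right t hb' (by omega)
  rw [Finset.sum_congr rfl hz, sum_range_eq_sum_fin t' N i K hK fun a =>
    ∑ j : Fin N, hInt t' (N - 1 - j - k) * kernel t a (2 * j - (N - 1))]
  intro b hb hb'
  refine Finset.sum_eq_zero fun j _ => ?_
  have := j.isLt
  rw [kernel_of_neg_left t hb' (by omega), mul_zero]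

theorem gramForm_inf_momentVec [IsAddTorsionFree R] (t : ℕ+ → R) (N i : ℕ) :
    gramForm (extKernel t) (basisInf R) (momentVec (fun j => t (2 * j)) N i)
      = hInt t (N - 1 - 2 * i) := by
  rw [momentVec, gramForm_inf_sum, hInt_eq_sum t (N - 1 - 2 * i) (N + 1) (by omega),
    sum_range_eq_sum_fin _ N i (N + 1) (by omega)]
  intro b _ hb
  exact qInt_of_neg t hb

variable [IsDomain R] [CharZero R]

/-- Reversing the columns turns the Toeplitz determinant into a Hankel determinant, with the same
sign as in the Pfaffian evaluation, so the signs cancel. -/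
theorem fock_ιMulti_momentVec [IsAddTorsionFree R] (t : ℕ+ → R) (N a : ℕ) :
    fock t (ExteriorAlgebra.ιMulti R a fun i => momentVec (fun j => t (2 * j)) N i)
      = (Matrix.of fun i j : Fin a => hInt t (N - a + j - i)).det := by
  have hrev : (Matrix.of fun i j : Fin a => hInt t (N - a + j - i)).det
      = (∏ i : Fin a, (-1) ^ (i : ℕ)) *
        (Matrix.of fun i j : Fin a => hInt t (N - 1 - (i + j : ℕ))).det := by
    rw [← det_reverse_columns fun i j : Fin a => hInt t (N - 1 - (i + j : ℕ))]
    congr 1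
    ext i j
    simp only [Matrix.of_apply, Fin.val_rev]
    congr 1
    have := j.isLt
    push_cast [Nat.cast_sub (show (j : ℕ) + 1 ≤ a from j.isLt)]
    ring
  rw [hrev]
  rcases Nat.even_or_odd' a with ⟨n, rfl | rfl⟩
  · rw [fock_ιMulti_even, ← pfaffian_eq_hankel (L := fun u => hInt t (N - 1 - u))
      (β := momentForm t (fun j => t (2 * j)) (N - 1) (N + 2)) (momentForm_swap _ _ _ _)
      (momentForm_add_one t _ _ (by omega))]
    congr 1
    ext i k
    simp only [Matrix.of_apply]
    rw [gramForm_momentVec t _ N (N + 2) (by omega), momentForm]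
    push_cast
    rfl
  -- The odd version starts at index 2, so the origin is N + 1 here instead of N - 1.
  · have h := pfaffian_eq_hankel_odd (L := fun u => hInt t (N + 1 - u))
      (β := momentForm t (fun j => t (2 * j)) (N + 1) (N + 2)) (momentForm_swap _ _ _ _)
      (momentForm_add_one t _ _ (by omega)) n
    have e : (Matrix.of fun i j : Fin (2 * n + 1) => hInt t (N - 1 - (i + j : ℕ)))
        = Matrix.of fun i j : Fin (2 * n + 1) => hInt t (N + 1 - (i + j + 2 : ℕ)) := by
      ext i j
      simp only [Matrix.of_apply]
      congr 1
      push_cast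
      ring
    rw [fock_ιMulti_odd, e, ← h]
    refine Finset.sum_congr rfl fun j _ => ?_
    congr 1
    · rw [gramForm_inf_momentVec]
      congr 2
      push_cast
      ring
    · congr 1
      ext i k
      simp only [Matrix.of_apply]
      rw [gramForm_momentVec t _ N (N + 2) (by omega), momentForm]
      refine Finset.sum_congr rfl fun r _ => Finset.sum_congr rfl fun s _ => ?_
      congr 3
      · push_cast; ring
      · push_cast; ring

/-- The expansion of a rectangular Schur function with respect to minors of `(h_{j-i}(t^{(2)}))`. -/
theorem det_rect_eq_sum [IsAddTorsionFree R] (t : ℕ+ → R) (N a : ℕ) :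
    (Matrix.of fun i j : Fin a => hInt t (N - a + j - i)).det
      = ∑ s : Set.powersetCard (Fin N) a,
        (Matrix.of fun i j : Fin a => hInt (fun j => t (2 * j))
          (N - 1 - (Set.powersetCard.ofFinEmbEquiv.symm s j : Fin N) - i)).det *
        fock t (ExteriorAlgebra.ιMulti R a fun j =>
          basisVec R (2 * (Set.powersetCard.ofFinEmbEquiv.symm s j : Fin N) - (N - 1))) := by
  rw [← fock_ιMulti_momentVec]
  -- The moment vectors are images under `T` of the rows of the coefficient matrix, so the expansion
  -- into minors applies to the alternating map pulled back along `T`.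
  let T : (Fin N → R) →ₗ[R] (Option ℤ →₀ R) :=
    Fintype.linearCombination R fun j : Fin N => basisVec R (2 * j - (N - 1))
  let f : (Fin N → R) [⋀^Fin a]→ₗ[R] R :=
    (fock t).compAlternatingMap ((ExteriorAlgebra.ιMulti R a).compLinearMap T)
  have h := alternatingMap_eq_sum_det f fun i j => hInt (fun j => t (2 * j)) (N - 1 - j - i)
  have hT : ∀ j, T (Pi.single j 1) = basisVec R (2 * j - (N - 1)) := fun j => by
    simp [T, Fintype.linearCombination_apply_single]
  simp only [f, LinearMap.compAlternatingMap_apply, AlternatingMap.compLinearMap_apply, hT] at h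
  exact h

end Moments

end

end MixedExpansion

namespace MixedExpansion

noncomputable section

/-! ### Schur `Q`-functions as values of the Pfaffian functional -/

section ProdVec

variable {R : Type*} [CommRing R]

/-- The product of the basis vectors with indices in a list. -/
def prodVec (R : Type*) [CommRing R] (l : List ℤ) : ExteriorAlgebra R (Option ℤ →₀ R) :=
  (l.map fun a => ExteriorAlgebra.ι R (basisVec R a)).prod

theorem prodVec_nil : prodVec R [] = 1 := rfl

theorem prodVec_cons (a : ℤ) (l : List ℤ) :
    prodVec R (a :: l) = ExteriorAlgebra.ι R (basisVec R a) * prodVec R l := by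
  simp [prodVec]

theorem prodVec_append (l l' : List ℤ) : prodVec R (l ++ l') = prodVec R l * prodVec R l' := by
  simp [prodVec]

theorem ι_mul_ι (x y : Option ℤ →₀ R) : ExteriorAlgebra.ι R x * ExteriorAlgebra.ι R y
    = -(ExteriorAlgebra.ι R y * ExteriorAlgebra.ι R x) :=
  eq_neg_of_add_eq_zero_left (ExteriorAlgebra.ι_add_mul_swap x y)

theorem ι_mul_prodVec (x : Option ℤ →₀ R) :
    ∀ l : List ℤ, ExteriorAlgebra.ι R x * prodVec R l
      = (-1) ^ l.length * (prodVec R l * ExteriorAlgebra.ι R x)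
  | [] => by simp [prodVec_nil]
  | a :: l => by
    rw [prodVec_cons, ← mul_assoc, ι_mul_ι, neg_mul, mul_assoc, ι_mul_prodVec x l, List.length_cons,
      pow_succ]
    rcases Nat.even_or_odd l.length with h | h
    · simp [h.neg_one_pow, mul_assoc]
    · simp [h.neg_one_pow, mul_assoc]

theorem ιMulti_basisVec {k : ℕ} (v : Fin k → ℤ) :
    ExteriorAlgebra.ιMulti R k (fun i => basisVec R (v i)) = prodVec R (List.ofFn v) := by
  rw [ExteriorAlgebra.ιMulti_apply, prodVec, List.map_ofFn]
  rfl

theorem prodVec_reverse (l : List ℤ) :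
    prodVec R l.reverse = (∏ i : Fin l.length, (-1 : R) ^ (i : ℕ)) • prodVec R l := by
  have h := AlternatingMap.map_perm (ExteriorAlgebra.ιMulti R l.length (M := Option ℤ →₀ R))
    (fun i => basisVec R (l.get i)) Fin.revPerm
  rw [ιMulti_basisVec, List.ofFn_get] at h
  have e : ((fun i => basisVec R (l.get i)) ∘ Fin.revPerm)
      = fun i => basisVec R ((l.get ∘ Fin.rev) i) := rfl
  rw [e, ιMulti_basisVec] at h
  have e2 : List.ofFn (l.get ∘ Fin.rev) = l.reverse := by
    apply List.ext_getElem
    · simp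
    · intro i h1 h2
      simp only [List.getElem_ofFn, Function.comp_apply, List.get_eq_getElem, Fin.val_rev,
        List.getElem_reverse]
      congr 1
      omega
  rw [e2] at h
  rw [h, ← sign_revPerm, Units.smul_def, Int.cast_smul_eq_zsmul]

theorem contractLeft_prodVec_eq_zero (d : Module.Dual R (Option ℤ →₀ R)) :
    ∀ l : List ℤ, (∀ x ∈ l, d (basisVec R x) = 0) →
      CliffordAlgebra.contractLeft d (prodVec R l) = 0
  | [], _ => CliffordAlgebra.contractLeft_one _ d
  | a :: l, h => by
    rw [prodVec_cons, contractLeft_ι_mul', h a List.mem_cons_self, zero_smul,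
      contractLeft_prodVec_eq_zero d l fun x hx => h x (List.mem_cons_of_mem a hx), mul_zero,
      sub_zero]

theorem contractLeft_prodVec_append (d : Module.Dual R (Option ℤ →₀ R)) (c : ℤ) (l₂ : List ℤ)
    (h₂ : ∀ x ∈ l₂, d (basisVec R x) = 0) :
    ∀ l₁ : List ℤ, (∀ x ∈ l₁, d (basisVec R x) = 0) →
      CliffordAlgebra.contractLeft d (prodVec R (l₁ ++ c :: l₂))
        = ((-1) ^ l₁.length * d (basisVec R c)) • prodVec R (l₁ ++ l₂)
  | [], _ => by
    rw [List.nil_append, List.nil_append, prodVec_cons, contractLeft_ι_mul',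
      contractLeft_prodVec_eq_zero d l₂ h₂]
    simp
  | a :: l₁, h => by
    rw [List.cons_append, List.cons_append, prodVec_cons, prodVec_cons, contractLeft_ι_mul',
      h a List.mem_cons_self,
      contractLeft_prodVec_append d c l₂ h₂ l₁ fun x hx => h x (List.mem_cons_of_mem a hx),
      List.length_cons, pow_succ]
    simp

end ProdVec

/-! ### Cancellation of opposite indices. -/

section FockValues

variable {R : Type*} [CommRing R] [Algebra ℚ R]

theorem gramForm_basisVec (t : ℕ+ → R) (a b : ℤ) :
    gramForm (extKernel t) (basisVec R a) (basisVec R b) = kernel t a b := by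
  rw [basisVec, basisVec, gramForm_single, extKernel]

variable [IsDomain R] [CharZero R]

theorem fockPf_ι_mul (t : ℕ+ → R) (x : Option ℤ →₀ R) (w : ExteriorAlgebra R (Option ℤ →₀ R)) :
    fockPf t (ExteriorAlgebra.ι R x * w)
      = fockPf t (CliffordAlgebra.contractLeft (gramForm (extKernel t) x) w) :=
  pfaffianForm_ι_mul _ x w

/-- A vector of negative index is orthogonal to the auxiliary vector because q_b = 0. In the
completed summand, the sign from exchanging the two vectors cancels the one from contracting past
the auxiliary vector. -/
theorem fock_ι_mul_of_neg (t : ℕ+ → R) {b : ℤ} (hb : b < 0)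
    (x : ExteriorAlgebra R (Option ℤ →₀ R)) :
    fock t (ExteriorAlgebra.ι R (basisVec R b) * x)
      = fock t (CliffordAlgebra.contractLeft (gramForm (extKernel t) (basisVec R b)) x) := by
  rw [fock_apply, fock_apply, fockPf_ι_mul, ← mul_assoc, ι_mul_ι, neg_mul, mul_assoc, map_neg,
    fockPf_ι_mul, contractLeft_ι_mul']
  have : gramForm (extKernel t) (basisVec R b) (basisInf R) = 0 := by
    rw [basisVec, basisInf, gramForm_single, extKernel, qInt_of_neg t hb, neg_zero]
  rw [this, zero_smul, zero_sub, map_neg, neg_neg]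

theorem fock_cons_eq_zero (t : ℕ+ → R) {b : ℤ} (hb : b < 0) {l : List ℤ} (hl : -b ∉ l) :
    fock t (prodVec R (b :: l)) = 0 := by
  rw [prodVec_cons, fock_ι_mul_of_neg t hb, contractLeft_prodVec_eq_zero, map_zero]
  intro x hx
  rw [gramForm_basisVec]
  exact kernel_of_neg_left t hb fun h => hl ((show x = -b by omega) ▸ hx)

theorem fock_cons_append (t : ℕ+ → R) {b : ℤ} (hb : b < 0) {l₁ l₂ : List ℤ} (h₁ : -b ∉ l₁)
    (h₂ : -b ∉ l₂) :
    fock t (prodVec R (b :: (l₁ ++ -b :: l₂)))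
      = (-1) ^ (b.natAbs + l₁.length) * fock t (prodVec R (l₁ ++ l₂)) := by
  rw [prodVec_cons, fock_ι_mul_of_neg t hb, contractLeft_prodVec_append, map_smul,
    gramForm_basisVec, kernel_neg_self t hb, smul_eq_mul, pow_add, mul_comm ((-1) ^ b.natAbs)]
  · intro x hx
    rw [gramForm_basisVec]
    exact kernel_of_neg_left t hb fun h => h₂ ((show x = -b by omega) ▸ hx)
  · intro x hx
    rw [gramForm_basisVec]
    exact kernel_of_neg_left t hb fun h => h₁ ((show x = -b by omega) ▸ hx)

/-- The value of the functional on a finite set of indices in increasing order. -/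
def fockSet (t : ℕ+ → R) (B : Finset ℤ) : R := fock t (prodVec R (B.sort (· ≤ ·)))

theorem sort_eq_cons_min {B : Finset ℤ} {b : ℤ} (hb : b ∈ B) (hmin : ∀ x ∈ B, b ≤ x) :
    B.sort (· ≤ ·) = b :: (B.erase b).sort (· ≤ ·) := by
  have h := (List.toFinset_sort (r := (· ≤ ·)) (l := b :: (B.erase b).sort (· ≤ ·)) (by simp)).mpr
    (by simp; exact fun x _ hx => hmin x hx)
  rw [← h]
  congr 1
  ext x
  by_cases hx : x = b <;> simp [hx, hb]

theorem exists_sort_eq_append {B : Finset ℤ} {c : ℤ} (hc : c ∈ B) :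
    ∃ l₁ l₂ : List ℤ, B.sort (· ≤ ·) = l₁ ++ c :: l₂ ∧ (B.erase c).sort (· ≤ ·) = l₁ ++ l₂ ∧
      c ∉ l₁ ∧ c ∉ l₂ ∧ l₁.length = (B.filter (· < c)).card := by
  obtain ⟨l₁, l₂, h⟩ := List.append_of_mem ((Finset.mem_sort (· ≤ ·)).mpr hc)
  have hnd : (l₁ ++ c :: l₂).Nodup := h ▸ B.sort_nodup (· ≤ ·)
  have hs : (l₁ ++ c :: l₂).Pairwise (· ≤ ·) := h ▸ B.pairwise_sort (· ≤ ·)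
  have hmem : ∀ x, x ∈ B ↔ x ∈ l₁ ∨ x = c ∨ x ∈ l₂ := fun x => by
    rw [← Finset.mem_sort (· ≤ ·), h]; simp
  rw [List.nodup_append, List.nodup_cons] at hnd
  obtain ⟨nd1, ⟨nc2, nd2⟩, hdis⟩ := hnd
  have nc1 : c ∉ l₁ := fun hx => hdis c hx c List.mem_cons_self rfl
  rw [List.pairwise_append, List.pairwise_cons] at hs
  obtain ⟨s1, ⟨sc, s2⟩, s12⟩ := hs
  refine ⟨l₁, l₂, h, ?_, nc1, nc2, ?_⟩
  · have hnd' : (l₁ ++ l₂).Nodup := List.nodup_append.mpr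
      ⟨nd1, nd2, fun a ha b hb => hdis a ha b (List.mem_cons_of_mem c hb)⟩
    have := (List.toFinset_sort (r := (· ≤ ·)) hnd').mpr (List.pairwise_append.mpr
      ⟨s1, s2, fun a ha b hb => s12 a ha b (List.mem_cons_of_mem c hb)⟩)
    rw [← this]
    congr 1
    ext x
    simp only [Finset.mem_erase, hmem, List.mem_toFinset, List.mem_append]
    constructor
    · rintro ⟨h1, h2 | h2 | h2⟩ <;> tauto
    · rintro (h2 | h2)
      · exact ⟨fun e => nc1 (e ▸ h2), Or.inl h2⟩
      · exact ⟨fun e => nc2 (e ▸ h2), Or.inr (Or.inr h2)⟩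
  · rw [← List.toFinset_card_of_nodup nd1]
    congr 1
    ext x
    simp only [List.mem_toFinset, Finset.mem_filter, hmem]
    constructor
    · intro hx
      exact ⟨Or.inl hx, lt_of_le_of_ne (s12 x hx c List.mem_cons_self) fun e => nc1 (e ▸ hx)⟩
    · rintro ⟨h1 | h1 | h1, h2⟩
      · exact h1
      · omega
      · have := sc x h1
        omega

theorem fockSet_eq_zero_of_min (t : ℕ+ → R) {B : Finset ℤ} {b : ℤ} (hb : b ∈ B)
    (hmin : ∀ x ∈ B, b ≤ x) (hneg : b < 0) (hB : -b ∉ B) : fockSet t B = 0 := by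
  rw [fockSet, sort_eq_cons_min hb hmin]
  exact fock_cons_eq_zero t hneg fun h =>
    hB (Finset.mem_of_mem_erase ((Finset.mem_sort _).mp h))

theorem fockSet_of_min (t : ℕ+ → R) {B : Finset ℤ} {b : ℤ} (hb : b ∈ B)
    (hmin : ∀ x ∈ B, b ≤ x) (hneg : b < 0) (hB : -b ∈ B) :
    fockSet t B = (-1) ^ (b.natAbs + (B.filter fun x => b < x ∧ x < -b).card) *
      fockSet t ((B.erase b).erase (-b)) := by
  have hc : -b ∈ B.erase b := Finset.mem_erase.mpr ⟨by omega, hB⟩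
  obtain ⟨l₁, l₂, e1, e2, h1, h2, h3⟩ := exists_sort_eq_append hc
  rw [fockSet, sort_eq_cons_min hb hmin, e1, fock_cons_append t hneg h1 h2, h3, fockSet, e2]
  congr 4
  ext x
  simp only [Finset.mem_filter, Finset.mem_erase]
  constructor
  · rintro ⟨⟨h, hx⟩, hlt⟩
    have := hmin x hx
    exact ⟨hx, by omega, hlt⟩
  · rintro ⟨hx, h, hlt⟩
    exact ⟨⟨by omega, hx⟩, hlt⟩

/-- The least index is negative, so either it is unmatched and the value vanishes, or its pair is
split off; the unmatched `b` survives in the smaller set. -/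
theorem fockSet_eq_zero (t : ℕ+ → R) : ∀ (k : ℕ) {B : Finset ℤ}, B.card = k → ∀ {b : ℤ},
    b ∈ B → b < 0 → -b ∉ B → fockSet t B = 0 := by
  intro k
  induction k using Nat.strong_induction_on with
  | _ k ih =>
    intro B hk b hb hneg hB
    set b₀ := B.min' ⟨b, hb⟩ with hb₀
    have hm : b₀ ∈ B := B.min'_mem _
    have hmin : ∀ x ∈ B, b₀ ≤ x := fun x hx => B.min'_le x hx
    have hneg₀ : b₀ < 0 := (hmin b hb).trans_lt hneg
    by_cases hB₀ : -b₀ ∈ B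
    · rw [fockSet_of_min t hm hmin hneg₀ hB₀]
      have hne : b ≠ b₀ := fun e => hB (e ▸ hB₀)
      rw [ih _ ?_ rfl (b := b) _ hneg, mul_zero]
      · exact fun h => hB (Finset.mem_of_mem_erase (Finset.mem_of_mem_erase h))
      · have c1 := Finset.card_erase_lt_of_mem hm
        have c2 : ((B.erase b₀).erase (-b₀)).card ≤ (B.erase b₀).card :=
          Finset.card_le_card (Finset.erase_subset _ _)
        omega
      · exact Finset.mem_erase.mpr ⟨by omega, Finset.mem_erase.mpr ⟨hne, hb⟩⟩
    · exact fockSet_eq_zero_of_min t hm hmin hneg₀ hB₀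

/-- The non-negative elements whose negative is not in the set, and `0`. -/
def unpaired (B : Finset ℤ) : Finset ℤ := B.filter fun b => 0 ≤ b ∧ (b = 0 ∨ -b ∉ B)

/-- Matched elements strictly between `c` and `-c` come in opposite pairs, so only 0 and the
unmatched ones affect the parity. -/
theorem neg_one_pow_card_between {S : Type*} [CommRing S] {B : Finset ℤ}
    (hB : ∀ b ∈ B, b < 0 → -b ∈ B) (c : ℤ) :
    (-1 : S) ^ (B.filter fun x => c < x ∧ x < -c).card
      = (-1) ^ ((unpaired B).filter fun x => x < -c).card := by
  have e1 : (B.filter fun x => c < x ∧ x < -c)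
      = (B.filter fun x => c < x ∧ x < 0) ∪ (B.filter fun x => 0 < x ∧ x < -c ∧ -x ∈ B)
        ∪ ((unpaired B).filter fun x => x < -c) := by
    ext x
    simp only [unpaired, Finset.mem_filter, Finset.mem_union]
    by_cases hx : x ∈ B
    · by_cases hnx : -x ∈ B
      · simp only [hx, hnx, true_and, not_true, or_false, and_true]; omega
      · have : ¬ x < 0 := fun h => hnx (hB x hx h)
        simp only [hx, hnx, true_and, not_false_iff, or_true, and_true, and_false, or_false]; omega
    · simp [hx]
  have e2 : (B.filter fun x => c < x ∧ x < 0).card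
      = (B.filter fun x => 0 < x ∧ x < -c ∧ -x ∈ B).card := by
    refine Finset.card_bij' (fun x _ => -x) (fun x _ => -x) ?_ ?_ ?_ ?_
    · intro x hx
      simp only [Finset.mem_filter] at hx ⊢
      exact ⟨hB x hx.1 hx.2.2, by omega, by omega, by rw [neg_neg]; exact hx.1⟩
    · intro x hx
      simp only [Finset.mem_filter] at hx ⊢
      exact ⟨hx.2.2.2, by omega, by omega⟩
    · intro x _; exact neg_neg x
    · intro x _; exact neg_neg x
  rw [e1, Finset.card_union_of_disjoint, Finset.card_union_of_disjoint, ← e2, pow_add, ← two_mul,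
    pow_mul]
  · simp
  · rw [Finset.disjoint_left]
    intro x h1 h2
    simp only [Finset.mem_filter] at h1 h2
    omega
  · rw [Finset.disjoint_left]
    intro x h1 h2
    simp only [unpaired, Finset.mem_filter, Finset.mem_union] at h1 h2
    rcases h1 with h1 | h1
    · omega
    · rcases h2.1.2.2 with h | h
      · omega
      · exact h h1.2.2.2

/-- Pairs are removed from the outermost inwards. Removing the outermost one does not alter the
counts for the other pairs, which lie strictly inside it. -/
theorem fockSet_eq_unpaired (t : ℕ+ → R) : ∀ (k : ℕ) {B : Finset ℤ}, B.card = k →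
    (∀ b ∈ B, b < 0 → -b ∈ B) →
    fockSet t B = (∏ b ∈ B.filter (· < 0),
      (-1) ^ (b.natAbs + (B.filter fun x => b < x ∧ x < -b).card)) * fockSet t (unpaired B) := by
  intro k
  induction k using Nat.strong_induction_on with
  | _ k ih =>
    intro B hk hB
    by_cases hne : (B.filter (· < 0)).Nonempty
    · obtain ⟨b, hb'⟩ := hne
      rw [Finset.mem_filter] at hb'
      obtain ⟨hb, hneg⟩ := hb'
      set b₀ := B.min' ⟨b, hb⟩ with hb₀
      have hm : b₀ ∈ B := B.min'_mem _
      have hmin : ∀ x ∈ B, b₀ ≤ x := fun x hx => B.min'_le x hx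
      have hneg₀ : b₀ < 0 := (hmin b hb).trans_lt hneg
      clear_value b₀
      have hB₀ := hB b₀ hm hneg₀
      have hmem : ∀ x, x ∈ (B.erase b₀).erase (-b₀) ↔ x ≠ -b₀ ∧ x ≠ b₀ ∧ x ∈ B := fun x => by
        rw [Finset.mem_erase, Finset.mem_erase]
      rw [fockSet_of_min t hm hmin hneg₀ hB₀, ih _ ?_ rfl ?_]
      · have f1 : B.filter (· < 0)
            = insert b₀ (((B.erase b₀).erase (-b₀)).filter (· < 0)) := by
          ext x
          simp only [Finset.mem_insert, Finset.mem_filter, hmem]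
          constructor
          · rintro ⟨h1, h2⟩
            by_cases e : x = b₀
            · exact Or.inl e
            · exact Or.inr ⟨⟨by omega, e, h1⟩, h2⟩
          · rintro (rfl | h)
            · exact ⟨hm, hneg₀⟩
            · exact ⟨h.1.2.2, h.2⟩
        have f2 : unpaired B = unpaired ((B.erase b₀).erase (-b₀)) := by
          ext x
          simp only [unpaired, Finset.mem_filter, hmem]
          constructor
          · rintro ⟨h1, h2, h3⟩
            refine ⟨⟨?_, by omega, h1⟩, h2, ?_⟩
            · rintro rfl
              rcases h3 with h3 | h3
              · omega
              · exact h3 (by rwa [neg_neg])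
            · rcases h3 with h3 | h3
              · exact Or.inl h3
              · exact Or.inr fun h => h3 h.2.2
          · rintro ⟨⟨h1, h1', h1''⟩, h2, h3⟩
            refine ⟨h1'', h2, ?_⟩
            rcases h3 with h3 | h3
            · exact Or.inl h3
            · exact Or.inr fun h => h3 ⟨by omega, by omega, h⟩
        rw [f2, f1, Finset.prod_insert, mul_assoc]
        · congr 2
          refine Finset.prod_congr rfl fun x hx => ?_
          rw [Finset.mem_filter, hmem] at hx
          have hx0 := hmin x hx.1.2.2
          congr 3
          ext y
          simp only [Finset.mem_filter, hmem]
          constructor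
          · rintro ⟨⟨-, -, h1⟩, h2⟩
            exact ⟨h1, h2⟩
          · rintro ⟨h1, h2⟩
            exact ⟨⟨by omega, by omega, h1⟩, h2⟩
        · rw [Finset.mem_filter, hmem]
          rintro ⟨⟨-, h, -⟩, -⟩
          exact h rfl
      · have c1 := Finset.card_erase_lt_of_mem hm
        have c2 : ((B.erase b₀).erase (-b₀)).card ≤ (B.erase b₀).card :=
          Finset.card_le_card (Finset.erase_subset _ _)
        omega
      · intro x hx hx0
        rw [hmem] at hx ⊢
        exact ⟨by omega, by omega, hB x hx.2.2 hx0⟩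
    · rw [Finset.not_nonempty_iff_eq_empty] at hne
      have hpos : ∀ x ∈ B, 0 ≤ x := fun x hx => by
        by_contra hc
        have : x ∈ B.filter (· < 0) := Finset.mem_filter.mpr ⟨hx, by omega⟩
        rw [hne] at this
        simp at this
      have : unpaired B = B := by
        refine Finset.filter_true_of_mem fun x hx => ⟨hpos x hx, ?_⟩
        by_cases h0 : x = 0
        · exact Or.inl h0
        · refine Or.inr fun h => ?_
          have h1 := hpos x hx
          have h2 := hpos (-x) h
          omega
      rw [hne, this, Finset.prod_empty, one_mul]

end FockValues

end

end MixedExpansion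

namespace MixedExpansion

noncomputable section

/-! ### Positive indices and the role of the part 0. -/

section SchurQ

variable {R : Type*} [CommRing R] [Algebra ℚ R]

theorem schurQ_eq_pfaffian (lam : YoungDiagram) (t : ℕ+ → R) {n : ℕ}
    (hn : (lam.colLen 0 + 1) / 2 = n) :
    schurQ lam t = pfaffian n (Matrix.of fun i j => QPair t (lam.rowLen i) (lam.rowLen j)) := by
  subst hn
  rfl

theorem rowLen_eq_zero_iff (lam : YoungDiagram) (i : ℕ) : lam.rowLen i = 0 ↔ lam.colLen 0 ≤ i := by
  have h1 := YoungDiagram.mem_iff_lt_rowLen (μ := lam) (i := i) (j := 0)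
  have h2 := YoungDiagram.mem_iff_lt_colLen (μ := lam) (i := i) (j := 0)
  rw [h1] at h2
  omega

variable [IsDomain R] [CharZero R]

theorem fock_prodVec_even (lam : YoungDiagram) (t : ℕ+ → R) (n : ℕ) :
    fock t (prodVec R (List.ofFn fun i : Fin (2 * n) => (lam.rowLen i : ℤ)))
      = pfaffian n (Matrix.of fun i j => QPair t (lam.rowLen i) (lam.rowLen j)) := by
  rw [← ιMulti_basisVec, fock_ιMulti_even]
  simp only [gramForm_basisVec, kernel_natCast]

theorem fockPf_prodVec_odd (t : ℕ+ → R) {l : List ℤ} (hl : Odd l.length) :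
    fockPf t (prodVec R l) = 0 := by
  obtain ⟨n, hn⟩ := hl
  have h := pfaffianForm_ιMulti_odd (gramForm_self (extKernel_swap t)) n
    (fun i => basisVec R (l.get (Fin.cast hn.symm i)))
  rw [ιMulti_basisVec] at h
  have e : List.ofFn (fun i : Fin (2 * n + 1) => l.get (Fin.cast hn.symm i)) = l := by
    apply List.ext_getElem
    · simp [hn]
    · intro i h1 h2
      rw [List.getElem_ofFn]
      rfl
  rwa [e] at h

theorem fock_prodVec_odd (lam : YoungDiagram) (t : ℕ+ → R) (n : ℕ)
    (hlam : lam.colLen 0 = 2 * n + 1) :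
    fock t (prodVec R (List.ofFn fun i : Fin (2 * n + 1) => (lam.rowLen i : ℤ)))
      = pfaffian (n + 1) (Matrix.of fun i j => QPair t (lam.rowLen i) (lam.rowLen j)) := by
  have hl : Odd (List.ofFn fun i : Fin (2 * n + 1) => (lam.rowLen i : ℤ)).length := by simp
  rw [fock_apply, fockPf_prodVec_odd t hl, zero_add, ι_mul_prodVec, hl.neg_one_pow]
  -- The negated auxiliary vector plays the part 0: its pairing with a positive index a is Q_{a,0} =
  -- q_a.
  let v : Fin (2 * n + 1 + 1) → Option ℤ →₀ R := fun i =>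
    if (i : ℕ) < 2 * n + 1 then basisVec R (lam.rowLen i) else -basisInf R
  have hv : ExteriorAlgebra.ιMulti R (2 * n + 1 + 1) v
      = -1 * (prodVec R (List.ofFn fun i : Fin (2 * n + 1) => (lam.rowLen i : ℤ)) *
        ExteriorAlgebra.ι R (basisInf R)) := by
    rw [ExteriorAlgebra.ιMulti_apply, List.ofFn_succ_last, List.prod_append, prodVec, List.map_ofFn]
    have e1 : ∀ i : Fin (2 * n + 1), v i.castSucc = basisVec R (lam.rowLen i) := fun i => by
      have hi : ((i.castSucc : Fin (2 * n + 1 + 1)) : ℕ) < 2 * n + 1 := i.isLt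
      simp only [v]
      rw [if_pos hi]
      rfl
    have e2 : v (Fin.last (2 * n + 1)) = -basisInf R := by simp [v]
    simp only [e1, e2, List.prod_singleton, map_neg, mul_neg, neg_mul, one_mul]
    rfl
  rw [← hv]
  have h := pfaffianForm_ιMulti (gramForm_self (extKernel_swap t)) (n + 1) v
  refine h.trans ?_
  congr 1
  ext i j
  have hi : (i : ℕ) < 2 * n + 1 + 1 := i.isLt
  have hj : (j : ℕ) < 2 * n + 1 + 1 := j.isLt
  have hpos : ∀ i, i < 2 * n + 1 → 0 < lam.rowLen i := fun i hi => by
    rw [Nat.pos_iff_ne_zero, Ne, rowLen_eq_zero_iff]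
    omega
  have hlast : lam.rowLen (2 * n + 1) = 0 := (rowLen_eq_zero_iff lam _).mpr hlam.le
  simp only [Matrix.of_apply, v]
  split_ifs with h1 h2 h2
  · rw [gramForm_basisVec, kernel_natCast]
  · rw [show (j : ℕ) = 2 * n + 1 by omega, hlast, QPair_zero_right t (hpos i h1), map_neg,
      basisVec, basisInf, gramForm_single, extKernel, neg_neg, qInt_natCast]
  · rw [show (i : ℕ) = 2 * n + 1 by omega, hlast, QPair_swap, QPair_zero_right t (hpos j h2),
      map_neg, LinearMap.neg_apply, basisVec, basisInf, gramForm_single, extKernel, qInt_natCast]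
  · rw [show (i : ℕ) = 2 * n + 1 by omega, show (j : ℕ) = 2 * n + 1 by omega, hlast, QPair_self,
      map_neg, LinearMap.map_neg₂, basisInf, gramForm_single, extKernel, neg_zero, neg_zero]

/-- For an even number of positive indices the bead at 0 merely replaces the auxiliary vector. The
sum of these two vectors is orthogonal to every positive index, so its contraction meets only the
auxiliary vector, with value -1. -/
theorem fock_prodVec_append_zero (t : ℕ+ → R) {l : List ℤ} (hl : Even l.length)
    (hpos : ∀ x ∈ l, 0 < x) : fock t (prodVec R (l ++ [0])) = fock t (prodVec R l) := by
  have hodd : Odd (l ++ [(0 : ℤ)]).length := by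
    rw [List.length_append, List.length_singleton]
    exact hl.add_one
  set u : Option ℤ →₀ R := basisVec R 0 + basisInf R with hu
  have hu0 : ∀ x ∈ l, gramForm (extKernel t) u (basisVec R x) = 0 := by
    intro x hx
    have := hpos x hx
    lift x to ℕ using this.le
    rw [hu, map_add, LinearMap.add_apply, gramForm_basisVec, basisVec, basisInf, gramForm_single,
      extKernel, qInt_natCast]
    have h0 := kernel_natCast t 0 x
    rw [Nat.cast_zero] at h0
    rw [h0, QPair_swap, QPair_zero_right t (by omega), neg_add_cancel]
  have hu1 : gramForm (extKernel t) u (basisInf R) = -1 := by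
    have hz : qInt t 0 = 1 := by
      have := qInt_natCast t 0
      rwa [qPoly_zero] at this
    rw [hu, map_add, LinearMap.add_apply, basisVec, basisInf, gramForm_single, gramForm_single,
      extKernel, extKernel, hz, add_zero]
  have hinf : ExteriorAlgebra.ι R (basisInf R) * ExteriorAlgebra.ι R (basisVec R 0)
      = -(ExteriorAlgebra.ι R u * ExteriorAlgebra.ι R (basisInf R)) := by
    rw [hu, map_add, add_mul, ExteriorAlgebra.ι_sq_zero, add_zero, ι_mul_ι]
  have hcomm : ∀ x : Option ℤ →₀ R, ExteriorAlgebra.ι R x * prodVec R l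
      = prodVec R l * ExteriorAlgebra.ι R x := fun x => by
    rw [ι_mul_prodVec, hl.neg_one_pow, one_mul]
  have h1 : ExteriorAlgebra.ι R (basisInf R) * prodVec R (l ++ [0])
      = -(ExteriorAlgebra.ι R u * (ExteriorAlgebra.ι R (basisInf R) * prodVec R l)) := by
    rw [prodVec_append, prodVec_cons, prodVec_nil, mul_one, ← mul_assoc, hcomm, mul_assoc, hinf,
      mul_neg, ← mul_assoc, ← hcomm, mul_assoc, ← hcomm]
  have h2 : fockPf t (ExteriorAlgebra.ι R (basisInf R) * prodVec R l) = 0 := by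
    obtain ⟨n, hn⟩ := hl
    have hn' : l.length = 2 * n := by omega
    have h := pfaffianForm_ιMulti_odd (gramForm_self (extKernel_swap t)) n
      (Fin.cons (basisInf R) fun i => basisVec R (l.get (Fin.cast hn'.symm i)))
    rw [ExteriorAlgebra.ιMulti_succ_apply] at h
    have e : List.ofFn (fun i : Fin (2 * n) => l.get (Fin.cast hn'.symm i)) = l := by
      apply List.ext_getElem
      · simp [hn']
      · intro i h1 h2
        rw [List.getElem_ofFn]
        rfl
    have h' : fockPf t (ExteriorAlgebra.ι R (basisInf R) * ExteriorAlgebra.ιMulti R (2 * n)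
      fun i => basisVec R (l.get (Fin.cast hn'.symm i))) = 0 := h
    rwa [ιMulti_basisVec, e] at h'
  rw [fock_apply, fock_apply, fockPf_prodVec_odd t hodd, zero_add, h1, map_neg, fockPf_ι_mul,
    contractLeft_ι_mul', contractLeft_prodVec_eq_zero _ l hu0, mul_zero, sub_zero, hu1, h2]
  simp

theorem rowLens_cast_eq_ofFn (lam : YoungDiagram) :
    lam.rowLens.map (fun x : ℕ => (x : ℤ)) = List.ofFn fun i : Fin (lam.colLen 0) =>
      (lam.rowLen i : ℤ) := by
  apply List.ext_getElem
  · simp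
  · intro i h1 h2
    simp [YoungDiagram.rowLens]

/-- The Schur `Q`-function is the value of the functional on the parts in decreasing order. -/
theorem fock_rowLens (lam : YoungDiagram) (t : ℕ+ → R) :
    fock t (prodVec R (lam.rowLens.map fun x : ℕ => (x : ℤ))) = schurQ lam t := by
  rw [rowLens_cast_eq_ofFn]
  rcases Nat.even_or_odd' (lam.colLen 0) with ⟨n, h | h⟩
  · rw [h, fock_prodVec_even, schurQ_eq_pfaffian lam t (n := n) (by omega)]
  · rw [h, fock_prodVec_odd lam t n h, schurQ_eq_pfaffian lam t (n := n + 1) (by omega)]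

theorem fock_rowLens_append_zero (lam : YoungDiagram) (t : ℕ+ → R) :
    fock t (prodVec R ((lam.rowLens.map fun x : ℕ => (x : ℤ)) ++ [0])) = schurQ lam t := by
  rcases Nat.even_or_odd' (lam.colLen 0) with ⟨n, h | h⟩
  · rw [fock_prodVec_append_zero, fock_rowLens]
    · simp [h]
    · intro x hx
      rw [List.mem_map] at hx
      obtain ⟨y, hy, rfl⟩ := hx
      exact_mod_cast YoungDiagram.pos_of_mem_rowLens lam y hy
  · have hlast : lam.rowLen (2 * n + 1) = 0 := (rowLen_eq_zero_iff lam _).mpr h.le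
    have e : (lam.rowLens.map fun x : ℕ => (x : ℤ)) ++ [0]
        = List.ofFn fun i : Fin (2 * n + 1 + 1) => (lam.rowLen i : ℤ) := by
      rw [List.ofFn_succ_last, rowLens_cast_eq_ofFn, h]
      simp [hlast]
    rw [e]
    exact (fock_prodVec_even lam t (n + 1)).trans
      (schurQ_eq_pfaffian lam t (n := n + 1) (by omega)).symm

end SchurQ

end

end MixedExpansion

namespace MixedExpansion

noncomputable section

/-! ### Row lengths, strictness, and determinants of larger size. -/

section Young

theorem youngDiagram_ext {μ ν : YoungDiagram} (h : ∀ i, μ.rowLen i = ν.rowLen i) : μ = ν := by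
  ext ⟨i, j⟩
  rw [YoungDiagram.mem_cells, YoungDiagram.mem_cells, YoungDiagram.mem_iff_lt_rowLen,
    YoungDiagram.mem_iff_lt_rowLen, h]

theorem youngDiagram_le_iff {μ ν : YoungDiagram} : μ ≤ ν ↔ ∀ i, μ.rowLen i ≤ ν.rowLen i := by
  constructor
  · intro h i
    by_contra hc
    have h1 : (i, ν.rowLen i) ∈ μ := YoungDiagram.mem_iff_lt_rowLen.mpr (by omega)
    have h2 := YoungDiagram.mem_iff_lt_rowLen.mp (h h1)
    omega
  · rintro h ⟨i, j⟩ hx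
    exact YoungDiagram.mem_iff_lt_rowLen.mpr
      ((YoungDiagram.mem_iff_lt_rowLen.mp hx).trans_le (h i))

theorem card_eq_sum_rowLen (μ : YoungDiagram) {N : ℕ} (hN : ∀ i, N ≤ i → μ.rowLen i = 0) :
    μ.card = ∑ i ∈ Finset.range N, μ.rowLen i := by
  have h : μ.cells.card = ∑ i ∈ Finset.range N, (μ.cells.filter fun c => c.1 = i).card := by
    refine Finset.card_eq_sum_card_fiberwise ?_
    rintro ⟨i, j⟩ hx
    have h1 := YoungDiagram.mem_iff_lt_rowLen.mp ((YoungDiagram.mem_cells _).mp hx)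
    by_contra hc
    have := hN i (by simpa using hc)
    omega
  rw [YoungDiagram.card, h]
  refine Finset.sum_congr rfl fun i _ => ?_
  rw [YoungDiagram.rowLen_eq_card]
  rfl

theorem mem_rowLens_iff {μ : YoungDiagram} {p : ℕ} :
    p ∈ μ.rowLens ↔ 0 < p ∧ ∃ i, μ.rowLen i = p := by
  simp only [YoungDiagram.rowLens, List.mem_map, List.mem_range]
  constructor
  · rintro ⟨i, hi, rfl⟩
    refine ⟨?_, i, rfl⟩
    rw [Nat.pos_iff_ne_zero, Ne, rowLen_eq_zero_iff]
    omega
  · rintro ⟨hp, i, rfl⟩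
    refine ⟨i, ?_, rfl⟩
    rw [Nat.pos_iff_ne_zero, Ne, rowLen_eq_zero_iff] at hp
    omega

theorem mem_parts_iff {μ : YoungDiagram} {p : ℕ} :
    p ∈ parts μ ↔ 0 < p ∧ ∃ i, μ.rowLen i = p := by
  rw [parts, List.mem_toFinset, mem_rowLens_iff]

theorem isStrict_iff {μ : YoungDiagram} :
    IsStrict μ ↔ ∀ i, 0 < μ.rowLen i → μ.rowLen (i + 1) < μ.rowLen i := by
  rw [IsStrict, YoungDiagram.rowLens, List.nodup_map_iff_inj_on List.nodup_range]
  simp only [List.mem_range]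
  constructor
  · intro h i hi
    refine lt_of_le_of_ne (μ.rowLen_anti i (i + 1) (Nat.le_succ i)) fun e => ?_
    have h1 : ∀ k, 0 < μ.rowLen k → k < μ.colLen 0 := fun k hk => by
      rw [Nat.pos_iff_ne_zero, Ne, rowLen_eq_zero_iff] at hk
      omega
    have := h (i + 1) (h1 _ (by omega)) i (h1 _ hi) e
    omega
  · intro h
    have key : ∀ x y, y < μ.colLen 0 → x < y → μ.rowLen x ≠ μ.rowLen y := by
      intro x y hy hxy e
      have h1 := μ.rowLen_anti (x + 1) y hxy
      have h2 : μ.rowLen y ≠ 0 := by rw [Ne, rowLen_eq_zero_iff]; omega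
      have := h x (by omega)
      omega
    intro x hx y hy e
    rcases lt_trichotomy x y with hlt | rfl | hlt
    · exact absurd e (key x y hy hlt)
    · rfl
    · exact absurd e.symm (key y x hx hlt)

variable {R : Type*} [CommRing R] [Algebra ℚ R]

theorem schurS_eq_det (lam : YoungDiagram) (t : ℕ+ → R) {a : ℕ} (ha : lam.colLen 0 ≤ a) :
    schurS lam t = (Matrix.of fun i j : Fin a => hInt t (lam.rowLen i + j - i)).det := by
  induction a, ha using Nat.le_induction with
  | base => rfl
  | succ a ha ih =>
    have hz : lam.rowLen a = 0 := (rowLen_eq_zero_iff lam a).mpr ha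
    rw [ih, Matrix.det_succ_row _ (Fin.last a), Fin.sum_univ_castSucc, Finset.sum_eq_zero, zero_add]
    · have h1 : hInt t 0 = 1 := (hInt_natCast t 0).trans (hPoly_zero t)
      simp only [Matrix.of_apply, Fin.val_last, hz, Nat.cast_zero, zero_add, sub_self, h1, mul_one]
      rw [← two_mul, pow_mul]
      simp only [even_two, Even.neg_pow, one_pow, one_mul]
      congr 1
      ext i j
      simp
    · intro j _
      have hj := j.isLt
      rw [Matrix.of_apply, Fin.val_last, hz, Fin.val_castSucc, hInt_of_neg t (by push_cast; omega),
        mul_zero, zero_mul]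

end Young

/-! ### Partitions obtained from a core by adding nodes of one color. -/

section BarShape

/-- The shapes obtained from a core by adding nodes of one color: row `i` has length
`2b - 1`, `2b` or `2b + 1` with `b = N - 1 - 2i`. -/
def IsBarShape (N : ℕ) (μ : YoungDiagram) : Prop :=
  ∀ i, 2 * (N - 1 - 2 * i) - 1 ≤ μ.rowLen i ∧
    (2 * i < N → μ.rowLen i ≤ 2 * (N - 1 - 2 * i) + 1) ∧ (N ≤ 2 * i → μ.rowLen i = 0)

theorem rowLen_core_natCast (m i : ℕ) :
    (core (m : ℤ)).rowLen i = 2 * (2 * m - 1 - 2 * i) - 1 := by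
  rw [core, rowLen_ofSeq]
  simp only [Int.natAbs_natCast]
  split_ifs <;> omega

theorem rowLen_core_neg_natCast (m i : ℕ) :
    (core (-(m : ℤ))).rowLen i = 2 * (2 * m + 1 - 1 - 2 * i) - 1 := by
  rw [core, rowLen_ofSeq]
  simp only [Int.natAbs_neg, Int.natAbs_natCast]
  split_ifs <;> omega

theorem mem_sdiff_cells_iff {μ ν : YoungDiagram} {i j : ℕ} :
    (i, j) ∈ μ.cells \ ν.cells ↔ ν.rowLen i ≤ j ∧ j < μ.rowLen i := by
  rw [Finset.mem_sdiff, YoungDiagram.mem_cells, YoungDiagram.mem_cells,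
    YoungDiagram.mem_iff_lt_rowLen, YoungDiagram.mem_iff_lt_rowLen, not_lt, and_comm]

theorem IsBarShape.isStrict {N : ℕ} {μ : YoungDiagram} (h : IsBarShape N μ) : IsStrict μ := by
  rw [isStrict_iff]
  intro i hi
  obtain ⟨h1, h2, h3⟩ := h i
  obtain ⟨h4, h5, h6⟩ := h (i + 1)
  omega

/-- The number of added nodes. -/
def excess (N : ℕ) (μ : YoungDiagram) : ℕ :=
  ∑ i ∈ Finset.range N, (μ.rowLen i - (2 * (N - 1 - 2 * i) - 1))

theorem IsBarShape.card_eq {N : ℕ} {μ ν : YoungDiagram} (h : IsBarShape N μ)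
    (hν : ∀ i, ν.rowLen i = 2 * (N - 1 - 2 * i) - 1) : μ.card = ν.card + excess N μ := by
  rw [card_eq_sum_rowLen μ (N := N) fun i hi => (h i).2.2 (by omega),
    card_eq_sum_rowLen ν (N := N) fun i hi => by rw [hν]; omega, excess, ← Finset.sum_add_distrib]
  refine Finset.sum_congr rfl fun i _ => ?_
  have := (h i).1
  rw [hν]
  omega

theorem mem_addFinset_one {m n : ℕ} {μ : YoungDiagram} :
    μ ∈ addFinset 1 n (core (m : ℤ)) ↔ IsBarShape (2 * m) μ ∧ excess (2 * m) μ = n := by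
  rw [addFinset, Set.Finite.mem_toFinset, addSet, Set.mem_ofPred_eq, youngDiagram_le_iff]
  constructor
  · rintro ⟨-, hle, hcard, hcol⟩
    have hs : IsBarShape (2 * m) μ := by
      intro i
      have h1 := hle i
      rw [rowLen_core_natCast] at h1
      refine ⟨h1, fun hi => ?_, fun hi => ?_⟩
      · by_contra hc
        have := hcol (i, 2 * (2 * m - 1 - 2 * i) + 1) (mem_sdiff_cells_iff.mpr
          ⟨by rw [rowLen_core_natCast]; omega, by omega⟩)
        rw [color, if_pos (by left; dsimp only; omega)] at this
        omega
      · by_contra hc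
        have := hcol (i, 0) (mem_sdiff_cells_iff.mpr
          ⟨by rw [rowLen_core_natCast]; omega, by omega⟩)
        rw [color, if_pos (by right; rfl)] at this
        omega
    have := hs.card_eq (rowLen_core_natCast m)
    exact ⟨hs, by omega⟩
  · rintro ⟨hs, rfl⟩
    refine ⟨hs.isStrict, fun i => ?_, hs.card_eq (rowLen_core_natCast m), ?_⟩
    · rw [rowLen_core_natCast]
      exact (hs i).1
    · rintro ⟨i, j⟩ hx
      rw [mem_sdiff_cells_iff, rowLen_core_natCast] at hx
      obtain ⟨h1, h2, h3⟩ := hs i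
      rw [color, if_neg]
      dsimp only
      omega

theorem mem_addFinset_zero {m n : ℕ} {μ : YoungDiagram} :
    μ ∈ addFinset 0 n (core (-(m : ℤ))) ↔
      IsBarShape (2 * m + 1) μ ∧ excess (2 * m + 1) μ = n := by
  rw [addFinset, Set.Finite.mem_toFinset, addSet, Set.mem_ofPred_eq, youngDiagram_le_iff]
  constructor
  · rintro ⟨hstrict, hle, hcard, hcol⟩
    rw [isStrict_iff] at hstrict
    have hub : ∀ i, μ.rowLen i ≤ 2 * (2 * m + 1 - 1 - 2 * i) + 1 := by
      intro i
      by_contra hc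
      have := hcol (i, 2 * (2 * m + 1 - 1 - 2 * i) + 1) (mem_sdiff_cells_iff.mpr
        ⟨by rw [rowLen_core_neg_natCast]; omega, by omega⟩)
      rw [color, if_neg (by dsimp only; omega)] at this
      omega
    have hs : IsBarShape (2 * m + 1) μ := by
      intro i
      have h1 := hle i
      rw [rowLen_core_neg_natCast] at h1
      refine ⟨h1, fun _ => hub i, fun hi => ?_⟩
      -- The color allows every row below the core to have length 1. Strictness leaves at most one
      -- such row, the one with index m.
      obtain ⟨k, rfl⟩ : ∃ k, i = k + 1 := ⟨i - 1, by omega⟩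
      have h2 := hub k
      have h3 := hstrict k
      have h4 := μ.rowLen_anti k (k + 1) (Nat.le_succ k)
      omega
    have := hs.card_eq (rowLen_core_neg_natCast m)
    exact ⟨hs, by omega⟩
  · rintro ⟨hs, rfl⟩
    refine ⟨hs.isStrict, fun i => ?_, hs.card_eq (rowLen_core_neg_natCast m), ?_⟩
    · rw [rowLen_core_neg_natCast]
      exact (hs i).1
    · rintro ⟨i, j⟩ hx
      rw [mem_sdiff_cells_iff, rowLen_core_neg_natCast] at hx
      obtain ⟨h1, h2, h3⟩ := hs i
      rw [color, if_pos]
      dsimp only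
      omega

end BarShape

end

end MixedExpansion

namespace MixedExpansion

noncomputable section

/-! ### Beads, Maya diagrams and μ[1]. -/

section Beads

theorem IsBarShape.mem_parts {N : ℕ} {μ : YoungDiagram} (h : IsBarShape N μ) {i p : ℕ}
    (hi : 2 * i < N) (h1 : 2 * (N - 1 - 2 * i) - 1 ≤ p) (h2 : p ≤ 2 * (N - 1 - 2 * i) + 1)
    (hp : 0 < p) : p ∈ parts μ ↔ μ.rowLen i = p := by
  rw [mem_parts_iff]
  constructor
  · rintro ⟨-, k, hk⟩
    obtain ⟨h3, h4, h5⟩ := h k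
    have : k = i := by omega
    rw [← this, hk]
  · exact fun e => ⟨hp, i, e⟩

theorem IsBarShape.exists_of_mem_parts {N : ℕ} {μ : YoungDiagram} (h : IsBarShape N μ) {p : ℕ}
    (hp : p ∈ parts μ) : 0 < p ∧ ∃ i, 2 * i < N ∧ μ.rowLen i = p ∧
      2 * (N - 1 - 2 * i) - 1 ≤ p ∧ p ≤ 2 * (N - 1 - 2 * i) + 1 := by
  rw [mem_parts_iff] at hp
  obtain ⟨hp, i, hi⟩ := hp
  obtain ⟨h3, h4, h5⟩ := h i
  refine ⟨hp, i, ?_⟩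
  omega

/-- The positions of the beads of the Maya diagram among the `N` relevant ones, from right to
left. -/
def beadSet (N : ℕ) (μ : YoungDiagram) : Finset (Fin N) :=
  Finset.univ.filter fun x =>
    if N ≤ 2 * (x : ℕ) then μ.rowLen (N - 1 - x) % 4 ≠ 3 else μ.rowLen x % 4 = 1

theorem mem_beadSet {N : ℕ} {μ : YoungDiagram} {x : Fin N} : x ∈ beadSet N μ ↔
    if N ≤ 2 * (x : ℕ) then μ.rowLen (N - 1 - x) % 4 ≠ 3 else μ.rowLen x % 4 = 1 := by
  rw [beadSet, Finset.mem_filter, and_iff_right (Finset.mem_univ _)]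

/-- Positions i and N - 1 - i carry opposite indices and are governed by the same row i; for odd `N`
the middle position is alone. -/
theorem sum_range_pair (N : ℕ) (f : ℕ → ℕ) : ∑ x ∈ Finset.range N, f x
    = ∑ i ∈ Finset.range N, ((if 2 * i < N then f i else 0) +
      if 2 * i + 1 < N then f (N - 1 - i) else 0) := by
  rw [Finset.sum_add_distrib,
    ← Finset.sum_range_reflect (fun i => if 2 * i + 1 < N then f (N - 1 - i) else 0) N,
    ← Finset.sum_add_distrib]
  refine Finset.sum_congr rfl fun x hx => ?_
  rw [Finset.mem_range] at hx
  rw [show N - 1 - (N - 1 - x) = x by omega]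
  split_ifs <;> omega

theorem card_beadSet (N : ℕ) (μ : YoungDiagram) : (beadSet N μ).card
    = ∑ i ∈ Finset.range N, ((if 2 * i < N ∧ μ.rowLen i % 4 = 1 then 1 else 0) +
      if 2 * i + 1 < N ∧ μ.rowLen i % 4 ≠ 3 then 1 else 0) := by
  rw [beadSet, Finset.card_filter, Fin.sum_univ_eq_sum_range fun x => if (if N ≤ 2 * x then
    μ.rowLen (N - 1 - x) % 4 ≠ 3 else μ.rowLen x % 4 = 1) then 1 else 0, sum_range_pair]
  refine Finset.sum_congr rfl fun i hi => ?_
  rw [Finset.mem_range] at hi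
  by_cases h1 : 2 * i + 1 < N
  · rw [show N - 1 - (N - 1 - i) = i by omega]
    simp only [h1, show 2 * i < N by omega, show ¬ N ≤ 2 * i by omega,
      show N ≤ 2 * (N - 1 - i) by omega, if_true, if_false, true_and]
  · by_cases h2 : 2 * i < N
    · simp only [h1, h2, show ¬ N ≤ 2 * i by omega, if_true, if_false, true_and, false_and]
    · simp only [h1, h2, if_false, false_and]

/-- Here b is odd, so the lengths 2b - 1, 2b, 2b + 1 give two, one and no beads: each added node
removes a bead. -/
theorem IsBarShape.card_beadSet_even {m : ℕ} {μ : YoungDiagram} (h : IsBarShape (2 * m) μ) :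
    (beadSet (2 * m) μ).card + excess (2 * m) μ = 2 * m := by
  have e : 2 * m = ∑ x ∈ Finset.range (2 * m), 1 := by simp
  rw [card_beadSet, excess, ← Finset.sum_add_distrib]
  conv_rhs => rw [e, sum_range_pair]
  refine Finset.sum_congr rfl fun i hi => ?_
  obtain ⟨h1, h2, h3⟩ := h i
  split_ifs <;> omega

/-- Now b is even and the residues of 2b - 1 and 2b + 1 modulo 4 are interchanged, so each added
node creates a bead. -/
theorem IsBarShape.card_beadSet_odd {m : ℕ} {μ : YoungDiagram} (h : IsBarShape (2 * m + 1) μ) :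
    (beadSet (2 * m + 1) μ).card = excess (2 * m + 1) μ := by
  rw [card_beadSet, excess]
  refine Finset.sum_congr rfl fun i hi => ?_
  obtain ⟨h1, h2, h3⟩ := h i
  split_ifs <;> omega

theorem mem_maya_natCast {μ : YoungDiagram} {k : ℕ} : (k : ℤ) ∈ maya μ ↔ 4 * k + 1 ∈ parts μ := by
  constructor
  · rintro (⟨j, hj, e⟩ | ⟨h, -⟩)
    · rwa [show k = j by omega]
    · simp only [Set.mem_ofPred_eq] at h
      omega
  · exact fun h => Or.inl ⟨k, h, rfl⟩

theorem mem_maya_neg {μ : YoungDiagram} {k : ℕ} :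
    (-k - 1 : ℤ) ∈ maya μ ↔ 4 * k + 3 ∉ parts μ := by
  constructor
  · rintro (⟨j, hj, e⟩ | ⟨-, h⟩)
    · omega
    · exact fun hk => h ⟨k, hk, rfl⟩
  · refine fun h => Or.inr ⟨by simp only [Set.mem_ofPred_eq]; omega, ?_⟩
    rintro ⟨j, hj, e⟩
    exact h (by rwa [show k = j by omega])

theorem IsBarShape.mem_beadSet_iff {N : ℕ} {μ : YoungDiagram} (h : IsBarShape N μ) (x : Fin N) :
    x ∈ beadSet N μ ↔ (N - 1 - x - (N / 2 : ℕ) : ℤ) ∈ maya μ := by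
  have hx := x.isLt
  rw [mem_beadSet]
  split_ifs with hx2
  · obtain ⟨h1, h2, h3⟩ := h (N - 1 - x)
    have e : (N - 1 - x - (N / 2 : ℕ) : ℤ) = -(N / 2 + x - N : ℕ) - 1 := by omega
    rw [e, mem_maya_neg]
    have e2 := h.mem_parts (i := N - 1 - x) (p := 4 * (N / 2 + x - N) + 3) (by omega)
    rw [e2 (by omega) (by omega) (by omega)]
    omega
  · obtain ⟨h1, h2, h3⟩ := h x
    have e : (N - 1 - x - (N / 2 : ℕ) : ℤ) = (N - 1 - x - N / 2 : ℕ) := by omega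
    rw [e, mem_maya_natCast, h.mem_parts (i := x) (by omega) (by omega) (by omega) (by omega)]
    omega

theorem IsBarShape.mem_maya_of_lt {N : ℕ} {μ : YoungDiagram} (h : IsBarShape N μ) {y : ℤ}
    (hy : y < -(N / 2 : ℕ)) : y ∈ maya μ := by
  obtain ⟨k, rfl⟩ : ∃ k : ℕ, y = -k - 1 := ⟨(-y - 1).toNat, by omega⟩
  rw [mem_maya_neg]
  intro hk
  obtain ⟨hp, i, hi, h1, h2, h3⟩ := h.exists_of_mem_parts hk
  omega

theorem IsBarShape.lt_of_mem_maya {N : ℕ} {μ : YoungDiagram} (h : IsBarShape N μ) {y : ℤ}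
    (hy : y ∈ maya μ) : y < N - (N / 2 : ℕ) := by
  by_contra hc
  obtain ⟨k, rfl⟩ : ∃ k : ℕ, y = k := ⟨y.toNat, by omega⟩
  rw [mem_maya_natCast] at hy
  obtain ⟨hp, i, hi, h1, h2, h3⟩ := h.exists_of_mem_parts hy
  omega

theorem exists_orderEmbOfFin_eq {N a : ℕ} (s : Finset (Fin N)) (hs : s.card = a) {x : Fin N}
    (hx : x ∈ s) : ∃ k : Fin a, s.orderEmbOfFin hs k = x := by
  have : x ∈ Set.range (s.orderEmbOfFin hs) := by rwa [Finset.range_orderEmbOfFin]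
  exact this

/-- The Maya diagram of a bar shape in descending order. -/
theorem IsBarShape.mayaSeq_eq {N a : ℕ} {μ : YoungDiagram} (h : IsBarShape N μ)
    (ha : (beadSet N μ).card = a) (k : ℕ) : mayaSeq μ k =
      if hk : k < a then (N - 1 - ((beadSet N μ).orderEmbOfFin ha ⟨k, hk⟩ : ℕ) - (N / 2 : ℕ) : ℤ)
      else a - k - 1 - (N / 2 : ℕ) := by
  set f : ℕ → ℤ := fun k =>
    if hk : k < a then N - 1 - ((beadSet N μ).orderEmbOfFin ha ⟨k, hk⟩ : ℕ) - (N / 2 : ℕ)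
      else a - k - 1 - (N / 2 : ℕ) with hf
  have hanti : StrictAnti f := by
    intro k l hkl
    simp only [hf]
    split_ifs with h1 h2 h2
    · have : (beadSet N μ).orderEmbOfFin ha ⟨k, h2⟩ < (beadSet N μ).orderEmbOfFin ha ⟨l, h1⟩ :=
        (OrderEmbedding.lt_iff_lt _).mpr hkl
      rw [Fin.lt_def] at this
      omega
    · omega
    · have := ((beadSet N μ).orderEmbOfFin ha ⟨k, h2⟩).isLt
      omega
    · omega
  have hrange : Set.range f = maya μ := by
    ext y
    constructor
    · rintro ⟨k, rfl⟩
      simp only [hf]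
      split_ifs with h1
      · exact (h.mem_beadSet_iff _).mp (Finset.orderEmbOfFin_mem _ _ _)
      · exact h.mem_maya_of_lt (by omega)
    · intro hy
      by_cases hlt : y < -(N / 2 : ℕ)
      · refine ⟨(a - 1 - (N / 2 : ℕ) - y).toNat, ?_⟩
        simp only [hf]
        rw [dif_neg (by omega)]
        omega
      · have := h.lt_of_mem_maya hy
        obtain ⟨x, hx⟩ : ∃ x : ℕ, (x : ℤ) = N - 1 - y - (N / 2 : ℕ) :=
          ⟨(N - 1 - y - (N / 2 : ℕ)).toNat, by omega⟩
        have hmem : (⟨x, by omega⟩ : Fin N) ∈ beadSet N μ := by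
          rw [h.mem_beadSet_iff]
          simp only [hx]
          rwa [show (N : ℤ) - 1 - (N - 1 - y - (N / 2 : ℕ)) - (N / 2 : ℕ) = y by ring]
        obtain ⟨k, hk⟩ := exists_orderEmbOfFin_eq _ ha hmem
        refine ⟨k, ?_⟩
        simp only [hf]
        rw [dif_pos k.isLt, hk]
        simp only
        omega
  have e : mayaSeq μ = f := by
    -- A strictly decreasing sequence is determined by its range.
    have h1 := (StrictMono.range_inj (mayaSeq_strictAnti μ).dual_right hanti.dual_right).mp (by
      rw [Set.range_comp, Set.range_comp, range_mayaSeq, hrange])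
    exact h1
  rw [e]

theorem IsBarShape.charge_eq {N a : ℕ} {μ : YoungDiagram} (h : IsBarShape N μ)
    (ha : (beadSet N μ).card = a) : charge μ = a - (N / 2 : ℕ) := by
  obtain ⟨K, hK⟩ := mayaSeq_eventually μ
  -- The charge is read off at an index beyond both the beads and the point of stabilization.
  have := hK (K + a) (by omega)
  rw [h.mayaSeq_eq ha, dif_neg (by omega)] at this
  push_cast at this ⊢
  omega

variable {R : Type*} [CommRing R] [Algebra ℚ R]

/-- If x_k is the k-th bead, counted from 0, the k-th part of μ[1] is N - a + k - x_k. The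
Jacobi–Trudi matrix is then the transposed minor with its columns reversed. -/
theorem IsBarShape.schurS_quot1 {N a : ℕ} {μ : YoungDiagram} (h : IsBarShape N μ)
    (ha : (beadSet N μ).card = a) (t : ℕ+ → R) : schurS (quot1 μ) t
      = (∏ i : Fin a, (-1) ^ (i : ℕ)) * (Matrix.of fun i j : Fin a =>
        hInt t (N - 1 - ((beadSet N μ).orderEmbOfFin ha j : Fin N) - i)).det := by
  have hlen : (quot1 μ).colLen 0 ≤ a := by
    rw [← rowLen_eq_zero_iff]
    have := rowLen_quot1 μ a
    rw [h.charge_eq ha, h.mayaSeq_eq ha, dif_neg (lt_irrefl a)] at this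
    omega
  have htr := Matrix.det_transpose (Matrix.of fun i j : Fin a =>
    hInt t (N - 1 - ((beadSet N μ).orderEmbOfFin ha j : Fin N) - i))
  rw [schurS_eq_det _ t hlen, ← htr]
  refine Eq.trans ?_ (det_reverse_columns fun i j : Fin a =>
        hInt t (N - 1 - ((beadSet N μ).orderEmbOfFin ha i : Fin N) - j))
  congr 1
  ext i j
  simp only [Matrix.of_apply]
  rw [rowLen_quot1, h.charge_eq ha, h.mayaSeq_eq ha, dif_pos i.isLt]
  congr 1
  have := j.isLt
  rw [Fin.val_rev]
  simp only [Fin.eta]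
  omega

end Beads

end

end MixedExpansion

namespace MixedExpansion

noncomputable section

/-! ### Unpaired indices and μ[0]. -/

section BeadValues

/-- The indices of the basis vectors attached to a set of beads. -/
def beadVals {N : ℕ} (s : Finset (Fin N)) : Finset ℤ :=
  s.image fun x : Fin N => 2 * (x : ℤ) - (N - 1)

theorem card_beadVals {N : ℕ} (s : Finset (Fin N)) : (beadVals s).card = s.card := by
  refine Finset.card_image_of_injective _ fun x y h => ?_
  ext
  omega

theorem mem_beadVals {N : ℕ} {s : Finset (Fin N)} {b : ℤ} :
    b ∈ beadVals s ↔ ∃ x ∈ s, 2 * (x : ℤ) - (N - 1) = b := by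
  rw [beadVals, Finset.mem_image]

theorem mem_beadVals_beadSet_of_neg {N : ℕ} {μ : YoungDiagram} {b : ℤ} (hb : b < 0) :
    b ∈ beadVals (beadSet N μ) ↔ ∃ i : ℕ, 2 * i + 1 < N ∧ b = -(N - 1 - 2 * i) ∧
      μ.rowLen i % 4 = 1 := by
  rw [mem_beadVals]
  constructor
  · rintro ⟨x, hx, rfl⟩
    rw [mem_beadSet, if_neg (by omega)] at hx
    exact ⟨x, by omega, by ring, hx⟩
  · rintro ⟨i, hi, rfl, h⟩
    refine ⟨⟨i, by omega⟩, ?_, by simp only; ring⟩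
    rw [mem_beadSet, if_neg (by simp only; omega)]
    exact h

theorem mem_beadVals_beadSet_of_pos {N : ℕ} {μ : YoungDiagram} {b : ℤ} (hb : 0 < b) :
    b ∈ beadVals (beadSet N μ) ↔ ∃ i : ℕ, 2 * i + 1 < N ∧ b = N - 1 - 2 * i ∧
      μ.rowLen i % 4 ≠ 3 := by
  rw [mem_beadVals]
  constructor
  · rintro ⟨x, hx, rfl⟩
    rw [mem_beadSet, if_pos (by omega)] at hx
    exact ⟨N - 1 - x, by omega, by omega, hx⟩
  · rintro ⟨i, hi, rfl, h⟩
    refine ⟨⟨N - 1 - i, by omega⟩, ?_, by simp only; omega⟩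
    rw [mem_beadSet, if_pos (by simp only; omega)]
    rwa [show N - 1 - (N - 1 - i) = i by omega]

theorem IsBarShape.zero_mem_beadVals {N : ℕ} {μ : YoungDiagram} (h : IsBarShape N μ) :
    0 ∈ beadVals (beadSet N μ) ↔ Odd N ∧ 1 ∈ parts μ := by
  rw [mem_beadVals]
  constructor
  · rintro ⟨x, hx, e⟩
    rw [mem_beadSet, if_neg (by omega)] at hx
    obtain ⟨h1, h2, h3⟩ := h x
    refine ⟨⟨x, by omega⟩, ?_⟩
    rw [h.mem_parts (i := x) (by omega) (by omega) (by omega) (by omega)]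
    omega
  · rintro ⟨⟨m, rfl⟩, h1⟩
    rw [h.mem_parts (i := m) (by omega) (by omega) (by omega) (by omega)] at h1
    refine ⟨⟨m, by omega⟩, ?_, by simp only; push_cast; ring⟩
    rw [mem_beadSet, if_neg (by simp only; omega)]
    simp only [h1]

theorem neg_mem_beadVals {N : ℕ} {μ : YoungDiagram} :
    ∀ b ∈ beadVals (beadSet N μ), b < 0 → -b ∈ beadVals (beadSet N μ) := by
  intro b hb hneg
  rw [mem_beadVals_beadSet_of_neg hneg] at hb
  obtain ⟨i, hi, rfl, h⟩ := hb
  rw [mem_beadVals_beadSet_of_pos (by omega)]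
  exact ⟨i, hi, by ring, by omega⟩

/-- A row contributes b without -b exactly when its length is the even number 2b, so the positive
unpaired indices are the parts of μ[0]. -/
theorem IsBarShape.mem_unpaired {N : ℕ} {μ : YoungDiagram} (h : IsBarShape N μ) {b : ℤ} :
    b ∈ unpaired (beadVals (beadSet N μ)) ↔
      (∃ x : ℕ, 2 * x ∈ parts μ ∧ b = x) ∨ b = 0 ∧ 0 ∈ beadVals (beadSet N μ) := by
  rw [unpaired, Finset.mem_filter]
  rcases lt_trichotomy b 0 with hb | rfl | hb
  · constructor
    · omega
    · rintro (⟨x, -, rfl⟩ | ⟨rfl, -⟩) <;> omega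
  · constructor
    · exact fun h => Or.inr ⟨rfl, h.1⟩
    · rintro (⟨x, hx, e⟩ | h)
      · have := (mem_parts_iff.mp hx).1
        omega
      · exact ⟨h.2, le_rfl, Or.inl rfl⟩
  · rw [mem_beadVals_beadSet_of_pos hb, mem_beadVals_beadSet_of_neg (by omega)]
    constructor
    · rintro ⟨⟨i, hi, rfl, h3⟩, -, h4 | h4⟩
      · omega
      · refine Or.inl ⟨N - 1 - 2 * i, ?_, by omega⟩
        rw [h.mem_parts (i := i) (by omega) (by omega) (by omega) (by omega)]
        by_contra hc
        obtain ⟨h5, h6, h7⟩ := h i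
        exact h4 ⟨i, hi, rfl, by omega⟩
    · rintro (⟨x, hx, rfl⟩ | h)
      · obtain ⟨h0, i, hi, h1, h2, h3⟩ := h.exists_of_mem_parts hx
        refine ⟨⟨i, by omega, by omega, by omega⟩, by omega, Or.inr ?_⟩
        rintro ⟨j, hj, e, h4⟩
        have : i = j := by omega
        subst this
        omega
      · omega

theorem mem_rowLens_quot0 {μ : YoungDiagram} {x : ℕ} :
    x ∈ (quot0 μ).rowLens ↔ 2 * x ∈ parts μ := by
  rw [quot0, YoungDiagram.rowLens_ofRowLens_eq_self]
  · rw [Finset.mem_sort, Finset.mem_image]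
    constructor
    · rintro ⟨p, hp, rfl⟩
      rw [Finset.mem_filter] at hp
      rw [show 2 * (p / 2) = p by omega]
      exact hp.1
    · intro h
      exact ⟨2 * x, Finset.mem_filter.mpr ⟨h, by omega⟩, by omega⟩
  · intro x hx
    rw [Finset.mem_sort, Finset.mem_image] at hx
    obtain ⟨p, hp, rfl⟩ := hx
    rw [Finset.mem_filter, mem_parts_iff] at hp
    omega

theorem rowLens_quot0_sortedGT (μ : YoungDiagram) : (quot0 μ).rowLens.SortedGT := by
  rw [quot0, YoungDiagram.rowLens_ofRowLens_eq_self]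
  · exact Finset.sortedGT_sort _
  · intro x hx
    rw [Finset.mem_sort, Finset.mem_image] at hx
    obtain ⟨p, hp, rfl⟩ := hx
    rw [Finset.mem_filter, mem_parts_iff] at hp
    omega

open Classical in
/-- The unpaired indices in decreasing order. -/
theorem IsBarShape.sort_unpaired {N : ℕ} {μ : YoungDiagram} (h : IsBarShape N μ) :
    (unpaired (beadVals (beadSet N μ))).sort (· ≤ ·)
      = (((quot0 μ).rowLens.map fun x : ℕ => (x : ℤ)) ++
        if 0 ∈ beadVals (beadSet N μ) then [0] else []).reverse := by
  refine (Finset.sortedLT_sort _).eq_of_mem_iff ?_ ?_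
  · rw [List.sortedLT_iff_pairwise, List.pairwise_reverse, List.pairwise_append]
    refine ⟨?_, ?_, ?_⟩
    · rw [List.pairwise_map]
      exact (rowLens_quot0_sortedGT μ).pairwise.imp fun h => by exact_mod_cast h
    · split_ifs <;> simp
    · intro x hx y hy
      rw [List.mem_map] at hx
      obtain ⟨z, hz, rfl⟩ := hx
      have := YoungDiagram.pos_of_mem_rowLens _ _ hz
      split_ifs at hy
      · rw [List.mem_singleton] at hy
        omega
      · simp at hy
  · intro b
    rw [Finset.mem_sort, h.mem_unpaired, List.mem_reverse, List.mem_append, List.mem_map]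
    refine or_congr ?_ ?_
    · simp only [mem_rowLens_quot0]
      exact exists_congr fun x => and_congr_right fun _ => eq_comm
    · split_ifs with h0 <;> simp [h0]

variable {R : Type*} [CommRing R] [Algebra ℚ R] [IsDomain R] [CharZero R]

theorem fock_orderEmbOfFin (t : ℕ+ → R) {N a : ℕ} (s : Finset (Fin N)) (hs : s.card = a) :
    fock t (ExteriorAlgebra.ιMulti R a fun j =>
      basisVec R (2 * (s.orderEmbOfFin hs j : Fin N) - (N - 1))) = fockSet t (beadVals s) := by
  rw [ιMulti_basisVec, fockSet]
  congr 2
  refine List.SortedLT.eq_of_mem_iff ?_ (Finset.sortedLT_sort _) ?_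
  · rw [List.sortedLT_ofFn_iff]
    intro i j hij
    have := (OrderEmbedding.lt_iff_lt (s.orderEmbOfFin hs)).mpr hij
    rw [Fin.lt_def] at this
    simp only
    omega
  · intro b
    rw [List.mem_ofFn', Finset.mem_sort, mem_beadVals]
    constructor
    · rintro ⟨j, rfl⟩
      exact ⟨_, Finset.orderEmbOfFin_mem _ _ _, rfl⟩
    · rintro ⟨x, hx, rfl⟩
      obtain ⟨k, rfl⟩ := exists_orderEmbOfFin_eq s hs hx
      exact ⟨k, rfl⟩

/-- Index sets are read in increasing order and parts in decreasing order, which accounts for the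
sign; a bead at 0 does not change the Q-function. -/
theorem IsBarShape.fockSet_unpaired {N : ℕ} {μ : YoungDiagram} (h : IsBarShape N μ) (t : ℕ+ → R) :
    fockSet t (unpaired (beadVals (beadSet N μ)))
      = (∏ i : Fin (unpaired (beadVals (beadSet N μ))).card, (-1) ^ (i : ℕ)) *
        schurQ (quot0 μ) t := by
  classical
  have hs := h.sort_unpaired
  have hlen := congrArg List.length hs
  rw [Finset.length_sort, List.length_reverse] at hlen
  rw [fockSet, hs, prodVec_reverse, map_smul, smul_eq_mul, hlen]
  congr 1
  split_ifs
  · exact fock_rowLens_append_zero _ _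
  · rw [List.append_nil]
    exact fock_rowLens _ _

end BeadValues

end

end MixedExpansion

namespace MixedExpansion

noncomputable section

/-! ### Comparison of the Pfaffian signs with δ(μ). -/

section Sign

theorem card_eq_unpaired {B : Finset ℤ} (hB : ∀ b ∈ B, b < 0 → -b ∈ B) :
    B.card = (unpaired B).card + 2 * (B.filter (· < 0)).card := by
  have e1 : B = unpaired B ∪ ((B.filter (· < 0)) ∪ (B.filter fun x => 0 < x ∧ -x ∈ B)) := by
    ext x
    simp only [unpaired, Finset.mem_filter, Finset.mem_union]
    by_cases hx : x ∈ B
    · by_cases hnx : -x ∈ B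
      · simp only [hx, hnx, true_and, not_true, or_false, and_true, true_iff]; omega
      · have : ¬ x < 0 := fun h => hnx (hB x hx h)
        simp only [hx, hnx, true_and, not_false_iff, or_true, and_true, and_false, or_false,
          true_iff]
        omega
    · simp [hx]
  have e2 : (B.filter (· < 0)).card = (B.filter fun x => 0 < x ∧ -x ∈ B).card := by
    refine Finset.card_bij' (fun x _ => -x) (fun x _ => -x) ?_ ?_ ?_ ?_
    · intro x hx
      simp only [Finset.mem_filter] at hx ⊢
      exact ⟨hB x hx.1 hx.2, by omega, by rw [neg_neg]; exact hx.1⟩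
    · intro x hx
      simp only [Finset.mem_filter] at hx ⊢
      exact ⟨hx.2.2, by omega⟩
    · intro x _; exact neg_neg x
    · intro x _; exact neg_neg x
  conv_lhs => rw [e1]
  rw [Finset.card_union_of_disjoint, Finset.card_union_of_disjoint, ← e2, two_mul]
  · rw [Finset.disjoint_left]
    intro x h1 h2
    simp only [Finset.mem_filter] at h1 h2
    omega
  · rw [Finset.disjoint_left]
    intro x h1 h2
    simp only [unpaired, Finset.mem_filter, Finset.mem_union] at h1 h2
    rcases h2 with h2 | h2
    · omega
    · rcases h1.2.2 with h | h
      · omega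
      · exact h h2.2.2

theorem prod_neg_one_pow_add {S : Type*} [CommRing S] (p z : ℕ) :
    ∏ i : Fin (p + 2 * z), (-1 : S) ^ (i : ℕ) = (-1) ^ z * ∏ i : Fin p, (-1 : S) ^ (i : ℕ) := by
  rw [Fin.prod_univ_eq_prod_range fun i => (-1 : S) ^ i,
    Fin.prod_univ_eq_prod_range fun i => (-1 : S) ^ i]
  induction z with
  | zero => simp
  | succ z ih =>
    rw [show p + 2 * (z + 1) = p + 2 * z + 1 + 1 by ring, Finset.prod_range_succ,
      Finset.prod_range_succ, ih, mul_assoc, ← pow_add,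
      show p + 2 * z + (p + 2 * z + 1) = 2 * (p + 2 * z) + 1 by ring, pow_add, pow_mul]
    ring

theorem sign_eq_prod (M : ℤ) (μ : YoungDiagram) : sign M μ
    = ∏ c ∈ centralBeads μ, (-1) ^ ((leftBeads M μ).filter (· < c)).card := by
  rw [sign, Finset.prod_pow_eq_pow_sum, Finset.card_filter, Finset.sum_product_right]
  simp only [Finset.card_filter]

/-- Halving matches the even parts below `c` with the positive unpaired indices below N - 1 - 2i.
For odd `N` exactly one of the two sides also contains 0, according to whether 1 is a part; this
shifts the parity by `N`. -/
theorem IsBarShape.card_left {N : ℕ} {μ : YoungDiagram} (h : IsBarShape N μ) {M : ℤ}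
    (hM : (M < 0 ∧ μ.rowLen (-M).toNat = 0) ↔ (Odd N ∧ 1 < N ∧ 1 ∉ parts μ)) {c i : ℕ}
    (hi : 2 * i + 1 < N) (hc : μ.rowLen i = c) (hc4 : c % 4 = 1) :
    (-1 : ℤ) ^ ((leftBeads M μ).filter (· < c)).card
      = (-1) ^ (((unpaired (beadVals (beadSet N μ))).filter (· < (N - 1 - 2 * i : ℤ))).card + N) := by
  classical
  set E := ((parts μ).filter fun a => a % 2 = 0).filter (· < c) with hE
  obtain ⟨h1, h2, h3⟩ := h i
  have hleft : (leftBeads M μ).filter (· < c)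
      = E ∪ if Odd N ∧ 1 < N ∧ 1 ∉ parts μ then {0} else ∅ := by
    rw [leftBeads, Finset.filter_union, if_congr hM rfl rfl]
    congr 1
    split_ifs
    · ext x
      simp only [Finset.mem_filter, Finset.mem_singleton]
      omega
    · rfl
  have h0E : 0 ∉ E := fun h0 => by
    have := (mem_parts_iff.mp (Finset.mem_filter.mp (Finset.mem_filter.mp h0).1).1).1
    omega
  have hright : (unpaired (beadVals (beadSet N μ))).filter (· < (N - 1 - 2 * i : ℤ))
      = (E.image fun p : ℕ => ((p / 2 : ℕ) : ℤ)) ∪ if Odd N ∧ 1 ∈ parts μ then {0} else ∅ := by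
    ext b
    rw [Finset.mem_filter, h.mem_unpaired, h.zero_mem_beadVals, Finset.mem_union, Finset.mem_image,
      or_and_right]
    refine or_congr ?_ ?_
    · constructor
      · rintro ⟨⟨x, hx, rfl⟩, hlt⟩
        refine ⟨2 * x, ?_, by omega⟩
        rw [hE, Finset.mem_filter, Finset.mem_filter]
        exact ⟨⟨hx, by omega⟩, by omega⟩
      · rintro ⟨p, hp, rfl⟩
        rw [hE, Finset.mem_filter, Finset.mem_filter] at hp
        obtain ⟨⟨hp1, hp2⟩, hp3⟩ := hp
        refine ⟨⟨p / 2, by rwa [show 2 * (p / 2) = p by omega], rfl⟩, ?_⟩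
        by_contra hcon
        have := (h.mem_parts (i := i) (p := p) (by omega) (by omega) (by omega) (by omega)).mp hp1
        omega
    · split_ifs with hodd
      · simp only [hodd, Finset.mem_singleton]
        simp
        omega
      · simp [hodd]
  have hcard : (E.image fun p : ℕ => ((p / 2 : ℕ) : ℤ)).card = E.card := by
    refine Finset.card_image_of_injOn fun p hp q hq e => ?_
    simp only [hE, Finset.coe_filter, Finset.mem_filter, Set.mem_ofPred_eq] at hp hq e
    omega
  have h0E' : (0 : ℤ) ∉ E.image fun p : ℕ => ((p / 2 : ℕ) : ℤ) := fun h0 => by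
    rw [Finset.mem_image] at h0
    obtain ⟨p, hp, e⟩ := h0
    have hp' := Finset.mem_filter.mp (Finset.mem_filter.mp hp).1
    have := (mem_parts_iff.mp hp'.1).1
    omega
  rw [hleft, hright]
  rcases Nat.even_or_odd N with hN | hN
  · have hN' : ¬ Odd N := Nat.not_odd_iff_even.mpr hN
    simp only [hN', false_and, if_false, Finset.union_empty, hcard, pow_add, hN.neg_one_pow, mul_one]
  · by_cases hp : 1 ∈ parts μ
    · simp only [hp, not_true, and_false, if_false, Finset.union_empty, hN, true_and, if_true]
      rw [Finset.card_union_of_disjoint (Finset.disjoint_singleton_right.mpr h0E'), hcard,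
        Finset.card_singleton, pow_add, pow_add, hN.neg_one_pow]
      simp
    · simp only [hp, not_false_iff, and_true, hN, true_and, and_false, if_false,
        Finset.union_empty]
      rw [if_pos (by omega), Finset.card_union_of_disjoint
        (Finset.disjoint_singleton_right.mpr h0E), hcard, Finset.card_singleton, pow_add, pow_add,
        hN.neg_one_pow]
      simp

theorem IsBarShape.sign_eq {N : ℕ} {μ : YoungDiagram} (h : IsBarShape N μ) {M : ℤ}
    (hM : (M < 0 ∧ μ.rowLen (-M).toNat = 0) ↔ (Odd N ∧ 1 < N ∧ 1 ∉ parts μ)) :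
    sign M μ = ∏ b ∈ (beadVals (beadSet N μ)).filter (· < 0),
      (-1) ^ (((unpaired (beadVals (beadSet N μ))).filter (· < -b)).card + N) := by
  classical
  rw [sign_eq_prod]
  symm
  -- A negative bead of index b comes from a row of length congruent to 1 modulo 4, which is 2|b| -
  -- 1 for even `N` and 2|b| + 1 for odd `N`.
  refine Finset.prod_of_injOn
    (fun b : ℤ => if Even N then 2 * b.natAbs - 1 else 2 * b.natAbs + 1) ?_ ?_ ?_ ?_
  · intro b hb b' hb' e
    simp only [Finset.coe_filter, Set.mem_ofPred_eq] at hb hb' e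
    split_ifs at e <;> omega
  · intro b hb
    simp only [Finset.coe_filter, Set.mem_ofPred_eq] at hb
    obtain ⟨i, hi, rfl, hr⟩ := (mem_beadVals_beadSet_of_neg hb.2).mp hb.1
    obtain ⟨h1, h2, h3⟩ := h i
    simp only [centralBeads, Finset.coe_filter, Set.mem_ofPred_eq, mem_parts_iff, Nat.even_iff]
    refine ⟨⟨?_, i, ?_⟩, ?_⟩ <;> split_ifs <;> omega
  · intro c hc hnot
    rw [centralBeads, Finset.mem_filter] at hc
    obtain ⟨h0, i, hi, h1, h2, h3⟩ := h.exists_of_mem_parts hc.1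
    by_cases hi' : 2 * i + 1 < N
    · refine absurd ?_ hnot
      refine ⟨-(N - 1 - 2 * i), ?_, ?_⟩
      · simp only [Finset.coe_filter, Set.mem_ofPred_eq]
        refine ⟨(mem_beadVals_beadSet_of_neg (by omega)).mpr ⟨i, hi', rfl, by omega⟩, by omega⟩
      · simp only [Nat.even_iff]
        split_ifs <;> omega
    -- The middle row of odd `N` gives the part 1 without a negative bead. Its factor is 1, since
    -- the left bead at 0 is absent when 1 is a part.
    · have hc1 : c = 1 := by omega
      subst hc1
      have : (leftBeads M μ).filter (· < 1) = ∅ := by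
        rw [Finset.filter_eq_empty_iff]
        intro x hx hlt
        rw [leftBeads, if_neg (by rw [hM]; exact fun h => h.2.2 hc.1), Finset.union_empty,
          Finset.mem_filter, mem_parts_iff] at hx
        omega
      rw [this]
      rfl
  · intro b hb
    rw [Finset.mem_filter] at hb
    obtain ⟨i, hi, rfl, hr⟩ := (mem_beadVals_beadSet_of_neg hb.2).mp hb.1
    obtain ⟨h1, h2, h3⟩ := h i
    rw [h.card_left hM hi (c := if Even N then 2 * (-((N : ℤ) - 1 - 2 * i)).natAbs - 1 else
      2 * (-((N : ℤ) - 1 - 2 * i)).natAbs + 1), neg_neg]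
    · simp only [Nat.even_iff]
      split_ifs <;> omega
    · simp only [Nat.even_iff]
      split_ifs <;> omega

variable {R : Type*} [CommRing R] [Algebra ℚ R] [IsDomain R] [CharZero R]

/-- The contribution of a bar shape to the expansion. -/
theorem IsBarShape.term_eq {N a : ℕ} {μ : YoungDiagram} (h : IsBarShape N μ) {M : ℤ}
    (hM : (M < 0 ∧ μ.rowLen (-M).toNat = 0) ↔ (Odd N ∧ 1 < N ∧ 1 ∉ parts μ))
    (ha : (beadSet N μ).card = a) (t t' : ℕ+ → R) :
    (sign M μ : R) * schurQ (quot0 μ) t * schurS (quot1 μ) t'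
      = (Matrix.of fun i j : Fin a =>
        hInt t' (N - 1 - ((beadSet N μ).orderEmbOfFin ha j : Fin N) - i)).det *
        fockSet t (beadVals (beadSet N μ)) := by
  set B := beadVals (beadSet N μ) with hBdef
  have hB : ∀ b ∈ B, b < 0 → -b ∈ B := neg_mem_beadVals
  have hcard : a = (unpaired B).card + 2 * (B.filter (· < 0)).card := by
    rw [← card_eq_unpaired hB, hBdef, card_beadVals, ha]
  have hprod : (∏ b ∈ B.filter (· < 0),
      (-1 : R) ^ (b.natAbs + (B.filter fun x => b < x ∧ x < -b).card))
      = (-1) ^ (B.filter (· < 0)).card * (sign M μ : R) := by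
    rw [h.sign_eq hM, ← Finset.prod_const, Int.cast_prod, ← Finset.prod_mul_distrib]
    refine Finset.prod_congr rfl fun b hb => ?_
    rw [pow_add, neg_one_pow_card_between hB]
    rw [Finset.mem_filter] at hb
    obtain ⟨i, hi, hbi, hr⟩ := (mem_beadVals_beadSet_of_neg hb.2).mp hb.1
    -- Thus each pair leaves one factor -1 besides its factor in δ(μ). These factors cancel against
    -- the difference between the reversal signs for all beads and for the unpaired ones.
    have hpar : (-1 : R) ^ b.natAbs = -(-1) ^ N := by
      rw [show b.natAbs = N - 1 - 2 * i by omega]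
      conv_rhs => rw [show N = (N - 1 - 2 * i) + 1 + 2 * i by omega]
      rw [pow_add, pow_add, pow_mul]
      simp
    rw [hpar]
    push_cast
    rw [pow_add]
    ring
  rw [h.schurS_quot1 ha, fockSet_eq_unpaired t _ rfl hB, h.fockSet_unpaired, hprod]
  have hs := prod_neg_one_pow_add (S := R) (unpaired B).card (B.filter (· < 0)).card
  rw [← hcard] at hs
  rw [hs]
  ring

end Sign

end

end MixedExpansion

namespace MixedExpansion

noncomputable section

/-! ### Bar shapes as admissible bead sets, and the summation. -/

section Expansion

theorem IsBarShape.eq_of_beadSet_eq {N : ℕ} {μ ν : YoungDiagram} (hμ : IsBarShape N μ)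
    (hν : IsBarShape N ν) (h : beadSet N μ = beadSet N ν) : μ = ν := by
  refine youngDiagram_ext fun i => ?_
  obtain ⟨h1, h2, h3⟩ := hμ i
  obtain ⟨h4, h5, h6⟩ := hν i
  by_cases hi : 2 * i < N
  · have e1 : μ.rowLen i % 4 = 1 ↔ ν.rowLen i % 4 = 1 := by
      have := Finset.ext_iff.mp h ⟨i, by omega⟩
      simpa only [mem_beadSet, if_neg (show ¬ N ≤ 2 * i by omega)] using this
    by_cases hi' : 2 * i + 1 < N
    · have e2 : μ.rowLen i % 4 ≠ 3 ↔ ν.rowLen i % 4 ≠ 3 := by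
        have := Finset.ext_iff.mp h ⟨N - 1 - i, by omega⟩
        simpa only [mem_beadSet, if_pos (show N ≤ 2 * (N - 1 - i) by omega),
          show N - 1 - (N - 1 - i) = i by omega] using this
      omega
    · omega
  · omega

theorem exists_isBarShape {N : ℕ} {s : Finset (Fin N)}
    (hs : ∀ b ∈ beadVals s, b < 0 → -b ∈ beadVals s) :
    ∃ μ, IsBarShape N μ ∧ beadSet N μ = s := by
  classical
  let p : ℕ → Prop := fun x => ∃ h : x < N, (⟨x, h⟩ : Fin N) ∈ s
  have hp : ∀ x : Fin N, x ∈ s ↔ p x := fun x => ⟨fun h => ⟨x.isLt, h⟩, fun h => h.2⟩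
  have hpair : ∀ i, 2 * i + 1 < N → p i → p (N - 1 - i) := by
    rintro i hi ⟨hi', hmem⟩
    have := hs (2 * (i : ℤ) - (N - 1)) (mem_beadVals.mpr ⟨_, hmem, rfl⟩) (by omega)
    obtain ⟨x, hx, e⟩ := mem_beadVals.mp this
    rw [show N - 1 - i = (x : ℕ) by omega]
    exact (hp x).mp hx
  -- The row lengths are decoded from the bead states: both beads require a length congruent to 1
  -- modulo 4, none a length congruent to 3, and the parity of `N` decides which of these is 2b - 1
  -- and which is 2b + 1.
  let f : ℕ → ℕ := fun i =>
    if 2 * i + 1 < N then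
      (if p i then (if N % 2 = 0 then 2 * (N - 1 - 2 * i) - 1 else 2 * (N - 1 - 2 * i) + 1)
      else if p (N - 1 - i) then 2 * (N - 1 - 2 * i)
      else (if N % 2 = 0 then 2 * (N - 1 - 2 * i) + 1 else 2 * (N - 1 - 2 * i) - 1))
    else if 2 * i + 1 = N ∧ p i then 1 else 0
  have hf : ∀ i, 2 * (N - 1 - 2 * i) - 1 ≤ f i ∧
      (2 * i < N → f i ≤ 2 * (N - 1 - 2 * i) + 1) ∧ (N ≤ 2 * i → f i = 0) := by
    intro i
    simp only [f]
    split_ifs <;> omega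
  have hanti : Antitone f := by
    refine antitone_nat_of_succ_le fun i => ?_
    obtain ⟨h1, h2, h3⟩ := hf i
    obtain ⟨h4, h5, h6⟩ := hf (i + 1)
    omega
  refine ⟨ofSeq f hanti ⟨N, fun k hk => (hf k).2.2 (by omega)⟩, fun i => ?_, ?_⟩
  · rw [rowLen_ofSeq]
    exact hf i
  · ext x
    have hx := x.isLt
    rw [mem_beadSet, rowLen_ofSeq, rowLen_ofSeq, hp]
    split_ifs with h1
    · have e : N - 1 - (N - 1 - (x : ℕ)) = x := by omega
      simp only [f]
      rw [if_pos (by omega), e]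
      by_cases h2 : p (N - 1 - x)
      · have h3 := hpair _ (by omega) h2
        rw [e] at h3
        simp only [h2, h3, if_true, iff_true]
        split_ifs <;> omega
      · by_cases h3 : p x
        · simp only [h2, h3, if_true, if_false, iff_true]
          omega
        · simp only [h2, h3, if_false, iff_false]
          split_ifs <;> omega
    · simp only [f]
      by_cases h2 : p x
      · simp only [h2, if_true, and_true, iff_true]
        split_ifs <;> omega
      · simp only [h2, if_false, and_false, iff_false]
        split_ifs <;> first | exact not_false | omega

variable {R : Type*} [CommRing R] [Algebra ℚ R]

theorem rowLen_rect (a b i : ℕ) : (rect a b).rowLen i = if i < a then b else 0 := by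
  rw [rect, rowLen_ofSeq]

theorem schurS_rect (a b : ℕ) (t : ℕ+ → R) :
    schurS (rect a b) t = (Matrix.of fun i j : Fin a => hInt t (b + j - i)).det := by
  rw [schurS_eq_det (a := a)]
  · simp only [rowLen_rect, Fin.is_lt, if_true]
  · rw [← rowLen_eq_zero_iff, rowLen_rect, if_neg (lt_irrefl a)]

/-- The mixed expansion of a rectangular Schur function over a set of bar shapes. -/
theorem sum_isBarShape [IsDomain R] [CharZero R] [IsAddTorsionFree R] (t : ℕ+ → R) {N a : ℕ}
    {M : ℤ} (F : Finset YoungDiagram)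
    (hF : ∀ μ, μ ∈ F ↔ IsBarShape N μ ∧ (beadSet N μ).card = a)
    (hM : ∀ μ, IsBarShape N μ →
      ((M < 0 ∧ μ.rowLen (-M).toNat = 0) ↔ (Odd N ∧ 1 < N ∧ 1 ∉ parts μ))) :
    ∑ μ ∈ F, (sign M μ : R) * schurQ (quot0 μ) t * schurS (quot1 μ) (fun j => t (2 * j))
      = (Matrix.of fun i j : Fin a => hInt t (N - a + j - i)).det := by
  rw [det_rect_eq_sum]
  have hterm : ∀ s : Set.powersetCard (Fin N) a, ∀ μ, IsBarShape N μ → s.val = beadSet N μ →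
      (sign M μ : R) * schurQ (quot0 μ) t * schurS (quot1 μ) (fun j => t (2 * j))
      = (Matrix.of fun i j : Fin a => hInt (fun j => t (2 * j))
          (N - 1 - (Set.powersetCard.ofFinEmbEquiv.symm s j : Fin N) - i)).det *
        fock t (ExteriorAlgebra.ιMulti R a fun j =>
          basisVec R (2 * (Set.powersetCard.ofFinEmbEquiv.symm s j : Fin N) - (N - 1))) := by
    rintro ⟨s, hs⟩ μ hμ rfl
    rw [hμ.term_eq (hM μ hμ) hs t, ← fock_orderEmbOfFin t _ hs]
    rfl
  refine Finset.sum_bij_ne_zero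
    (fun μ hμ _ => (⟨beadSet N μ, ((hF μ).mp hμ).2⟩ : Set.powersetCard (Fin N) a)) ?_ ?_ ?_ ?_
  · intros
    exact Finset.mem_univ _
  · intro μ hμ _ ν hν _ e
    exact ((hF μ).mp hμ).1.eq_of_beadSet_eq ((hF ν).mp hν).1 (congrArg Subtype.val e)
  · rintro s - hne
    -- A subset with an unmatched negative index contributes 0; every other subset comes from a bar
    -- shape.
    have hpair : ∀ b ∈ beadVals s.val, b < 0 → -b ∈ beadVals s.val := by
      intro b hb hneg
      by_contra hc
      have h0 := fock_orderEmbOfFin t s.val s.prop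
      rw [fockSet_eq_zero t _ rfl hb hneg hc] at h0
      refine hne ?_
      rw [show fock t (ExteriorAlgebra.ιMulti R a fun j =>
        basisVec R (2 * (Set.powersetCard.ofFinEmbEquiv.symm s j : Fin N) - (N - 1))) = 0 from h0,
        mul_zero]
    obtain ⟨μ, hμ, e⟩ := exists_isBarShape hpair
    refine ⟨μ, (hF μ).mpr ⟨hμ, by rw [e]; exact s.prop⟩, ?_, Subtype.ext e⟩
    rwa [hterm s μ hμ e.symm]
  · intro μ hμ _
    exact hterm _ μ ((hF μ).mp hμ).1 rfl

end Expansion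

end

end MixedExpansion

open MixedExpansion in
theorem theorem3p1 (m n : ℕ) :
    (∑ μ ∈ addFinset 1 n (core (m : ℤ)),
        (sign (m : ℤ) μ : MvPolynomial ℕ+ ℂ) * schurQ (quot0 μ) tVar *
          schurS (quot1 μ) (fun j => tVar (2 * j)) =
      if n ≤ 2 * m then schurS (rect (2 * m - n) n) tVar else 0) ∧
    (∑ μ ∈ addFinset 0 n (core (-(m : ℤ))),
        (sign (-(m : ℤ)) μ : MvPolynomial ℕ+ ℂ) * schurQ (quot0 μ) tVar *
          schurS (quot1 μ) (fun j => tVar (2 * j)) =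
      if n ≤ 2 * m + 1 then schurS (rect n (2 * m + 1 - n)) tVar else 0) := by
  constructor
  · split_ifs with hn
    · rw [sum_isBarShape tVar (N := 2 * m) (a := 2 * m - n), schurS_rect]
      · congr! 5
        omega
      · intro μ
        rw [mem_addFinset_one]
        refine and_congr_right fun h => ?_
        have := h.card_beadSet_even
        omega
      · intro μ _
        have : ¬ Odd (2 * m) := by simp
        simp only [this, false_and, iff_false]
        omega
    -- For n > 2m the index set is empty, since the number of beads plus `n` is 2m.
    · refine Finset.sum_eq_zero fun μ hμ => ?_
      obtain ⟨h, e⟩ := mem_addFinset_one.mp hμ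
      have := h.card_beadSet_even
      omega
  · split_ifs with hn
    · rw [sum_isBarShape tVar (N := 2 * m + 1) (a := n), schurS_rect]
      · congr! 5
        omega
      · intro μ
        rw [mem_addFinset_zero]
        refine and_congr_right fun h => ?_
        rw [h.card_beadSet_odd]
      -- Row m has length 0 or 1, so the vanishing of row m means that 1 is not a part. For m = 0
      -- both sides fail, as N = 1.
      · intro μ h
        have h0 := (h m).2.1 (by omega)
        rw [h.mem_parts (i := m) (by omega) (by omega) (by omega) (by omega)]
        simp only [neg_neg, Int.toNat_natCast, odd_two_mul_add_one, true_and]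
        omega
    · refine Finset.sum_eq_zero fun μ hμ => ?_
      obtain ⟨h, e⟩ := mem_addFinset_zero.mp hμ
      have h1 := h.card_beadSet_odd
      have h2 := Finset.card_le_univ (beadSet (2 * m + 1) μ)
      rw [Fintype.card_fin] at h2
      omega
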